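/- **Definitions.** A *graph* (Serre) has vertices and edges, origin and terminus maps $o,t$, and a fixed-point-free involution $e\mapsto e^{-1}$ exchanging $o$ and $t$. A *graph of groups* $\mathbb A$ on a graph $A$ has vertex groups $A_v$, edge groups $A_e=A_{e^{-1}}$ and monomorphisms $\alpha_e:A_e\to A_{o(e)}$, $\omega_e:A_e\to A_{t(e)}$ with $\alpha_{e^{-1}}=\omega_e$. An *$\mathbb A$-path* $\langle p_0,e_1,p_1,\dots,e_n,p_n\rangle$ of length $n$ is an edge path with elements $p_0\in A_{o(e_1)}$ and $p_i\in A_{t(e_i)}$ (for $n=0$, a single element $p_0$ of a vertex group). An *elementary reduction* replaces a subpath $\langle a,e,\omega_e(c),e^{-1},b\rangle$ by $\langle a\,\alpha_e(c)\,b\rangle$; a path is *reduced* if none applies; $\overline p$ is the class of $p$ under the equivalence generated by elementary reductions. $\pi_1(\mathbb A,v_0)$ is the group of classes of loops at $v_0$. An *$\mathbb A$-graph* $\mathbb B$ is a graph $B$ with a graph morphism $[\cdot]:B\to A$, subgroups $B_u\le A_{[u]}$, and elements $f_\alpha\in A_{[o(f)]}$, $f_\omega\in A_{[t(f)]}$ with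 $(f^{-1})_\alpha=(f_\omega)^{-1}$. It is itself a graph of groups, with vertex groups $B_u$, edge groups $$B_f=\alpha_{[f]}^{-1}(f_\alpha^{-1}B_{o(f)}f_\alpha)\cap\omega_{[f]}^{-1}(f_\omega B_{t(f)}f_\omega^{-1}),$$ $\alpha_f(g)=f_\alpha\alpha_{[f]}(g)f_\alpha^{-1}$ and $\omega_f(g)=f_\omega^{-1}\omega_{[f]}(g)f_\omega$. For a $\mathbb B$-path $q=\langle q_0,f_1,q_1,\dots,f_m,q_m\rangle$ put $\mu(q)=\langle q_0(f_1)_\alpha,[f_1],(f_1)_\omega q_1(f_2)_\alpha,\dots,[f_m],(f_m)_\omega q_m\rangle$, and let $\overline{L(\mathbb B,u,u')}=\{\overline{\mu(q)} : q \text{ a reduced } \mathbb B\text{-path from } u \text{ to } u'\}$. $\mathbb B$ is *folded* if - there are no edges $f_1,f_2$ with $t(f_1)=o(f_2)=u$, $f_1\ne f_2^{-1}$ and $[f_1]=[f_2^{-1}]=e$ such that $(f_1)_\omega\, b\,(f_2)_\alpha=\omega_e(c)$ for some $b\in B_u$, $c\in A_e$; and - $\alpha_{[f]}^{-1}(f_\alpha^{-1}B_{o(f)}f_\alpha)=\omega_{[f]}^{-1}(f_\omega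 B_{t(f)}f_\omega^{-1})$ for every edge $f$. Let $\mathbb A$ be a finite connected graph of finitely generated groups, with fixed finite generating lists of all vertex and edge groups; group elements are given to and returned by algorithms as words in these generators, and algorithms are computable functions. $\mathbb A$ is *benign* if 1. for each edge $e$ with $o(e)=v$, there is an algorithm that, given a finite $X\subset A_v$ and $a\in A_v$, decides whether $\langle X\rangle\cap a\,\alpha_e(A_e)$ is empty and, if not, produces an element of it in the form $a\,\alpha_e(c)$, by giving $c\in A_e$; 2. every subgroup of every edge group is finitely generated; 3. every edge group has decidable uniform membership problem (given finite $X\subset A_e$ and $a\in A_e$, decide whether $a\in\langle X\rangle$); 4. for each edge $e$ with $o(e)=v$, there is an algorithm that, given a finite $X\subset A_v$, computes a finite generating set (as words in the generators of $A_v$) of $\langle X\rangle\cap\alpha_e(A_e)$. **Theorem.** Let $\mathbb A$ be a benign graph of groups, $v_0$ a vertex and $G=\pi_1(\mathbb A,v_0)$. There is an algorithm that, given a finite list of $\mathbb A$-loops at $v_0$ generating a subgroup $H\le G$, and an $\mathbb A$-loop at $v_0$ representing $x\in G$, produces - an element $y\in A_{v_0}$ (an element of $G$ of path length $0$) with $yH=xH$,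 if such a $y$ exists, and - otherwise a finite folded $\mathbb A$-graph $\mathbb B^{(x)}$, with its vertex groups given by finite generating sets, with vertices $u_x,u_0$ of type $v_0$ such that $\overline{L(\mathbb B^{(x)},u_x,u_0)}=xH$. Likewise for right cosets: there is an algorithm that, given the same data, produces $y\in A_{v_0}$ with $Hy=Hx$ if such a $y$ exists, and otherwise a finite folded $\mathbb A$-graph, in the same form, with vertices $u_x,u_0$ of type $v_0$ such that $\overline{L(\mathbb B^{(x)},u_0,u_x)}=Hx$. -/

import Mathlib

open scoped Pointwise

universe u v w

/-! ## Graphs and graphs of groups -/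

/-- A graph in the sense of Serre. The type `E a b` is the set of edges with origin `a` and
terminus `b`; the involution exchanges origin and terminus and has no fixed point. -/
structure SerreGraph where
  V : Type u
  E : V → V → Type u
  inv : ∀ {a b : V}, E a b → E b a
  inv_inv : ∀ {a b : V} (e : E a b), inv (inv e) = e
  inv_ne : ∀ {a : V} (e : E a a), inv e ≠ e

namespace SerreGraph

/-- The set of all edges of a graph. -/
abbrev Edge (Γ : SerreGraph.{u}) : Type u := Σ a b : Γ.V, Γ.E a b

/-- Nonempty, and any two vertices are joined by an edge path. -/
def Connected (Γ : SerreGraph.{u}) : Prop :=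
  Nonempty Γ.V ∧ ∀ a b : Γ.V, Relation.ReflTransGen (fun c d => Nonempty (Γ.E c d)) a b

end SerreGraph

/-- A graph of groups on the graph `Γ`. The edge groups of an edge and of its inverse
are identified by an isomorphism that exchanges the two monomorphisms. -/
structure GraphOfGroups (Γ : SerreGraph.{u}) where
  GV : Γ.V → Type v
  [groupV : ∀ a, Group (GV a)]
  GE : ∀ {a b : Γ.V}, Γ.E a b → Type w
  [groupE : ∀ {a b : Γ.V} (e : Γ.E a b), Group (GE e)]
  α : ∀ {a b : Γ.V} (e : Γ.E a b), GE e →* GV a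
  ω : ∀ {a b : Γ.V} (e : Γ.E a b), GE e →* GV b
  α_injective : ∀ {a b : Γ.V} (e : Γ.E a b), Function.Injective (α e)
  ω_injective : ∀ {a b : Γ.V} (e : Γ.E a b), Function.Injective (ω e)
  inv_edge : ∀ {a b : Γ.V} (e : Γ.E a b), ∃ φ : GE e ≃* GE (Γ.inv e),
    ∀ c, α (Γ.inv e) (φ c) = ω e c ∧ ω (Γ.inv e) (φ c) = α e c

attribute [instance] GraphOfGroups.groupV GraphOfGroups.groupE

namespace GraphOfGroups

variable {Γ : SerreGraph.{u}} (A : GraphOfGroups.{u, v, w} Γ)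

/-- Paths `⟨p₀, e₁, p₁, …, eₙ, pₙ⟩` in a graph of groups. -/
inductive Path : Γ.V → Γ.V → Type (max u v)
  | single {a : Γ.V} (g : A.GV a) : Path a a
  | cons {a b c : Γ.V} (g : A.GV a) (e : Γ.E a b) (p : Path b c) : Path a c

namespace Path

variable {A}

/-- Concatenation of paths. -/
def comp {c : Γ.V} : ∀ {a b : Γ.V}, A.Path a b → A.Path b c → A.Path a c
  | _, _, single g, single h => single (g * h)
  | _, _, single g, cons h e p => cons (g * h) e p
  | _, _, cons g e p, q => cons g e (p.comp q)

/-- The inverse path. -/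
def symm : ∀ {a b : Γ.V}, A.Path a b → A.Path b a
  | _, _, single g => single g⁻¹
  | _, _, cons g e p => p.symm.comp (cons 1 (Γ.inv e) (single g⁻¹))

/-- `Red p q`: the path `q` is obtained from `p` by one elementary reduction, which replaces a
subpath `⟨g, e, ω_e(c), e⁻¹, h⟩` by `⟨g α_e(c) h⟩`. -/
inductive Red : ∀ {a b : Γ.V}, A.Path a b → A.Path a b → Prop
  | head {a b d : Γ.V} (g : A.GV a) (e : Γ.E a b) (c : A.GE e) (p : A.Path a d) :
      Red (cons g e (cons (A.ω e c) (Γ.inv e) p)) ((single (g * A.α e c)).comp p)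
  | tail {a b d : Γ.V} (g : A.GV a) (e : Γ.E a b) {p q : A.Path b d} :
      Red p q → Red (cons g e p) (cons g e q)

/-- No elementary reduction is applicable. -/
def IsReduced {a b : Γ.V} (p : A.Path a b) : Prop := ∀ q, ¬ Red p q

/-- The equivalence relation generated by elementary reductions. -/
def Equiv {a b : Γ.V} (p q : A.Path a b) : Prop := Relation.EqvGen Red p q

theorem comp_assoc {a b c d : Γ.V} (p : A.Path a b) (q : A.Path b c) (r : A.Path c d) :
    (p.comp q).comp r = p.comp (q.comp r) := by
  induction p with
  | single g => cases q <;> cases r <;> simp [comp, mul_assoc]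
  | cons g e p ih => simp [comp, ih]

theorem one_comp {a b : Γ.V} (p : A.Path a b) : (single 1).comp p = p := by
  cases p <;> simp [comp]

theorem comp_one {a b : Γ.V} (p : A.Path a b) : p.comp (single 1) = p := by
  induction p with
  | single g => simp [comp]
  | cons g e p ih => simp [comp, ih]

theorem Red.comp_right {a b c : Γ.V} {p p' : A.Path a b} (h : Red p p') (q : A.Path b c) :
    Red (p.comp q) (p'.comp q) := by
  induction h with
  | head g e k p => rw [comp_assoc]; exact Red.head g e k (p.comp q)
  | tail g e _ ih => exact Red.tail g e (ih q)

theorem Red.comp_left {a b c : Γ.V} (p : A.Path a b) {q q' : A.Path b c} (h : Red q q') :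
    Red (p.comp q) (p.comp q') := by
  induction p with
  | single g =>
    cases h with
    | head k e d r =>
      rw [← comp_assoc]
      simpa [comp, mul_assoc] using Red.head (g * k) e d r
    | tail k e h => exact Red.tail (g * k) e h
  | cons g e p ih => exact Red.tail g e (ih h)

theorem Equiv.comp {a b c : Γ.V} {p p' : A.Path a b} {q q' : A.Path b c}
    (h : p.Equiv p') (k : q.Equiv q') : (p.comp q).Equiv (p'.comp q') := by
  have h1 : ∀ r : A.Path b c, (p.comp r).Equiv (p'.comp r) := fun r => by
    induction h with
    | rel _ _ h => exact .rel _ _ (h.comp_right r)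
    | refl => exact .refl _
    | symm _ _ _ ih => exact .symm _ _ ih
    | trans _ _ _ _ _ ih ih' => exact .trans _ _ _ ih ih'
  have h2 : ∀ r : A.Path a b, (r.comp q).Equiv (r.comp q') := fun r => by
    induction k with
    | rel _ _ h => exact .rel _ _ (Red.comp_left r h)
    | refl => exact .refl _
    | symm _ _ _ ih => exact .symm _ _ ih
    | trans _ _ _ _ _ ih ih' => exact .trans _ _ _ ih ih'
  exact .trans _ _ _ (h1 q) (h2 p')

theorem backtrack {a b d : Γ.V} (g : A.GV a) (e : Γ.E a b) (e' : Γ.E b a) (he : e' = Γ.inv e)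
    (p : A.Path a d) : (cons g e (cons 1 e' p)).Equiv ((single g).comp p) := by
  subst he
  have := Red.head g e 1 p
  rw [map_one, map_one, mul_one] at this
  exact .rel _ _ this

theorem symm_comp {a b : Γ.V} (p : A.Path a b) : (p.symm.comp p).Equiv (single 1) := by
  induction p with
  | single g => simp only [symm, comp, inv_mul_cancel]; exact .refl _
  | cons g e p ih =>
    simp only [symm, comp_assoc, comp, inv_mul_cancel]
    refine .trans _ _ _ (Equiv.comp (.refl p.symm)
      (backtrack 1 (Γ.inv e) e (Γ.inv_inv e).symm p)) ?_
    rw [one_comp]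
    exact ih

theorem comp_symm {a b : Γ.V} (p : A.Path a b) : (p.comp p.symm).Equiv (single 1) := by
  induction p with
  | single g => simp only [symm, comp, mul_inv_cancel]; exact .refl _
  | @cons a b c g e p ih =>
    have h1 : ((cons g e p).comp (cons g e p).symm) =
        (cons g e (single 1)).comp ((p.comp p.symm).comp
          (cons 1 (Γ.inv e) (single g⁻¹))) := by
      simp only [symm, comp, comp_assoc, one_comp]
    rw [h1]
    refine .trans _ _ _ (Equiv.comp (.refl _) (Equiv.comp ih (.refl _))) ?_
    simp only [comp, one_mul]
    refine .trans _ _ _ (backtrack g e (Γ.inv e) rfl _) ?_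
    simp only [comp, mul_inv_cancel]
    exact .refl _

theorem Equiv.symm_congr {a b : Γ.V} {p q : A.Path a b} (h : p.Equiv q) :
    p.symm.Equiv q.symm := by
  have h1 : (p.symm.comp (q.comp q.symm)).Equiv p.symm := by
    simpa only [comp_one] using Equiv.comp (.refl p.symm) (comp_symm q)
  have h2 : ((p.symm.comp p).comp q.symm).Equiv q.symm := by
    simpa only [one_comp] using Equiv.comp (symm_comp p) (.refl q.symm)
  rw [comp_assoc] at h2
  exact .trans _ _ _ (.symm _ _ h1) (.trans _ _ _
    (Equiv.comp (.refl p.symm) (Equiv.comp (.symm _ _ h) (.refl q.symm))) h2)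

end Path

/-- Equivalence of paths from `a` to `b`. -/
def pathSetoid (a b : Γ.V) : Setoid (A.Path a b) where
  r := Path.Equiv
  iseqv := Relation.EqvGen.is_equivalence _

/-- Equivalence classes of paths from `a` to `b`. -/
def PathClass (a b : Γ.V) : Type (max u v) := Quotient (A.pathSetoid a b)

variable {A} in
/-- The equivalence class of a path. -/
def Path.cls {a b : Γ.V} (p : A.Path a b) : A.PathClass a b := Quotient.mk (A.pathSetoid a b) p

variable {A} in
/-- Transport of a class along equalities of its endpoints. -/
def PathClass.cast {a a' b b' : Γ.V} (ha : a = a') (hb : b = b') (g : A.PathClass a b) :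
    A.PathClass a' b' := ha ▸ hb ▸ g

/-- The fundamental group of a graph of groups at the vertex `a`: the set of
classes of loops, under concatenation. -/
abbrev π₁ (a : Γ.V) : Type (max u v) := A.PathClass a a

instance (a : Γ.V) : Group (A.π₁ a) where
  mul := Quotient.map₂ Path.comp fun _ _ h _ _ k => Path.Equiv.comp h k
  one := (Path.single (1 : A.GV a)).cls
  inv := Quotient.map Path.symm fun _ _ h => Path.Equiv.symm_congr h
  mul_assoc x y z := by
    induction x using Quotient.inductionOn with | _ x
    induction y using Quotient.inductionOn with | _ y
    induction z using Quotient.inductionOn with | _ z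
    exact congrArg (Quotient.mk _) (Path.comp_assoc x y z)
  one_mul x := by
    induction x using Quotient.inductionOn with | _ x
    exact congrArg (Quotient.mk _) (Path.one_comp x)
  mul_one x := by
    induction x using Quotient.inductionOn with | _ x
    exact congrArg (Quotient.mk _) (Path.comp_one x)
  inv_mul_cancel x := by
    induction x using Quotient.inductionOn with | _ x
    exact Quotient.sound (s := A.pathSetoid a a) (Path.symm_comp x)

end GraphOfGroups

/-! ## `A`-graphs -/

/-- An `A`-graph: a graph `B` with a graph morphism to the graph of `A`, a subgroup of the
vertex group of `A` for each vertex of `B`, and two elements `lα f`, `lω f` for each edge `f`. -/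
structure AGraph {Γ : SerreGraph.{u}} (A : GraphOfGroups.{u, v, w} Γ) where
  B : SerreGraph.{0}
  typ : B.V → Γ.V
  etyp : ∀ {a b : B.V}, B.E a b → Γ.E (typ a) (typ b)
  etyp_inv : ∀ {a b : B.V} (f : B.E a b), etyp (B.inv f) = Γ.inv (etyp f)
  grp : ∀ a : B.V, Subgroup (A.GV (typ a))
  lα : ∀ {a b : B.V}, B.E a b → A.GV (typ a)
  lω : ∀ {a b : B.V}, B.E a b → A.GV (typ b)
  lα_inv : ∀ {a b : B.V} (f : B.E a b), lα (B.inv f) = (lω f)⁻¹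

namespace AGraph

variable {Γ : SerreGraph.{u}} {A : GraphOfGroups.{u, v, w} Γ} (𝔹 : AGraph A)

/-- `α_[f]⁻¹(f_α⁻¹ B_{o(f)} f_α)` -/
def preα {a b : 𝔹.B.V} (f : 𝔹.B.E a b) : Subgroup (A.GE (𝔹.etyp f)) :=
  (𝔹.grp a).comap ((MulAut.conj (𝔹.lα f)).toMonoidHom.comp (A.α (𝔹.etyp f)))

/-- `ω_[f]⁻¹(f_ω B_{t(f)} f_ω⁻¹)` -/
def preω {a b : 𝔹.B.V} (f : 𝔹.B.E a b) : Subgroup (A.GE (𝔹.etyp f)) :=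
  (𝔹.grp b).comap ((MulAut.conj (𝔹.lω f)⁻¹).toMonoidHom.comp (A.ω (𝔹.etyp f)))

/-- The edge group `B_f`. -/
def edgeGrp {a b : 𝔹.B.V} (f : 𝔹.B.E a b) : Subgroup (A.GE (𝔹.etyp f)) := 𝔹.preα f ⊓ 𝔹.preω f

theorem mem_preα {a b : 𝔹.B.V} (f : 𝔹.B.E a b) (c : A.GE (𝔹.etyp f)) :
    c ∈ 𝔹.preα f ↔ 𝔹.lα f * A.α (𝔹.etyp f) c * (𝔹.lα f)⁻¹ ∈ 𝔹.grp a := by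
  simp [preα, Subgroup.mem_comap]

theorem mem_preω {a b : 𝔹.B.V} (f : 𝔹.B.E a b) (c : A.GE (𝔹.etyp f)) :
    c ∈ 𝔹.preω f ↔ (𝔹.lω f)⁻¹ * A.ω (𝔹.etyp f) c * 𝔹.lω f ∈ 𝔹.grp b := by
  simp [preω, Subgroup.mem_comap]

theorem lω_inv {a b : 𝔹.B.V} (f : 𝔹.B.E a b) : 𝔹.lω (𝔹.B.inv f) = (𝔹.lα f)⁻¹ := by
  have := 𝔹.lα_inv (𝔹.B.inv f)
  rw [𝔹.B.inv_inv] at this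
  rw [this, inv_inv]

/-- `α_f(c) = f_α α_[f](c) f_α⁻¹` -/
def edgeα {a b : 𝔹.B.V} (f : 𝔹.B.E a b) : 𝔹.edgeGrp f →* 𝔹.grp a :=
  (((MulAut.conj (𝔹.lα f)).toMonoidHom.comp (A.α (𝔹.etyp f))).comp
    (𝔹.edgeGrp f).subtype).codRestrict (𝔹.grp a) fun c => c.2.1

/-- `ω_f(c) = f_ω⁻¹ ω_[f](c) f_ω` -/
def edgeω {a b : 𝔹.B.V} (f : 𝔹.B.E a b) : 𝔹.edgeGrp f →* 𝔹.grp b :=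
  (((MulAut.conj (𝔹.lω f)⁻¹).toMonoidHom.comp (A.ω (𝔹.etyp f))).comp
    (𝔹.edgeGrp f).subtype).codRestrict (𝔹.grp b) fun c => c.2.2

theorem edgeα_coe {a b : 𝔹.B.V} (f : 𝔹.B.E a b) (c : 𝔹.edgeGrp f) :
    (𝔹.edgeα f c : A.GV (𝔹.typ a)) = 𝔹.lα f * A.α (𝔹.etyp f) c * (𝔹.lα f)⁻¹ := rfl

theorem edgeω_coe {a b : 𝔹.B.V} (f : 𝔹.B.E a b) (c : 𝔹.edgeGrp f) :
    (𝔹.edgeω f c : A.GV (𝔹.typ b)) = (𝔹.lω f)⁻¹ * A.ω (𝔹.etyp f) c * 𝔹.lω f := by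
  simp [edgeω]

/-- The graph of groups defined by an `A`-graph. -/
def toGraphOfGroups : GraphOfGroups.{0, v, w} 𝔹.B where
  GV a := 𝔹.grp a
  GE f := 𝔹.edgeGrp f
  α := 𝔹.edgeα
  ω := 𝔹.edgeω
  α_injective f := by
    intro c d h
    have h' := congrArg Subtype.val h
    rw [edgeα_coe, edgeα_coe] at h'
    exact Subtype.ext (A.α_injective _ (by simpa using h'))
  ω_injective f := by
    intro c d h
    have h' := congrArg Subtype.val h
    rw [edgeω_coe, edgeω_coe] at h'
    exact Subtype.ext (A.ω_injective _ (by simpa using h'))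
  inv_edge := by
    intro a b f
    obtain ⟨φ, hφ⟩ : ∃ φ : A.GE (𝔹.etyp f) ≃* A.GE (𝔹.etyp (𝔹.B.inv f)),
        ∀ c, A.α (𝔹.etyp (𝔹.B.inv f)) (φ c) = A.ω (𝔹.etyp f) c ∧
          A.ω (𝔹.etyp (𝔹.B.inv f)) (φ c) = A.α (𝔹.etyp f) c := by
      rw [𝔹.etyp_inv]
      exact A.inv_edge _
    have hmem : ∀ c, φ c ∈ 𝔹.edgeGrp (𝔹.B.inv f) ↔ c ∈ 𝔹.edgeGrp f := by
      intro c
      simp only [edgeGrp, Subgroup.mem_inf, mem_preα, mem_preω, (hφ c).1, (hφ c).2,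
        lα_inv, lω_inv, inv_inv]
      exact and_comm
    have hmap : (𝔹.edgeGrp f).map φ.toMonoidHom = 𝔹.edgeGrp (𝔹.B.inv f) := by
      ext d
      obtain ⟨c, rfl⟩ := φ.surjective d
      rw [hmem]
      simp
    have hval : ∀ c : 𝔹.edgeGrp f, (((φ.subgroupMap (𝔹.edgeGrp f)).trans
        (MulEquiv.subgroupCongr hmap) c : 𝔹.edgeGrp (𝔹.B.inv f)) :
          A.GE (𝔹.etyp (𝔹.B.inv f))) = φ c := fun _ => rfl
    refine ⟨(φ.subgroupMap (𝔹.edgeGrp f)).trans (MulEquiv.subgroupCongr hmap), fun c => ⟨?_, ?_⟩⟩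
    · apply Subtype.ext
      rw [edgeα_coe, edgeω_coe, hval, (hφ _).1, lα_inv, inv_inv]
    · apply Subtype.ext
      rw [edgeα_coe, edgeω_coe, hval, (hφ _).2, lω_inv, inv_inv]

/-- The `A`-path `μ(q)` of a path `q` in the graph of groups of `𝔹`. -/
def μ : ∀ {a b : 𝔹.B.V}, 𝔹.toGraphOfGroups.Path a b → A.Path (𝔹.typ a) (𝔹.typ b)
  | _, _, .single g => .single (show 𝔹.grp _ from g).1
  | _, _, .cons g f q =>
      .cons ((show 𝔹.grp _ from g).1 * 𝔹.lα f) (𝔹.etyp f)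
        ((GraphOfGroups.Path.single (𝔹.lω f)).comp (μ q))

/-- The set of classes of the `A`-paths `μ(q)`, for `q` a reduced path from `a` to `b`. -/
def L (a b : 𝔹.B.V) : Set (A.PathClass (𝔹.typ a) (𝔹.typ b)) :=
  {g | ∃ q : 𝔹.toGraphOfGroups.Path a b, q.IsReduced ∧ (𝔹.μ q).cls = g}

/-- `L a b` as a subset of the fundamental group at `v₀`, for vertices `a`, `b` of type `v₀`. -/
def LAt (v₀ : Γ.V) (a b : 𝔹.B.V) (ha : 𝔹.typ a = v₀) (hb : 𝔹.typ b = v₀) : Set (A.π₁ v₀) :=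
  GraphOfGroups.PathClass.cast ha hb '' 𝔹.L a b

/-- Two edges `f₁`, `f₂` with `t(f₁) = o(f₂)`, where `f₁` and `f₂⁻¹` are distinct edges of the same
type `e`, and `(f₁)_ω b (f₂)_α = ω_e(c)` for some `b` in the vertex group and some `c`. -/
def NotFoldedI : Prop :=
  ∃ (a k d : 𝔹.B.V) (f₁ : 𝔹.B.E a k) (f₂ : 𝔹.B.E k d),
    (⟨a, k, f₁⟩ : 𝔹.B.Edge) ≠ ⟨d, k, 𝔹.B.inv f₂⟩ ∧
    (⟨_, _, 𝔹.etyp f₁⟩ : Γ.Edge) = ⟨_, _, 𝔹.etyp (𝔹.B.inv f₂)⟩ ∧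
    ∃ b ∈ 𝔹.grp k, ∃ c : A.GE (𝔹.etyp f₁), 𝔹.lω f₁ * b * 𝔹.lα f₂ = A.ω (𝔹.etyp f₁) c

def NotFoldedII : Prop :=
  ∃ (a b : 𝔹.B.V) (f : 𝔹.B.E a b), 𝔹.preα f ≠ 𝔹.preω f

def IsFolded : Prop := ¬ 𝔹.NotFoldedI ∧ ¬ 𝔹.NotFoldedII

end AGraph

/-! ## Finite descriptions and algorithms

An algorithm is a computable function (`Computable`) between types of finite descriptions. -/

/-- Words in numbered letters and their formal inverses; `(i, true)` is the letter number `i`, and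
`(i, false)` is its inverse. -/
abbrev GWord : Type := List (ℕ × Bool)

/-- The value of a word, for the list `gens` of values of the letters. Letters beyond the list
have value `1`. -/
def GWord.eval {G : Type*} [Group G] (gens : List G) (W : GWord) : G :=
  (W.map fun l => if l.2 then gens.getD l.1 1 else (gens.getD l.1 1)⁻¹).prod

/-- The subgroup generated by the values of finitely many words. -/
def GWord.span {G : Type*} [Group G] (gens : List G) (X : List GWord) : Subgroup G :=
  Subgroup.closure {g | ∃ W ∈ X, GWord.eval gens W = g}

/-- Description of a path `⟨p₀, e₁, p₁, …, eₙ, pₙ⟩`: the word `p₀` and the list of the pairs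
of the number of `eᵢ` and the word `pᵢ`. -/
abbrev PathCode : Type := GWord × List (ℕ × GWord)

/-- Description of a vertex of an `A`-graph: the number of its type, and words that generate its
group. -/
abbrev VertexCode : Type := ℕ × List GWord

/-- Description of an edge `f` of an `A`-graph: the numbers of its origin, its terminus and its
inverse, the number of its type, and words for `f_α` and `f_ω`. -/
abbrev EdgeCode : Type := (ℕ × ℕ × ℕ) × ℕ × GWord × GWord

/-- Description of a finite `A`-graph with two distinguished vertices: the list of its vertices,
the list of its edges, and the numbers of the distinguished vertices. -/
abbrev AGraphCode : Type := List VertexCode × List EdgeCode × ℕ × ℕ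

namespace GraphOfGroups

variable {Γ : SerreGraph.{u}} (A : GraphOfGroups.{u, v, w} Γ)

/-- A graph of groups with finite underlying graph and finitely generated groups: numberings of its
vertices and edges, and finite generating lists of all vertex and edge groups. -/
structure Marking where
  nV : ℕ
  nE : ℕ
  vNum : Γ.V ≃ Fin nV
  eNum : Γ.Edge ≃ Fin nE
  vGens : ∀ a, List (A.GV a)
  eGens : ∀ {a b : Γ.V} (e : Γ.E a b), List (A.GE e)
  vGens_closure : ∀ a, Subgroup.closure {g | g ∈ vGens a} = ⊤
  eGens_closure : ∀ {a b : Γ.V} (e : Γ.E a b), Subgroup.closure {g | g ∈ eGens e} = ⊤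

variable {A}

/-- Benign graphs of groups. -/
structure Benign (M : A.Marking) : Prop where
  connected : Γ.Connected
  /-- Deciding if `⟨X⟩ ∩ g α_e(A_e)` is empty, and producing an element `g α_e(c)` of it if not. -/
  coset : ∀ {a b : Γ.V} (e : Γ.E a b), ∃ F : List GWord × GWord → Option GWord, Computable F ∧
    ∀ (X : List GWord) (g : GWord),
      (F (X, g) = none →
        (GWord.span (M.vGens a) X : Set (A.GV a)) ∩
          (GWord.eval (M.vGens a) g • ((A.α e).range : Set (A.GV a))) = ∅) ∧
      ∀ c, F (X, g) = some c →
        GWord.eval (M.vGens a) g * A.α e (GWord.eval (M.eGens e) c) ∈ GWord.span (M.vGens a) X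
  noetherian : ∀ {a b : Γ.V} (e : Γ.E a b) (K : Subgroup (A.GE e)), K.FG
  edge_membership : ∀ {a b : Γ.V} (e : Γ.E a b), ∃ F : List GWord × GWord → Bool, Computable F ∧
    ∀ (X : List GWord) (g : GWord),
      F (X, g) = true ↔ GWord.eval (M.eGens e) g ∈ GWord.span (M.eGens e) X
  intersection : ∀ {a b : Γ.V} (e : Γ.E a b), ∃ F : List GWord → List GWord, Computable F ∧
    ∀ X : List GWord,
      GWord.span (M.vGens a) (F X) = GWord.span (M.vGens a) X ⊓ (A.α e).range

/-- The path code describes the path. -/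
inductive Marking.Describes (M : A.Marking) : ∀ {a b : Γ.V}, PathCode → A.Path a b → Prop
  | single {a : Γ.V} (W : GWord) :
      Describes M (W, []) (Path.single (GWord.eval (M.vGens a) W))
  | cons {a b c : Γ.V} (W W' : GWord) (e : Γ.E a b) (l : List (ℕ × GWord)) (p : A.Path b c) :
      Describes M (W', l) p →
      Describes M (W, ((M.eNum ⟨a, b, e⟩ : ℕ), W') :: l)
        (Path.cons (GWord.eval (M.vGens a) W) e p)

/-- The path code describes a loop at `v₀` that represents the element `g`. -/
def Marking.DescribesElt (M : A.Marking) {v₀ : Γ.V} (P : PathCode) (g : A.π₁ v₀) : Prop :=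
  ∃ p : A.Path v₀ v₀, M.Describes P p ∧ p.cls = g

/-- The element of the fundamental group given by a path of length 0. -/
def lengthZero (A : GraphOfGroups.{u, v, w} Γ) (v₀ : Γ.V) (y : A.GV v₀) : A.π₁ v₀ :=
  (Path.single y).cls

/-- The code describes the `A`-graph `𝔹` with its distinguished vertices `ux` and `u0`. -/
def Marking.DescribesAGraph (M : A.Marking) (C : AGraphCode) (𝔹 : AGraph A) (ux u0 : 𝔹.B.V) :
    Prop :=
  ∃ (nv : 𝔹.B.V ≃ Fin C.1.length) (ne : 𝔹.B.Edge ≃ Fin C.2.1.length),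
    (∀ a, (C.1.get (nv a)).1 = M.vNum (𝔹.typ a) ∧
      𝔹.grp a = GWord.span (M.vGens (𝔹.typ a)) (C.1.get (nv a)).2) ∧
    (∀ (a b : 𝔹.B.V) (f : 𝔹.B.E a b), ∃ Wα Wω : GWord,
      C.2.1.get (ne ⟨a, b, f⟩) =
        (((nv a : ℕ), (nv b : ℕ), (ne ⟨b, a, 𝔹.B.inv f⟩ : ℕ)),
          (M.eNum ⟨_, _, 𝔹.etyp f⟩ : ℕ), Wα, Wω) ∧
      GWord.eval (M.vGens (𝔹.typ a)) Wα = 𝔹.lα f ∧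
      GWord.eval (M.vGens (𝔹.typ b)) Wω = 𝔹.lω f) ∧
    C.2.2 = ((nv ux : ℕ), (nv u0 : ℕ))

end GraphOfGroups

/-!
Both alternatives of the theorem are recursively enumerable, and one of them holds, so the algorithm
is an unbounded search: either for a word for some `y` in `A_{v₀}` with `y⁻¹ x` in `H`, or for the
code of a finite folded `A`-graph with distinct vertices `u_x`, `u_0`, together with a certificate
that it represents `x H`. Membership in `H` is recursively enumerable because `G` is recursively
presented, and foldedness is recursively enumerable because the graph of groups is benign. In a
certificate, labels of the vertices by elements of `G` show that nothing outside `x H` is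
represented, and explicit paths show that all of `x H` is. Right cosets reduce to left cosets by
inversion.

The two searches exclude each other: in a folded `A`-graph, reduced paths represent reduced paths,
so a reduced path from `u_x` to `u_0` that represents an element of `A_{v₀}` has length 0, which is
impossible for `u_x ≠ u_0`.

If no `y` exists, a code is found in the quotient of the Bass–Serre tree by `H`, whose vertices and
edges are double cosets of `H` and the vertex and edge groups. Take the finite subgraph crossed by
the lifts of `x⁻¹` and of the generators of `H`, with finitely generated subgroups of the
stabilizers as vertex groups. Edge groups are Noetherian, so after finitely many enlargements the
vertex groups contain all the stabilizers of the chosen edges, and the `A`-graph is folded. The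
orbits of `x⁻¹ A_{v₀}` and `A_{v₀}` are distinct because no `y` exists.
-/

/-! ## Computable functions and recursively enumerable predicates -/

attribute [fun_prop] Computable Computable.id Computable.const Computable.comp Computable.fst
  Computable.snd Computable.pair Computable.option_some

section Computability

variable {α β γ : Type*} [Primcodable α] [Primcodable β] [Primcodable γ]

@[fun_prop]
theorem computable_append {f g : α → List β} (hf : Computable f) (hg : Computable g) :
    Computable fun a => f a ++ g a :=
  Computable.list_append.comp hf hg

@[fun_prop]
theorem computable_cons {f : α → β} {g : α → List β} (hf : Computable f) (hg : Computable g) :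
    Computable fun a => f a :: g a :=
  Computable.list_cons.comp hf hg

@[fun_prop]
theorem computable_length {f : α → List β} (hf : Computable f) :
    Computable fun a => (f a).length :=
  Computable.list_length.comp hf

@[fun_prop]
theorem computable_getElem? {f : α → List β} {g : α → ℕ} (hf : Computable f) (hg : Computable g) :
    Computable fun a => (f a)[g a]? :=
  Computable.list_getElem?.comp hf hg

@[fun_prop]
theorem computable_getD {f : α → List β} {g : α → ℕ} (d : β) (hf : Computable f)
    (hg : Computable g) : Computable fun a => (f a).getD (g a) d :=
  (Primrec.list_getD d).to_comp.comp hf hg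

@[fun_prop]
theorem computable_add {f g : α → ℕ} (hf : Computable f) (hg : Computable g) :
    Computable fun a => f a + g a :=
  Primrec.nat_add.to_comp.comp hf hg

@[fun_prop]
theorem computable_sub {f g : α → ℕ} (hf : Computable f) (hg : Computable g) :
    Computable fun a => f a - g a :=
  Primrec.nat_sub.to_comp.comp hf hg

theorem computable_sumMap {γ δ : Type*} [Primcodable γ] [Primcodable δ] {f : α → γ} {g : β → δ}
    (hf : Computable f) (hg : Computable g) : Computable (Sum.map f g) :=
  (Computable.sumCasesOn Computable.id (Primrec.sumInl.to_comp.comp (hf.comp Computable.snd)).to₂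
    (Primrec.sumInr.to_comp.comp (hg.comp Computable.snd)).to₂).of_eq fun s => by cases s <;> rfl

theorem rePred_comp {p : β → Prop} {f : α → β} (hp : REPred p) (hf : Computable f) :
    REPred fun a => p (f a) :=
  Partrec.comp hp hf

theorem rePred_of_computable {f : α → Bool} (hf : Computable f) : REPred fun a => f a = true :=
  ComputablePred.to_re (ComputablePred.computable_iff.2 ⟨f, hf, rfl⟩)

theorem rePred_const (P : Prop) : REPred fun _ : α => P := by
  classical exact (Computable.const (decide P)).computablePred.of_eq (fun _ => by simp) |>.to_re

theorem rePred_eq {f g : α → β} (hf : Computable f) (hg : Computable g) :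
    REPred fun a => f a = g a :=
  rePred_comp Primrec.eq.computablePred.to_re (hf.pair hg)

theorem rePred_ne {f g : α → β} (hf : Computable f) (hg : Computable g) :
    REPred fun a => f a ≠ g a :=
  rePred_comp (p := fun x : β × β => ¬x.1 = x.2) Primrec.eq.computablePred.not.to_re (hf.pair hg)

theorem rePred_lt {f g : α → ℕ} (hf : Computable f) (hg : Computable g) :
    REPred fun a => f a < g a :=
  rePred_comp Primrec.nat_lt.computablePred.to_re (hf.pair hg)

theorem part_assert_some_dom {P : Prop} : (Part.assert P fun _ => Part.some ()).Dom ↔ P := by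
  simp [Part.assert]

theorem rePred_and {p q : α → Prop} (hp : REPred p) (hq : REPred q) :
    REPred fun a => p a ∧ q a :=
  (Partrec.bind hp (hq.comp Computable.fst).to₂).dom_re.of_eq fun a => by
    simp [part_assert_some_dom]

theorem rePred_or {p q : α → Prop} (hp : REPred p) (hq : REPred q) :
    REPred fun a => p a ∨ q a := by
  obtain ⟨k, hk, hkpq⟩ := Partrec.merge' hp hq
  exact hk.dom_re.of_eq fun a => by
    simpa only [part_assert_some_dom] using (hkpq a).2

theorem rePred_exists_fintype {ι : Type*} [Finite ι] {p : ι → α → Prop}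
    (hp : ∀ i, REPred (p i)) : REPred fun a => ∃ i, p i a := by
  induction ι using Finite.induction_empty_option with
  | of_equiv e ih => exact (ih fun i => hp (e i)).of_eq fun a =>
      (e.surjective.exists (p := fun i => p i a)).symm
  | h_empty => exact (rePred_const False).of_eq fun a => by simp
  | h_option ih =>
    exact (rePred_or (hp none) (ih fun i => hp (some i))).of_eq fun a =>
      (Option.exists (p := fun i => p i a)).symm

/-- The decidable relation is the step-bounded evaluation of a partial recursive function. -/
theorem rePred_iff_exists_computable {p : α → Prop} :
    REPred p ↔ ∃ f : α × ℕ → Bool, Computable f ∧ ∀ a, p a ↔ ∃ n, f (a, n) = true := by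
  constructor
  · intro hp
    obtain ⟨c, hc⟩ := Nat.Partrec.Code.exists_code.1 hp
    refine ⟨fun x => (c.evaln x.2 (Encodable.encode x.1)).isSome,
      (Primrec.option_isSome.comp (Nat.Partrec.Code.primrec_evaln.comp ((Primrec.snd.pair
        (Primrec.const c)).pair (Primrec.encode.comp Primrec.fst)))).to_comp, fun a => ?_⟩
    have hdom : p a ↔ (c.eval (Encodable.encode a)).Dom := by
      simp [hc, part_assert_some_dom]
    simp only [hdom, Part.dom_iff_mem, Nat.Partrec.Code.evaln_complete, Option.isSome_iff_exists,
      Option.mem_def]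
    exact exists_comm
  · rintro ⟨f, hf, hpf⟩
    exact (Partrec.rfind (p := fun a n => Part.some (f (a, n))) hf.partrec).dom_re.of_eq
      fun a =>
      Nat.rfind_dom.trans (by simp [hpf])

theorem exists_computable_enumeration {p : α → β → Prop}
    (hp : REPred fun x : α × β => p x.1 x.2) :
    ∃ g : α → ℕ → Option β, Computable₂ g ∧ ∀ a b, p a b ↔ ∃ n, g a n = some b := by
  obtain ⟨f, hf, hpf⟩ := rePred_iff_exists_computable.1 hp
  refine ⟨fun a n => (Encodable.decode (α := β) n.unpair.1).bind fun b =>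
    bif f ((a, b), n.unpair.2) then some b else none, ?_, fun a b => ?_⟩
  · have hunpair : Computable fun x : α × ℕ => x.2.unpair := Computable.unpair.comp Computable.snd
    refine Computable.option_bind (Computable.decode.comp (Computable.fst.comp hunpair)) ?_
    have hbound : Computable fun y : (α × ℕ) × β => y.1.2.unpair.2 :=
      Computable.snd.comp (hunpair.comp Computable.fst)
    exact .cond (hf.comp (by fun_prop)) (by fun_prop) (by fun_prop)
  · simp only [hpf (a, b), Option.bind_eq_some_iff, Bool.cond_eq_ite, Option.ite_none_right_eq_some,
      Option.some.injEq]
    constructor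
    · rintro ⟨n, hn⟩
      exact ⟨Nat.pair (Encodable.encode b) n, b, by simp, by simpa using hn, rfl⟩
    · rintro ⟨n, b, -, hn, rfl⟩
      exact ⟨_, hn⟩

theorem rePred_exists {p : α → β → Prop} (hp : REPred fun x : α × β => p x.1 x.2) :
    REPred fun a => ∃ b, p a b := by
  obtain ⟨g, hg, hpg⟩ := exists_computable_enumeration hp
  refine rePred_iff_exists_computable.2
    ⟨fun x => (g x.1 x.2).isSome, Primrec.option_isSome.to_comp.comp hg, fun a => ?_⟩
  simp only [hpg, Option.isSome_iff_exists]
  exact exists_comm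

theorem exists_computable_of_rePred {p : α → β → Prop} (hp : REPred fun x : α × β => p x.1 x.2)
    (htotal : ∀ a, ∃ b, p a b) : ∃ F : α → β, Computable F ∧ ∀ a, p a (F a) := by
  obtain ⟨g, hg, hpg⟩ := exists_computable_enumeration hp
  have hdom : ∀ a, (Nat.rfindOpt (g a)).Dom := fun a => by
    obtain ⟨b, hb⟩ := htotal a
    obtain ⟨n, hn⟩ := (hpg a b).1 hb
    exact Nat.rfindOpt_dom.2 ⟨n, b, hn⟩
  exact ⟨fun a => (Nat.rfindOpt (g a)).get (hdom a),
    (Partrec.rfindOpt hg).of_eq_tot fun a => Part.get_mem _,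
    fun a => (hpg a _).2 (Nat.rfindOpt_spec (Part.get_mem (hdom a)))⟩

theorem rePred_forall_lt {p : α → ℕ → Prop} {N : α → ℕ} (hN : Computable N)
    (hp : REPred fun x : α × ℕ => p x.1 x.2) : REPred fun a => ∀ k < N a, p a k := by
  have hstep : Partrec₂ fun (a : α) (x : ℕ × Unit) => Part.assert (p a x.1) fun _ => Part.some () :=
    rePred_comp hp (f := fun y : α × ℕ × Unit => (y.1, y.2.1)) (by fun_prop)
  refine (Partrec.nat_rec hN (Computable.const ()).partrec hstep).dom_re.of_eq fun a => ?_
  simp only [PFun.coe_val]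
  induction N a with
  | zero => simp
  | succ n ih =>
    rw [Nat.forall_lt_succ_right, ← ih]
    simp [part_assert_some_dom]

theorem rePred_mem_list {f : α → β} {l : α → List β} (hf : Computable f) (hl : Computable l) :
    REPred fun a => f a ∈ l a :=
  (rePred_exists (p := fun a k => (l a)[k]? = some (f a))
    (rePred_eq (by fun_prop) (by fun_prop))).of_eq fun _ => List.mem_iff_getElem?.symm

theorem rePred_exists_mem_list {p : α → β → Prop} {l : α → List β} (hl : Computable l)
    (hp : REPred fun x : α × β => p x.1 x.2) : REPred fun a => ∃ b ∈ l a, p a b :=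
  rePred_exists (rePred_and (rePred_mem_list Computable.snd (by fun_prop)) hp)

theorem rePred_forall_mem_list {p : α → β → Prop} {l : α → List β} (hl : Computable l)
    (hp : REPred fun x : α × β => p x.1 x.2) : REPred fun a => ∀ b ∈ l a, p a b := by
  have hindex : REPred fun x : α × ℕ => ∃ b, (l x.1)[x.2]? = some b ∧ p x.1 b :=
    rePred_exists (p := fun (x : α × ℕ) b => (l x.1)[x.2]? = some b ∧ p x.1 b)
      (rePred_and (rePred_eq (by fun_prop) (by fun_prop))
      (rePred_comp hp (f := fun y : (α × ℕ) × β => (y.1.1, y.2)) (by fun_prop)))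
  refine (rePred_forall_lt (p := fun a k => ∃ b, (l a)[k]? = some b ∧ p a b)
    (N := fun a => (l a).length) (by fun_prop) hindex).of_eq fun a => ?_
  rw [List.forall_mem_iff_forall_getElem]
  refine forall₂_congr fun k hk => ?_
  simp [hk]

theorem rePred_isChain {r : α → β → β → Prop} {l : α → List β} (hl : Computable l)
    (hr : REPred fun x : α × β × β => r x.1 x.2.1 x.2.2) :
    REPred fun a => (l a).IsChain (r a) := by
  have hindex : REPred fun x : α × ℕ => ∃ y : β × β,
      ((l x.1)[x.2]? = some y.1 ∧ (l x.1)[x.2 + 1]? = some y.2) ∧ r x.1 y.1 y.2 :=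
    rePred_exists (rePred_and
      (rePred_and (rePred_eq (by fun_prop) (by fun_prop)) (rePred_eq (by fun_prop) (by fun_prop)))
      (rePred_comp hr (f := fun z : (α × ℕ) × β × β => (z.1.1, z.2)) (by fun_prop)))
  refine (rePred_forall_lt (p := fun a k => ∃ y : β × β,
    ((l a)[k]? = some y.1 ∧ (l a)[k + 1]? = some y.2) ∧ r a y.1 y.2)
    (N := fun a => (l a).length - 1) (by fun_prop) hindex).of_eq fun a => ?_
  rw [List.isChain_iff_getElem]
  refine forall_congr' fun k => ?_
  rw [Nat.lt_sub_iff_add_lt]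
  refine forall_congr' fun hk => ?_
  simp [hk, Nat.lt_of_succ_lt hk]

theorem rePred_reflTransGen {r : α → β → β → Prop}
    (hr : REPred fun x : α × β × β => r x.1 x.2.1 x.2.2) :
    REPred fun x : α × β × β => Relation.ReflTransGen (r x.1) x.2.1 x.2.2 := by
  have hchain : REPred fun y : (α × β × β) × List β => (y.1.2.1 :: y.2).IsChain (r y.1.1) :=
    rePred_isChain (r := fun y : (α × β × β) × List β => r y.1.1) (by fun_prop)
      (rePred_comp hr (f := fun z : ((α × β × β) × List β) × β × β => (z.1.1.1, z.2)) (by fun_prop))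
  refine (rePred_exists (p := fun (x : α × β × β) (l : List β) => (x.2.1 :: l).IsChain (r x.1) ∧
    (x.2.1 :: l)[l.length]? = some x.2.2)
    (rePred_and hchain (rePred_eq (by fun_prop) (by fun_prop)))).of_eq fun x => ?_
  have hlast : ∀ l : List β, (x.2.1 :: l)[l.length]? = some x.2.2 ↔
      (x.2.1 :: l).getLast (List.cons_ne_nil _ _) = x.2.2 := fun l => by
    rw [List.getLast_eq_getElem, List.getElem?_eq_getElem (by simp), Option.some.injEq]
    simp
  simp only [hlast]
  exact ⟨fun ⟨l, hl, hx⟩ => List.relationReflTransGen_of_exists_isChain_cons l hl hx,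
    List.exists_isChain_cons_of_relationReflTransGen⟩

end Computability

/-! ## Words -/

section Words

variable {L L' G : Type*} [Group G] (v : L → G)

/-- The value of a word in the letters `L` and their formal inverses, for the values `v` of the
letters. -/
def wordVal (W : List (L × Bool)) : G := FreeGroup.lift v (FreeGroup.mk W)

/-- Substitution of words for letters. -/
def wordSubst (s : L → List (L' × Bool)) (W : List (L × Bool)) : List (L' × Bool) :=
  W.flatMap fun l => bif l.2 then s l.1 else FreeGroup.invRev (s l.1)

/-- The subgroup generated by the values of finitely many words. -/
def wordSpan (X : List (List (L × Bool))) : Subgroup G :=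
  Subgroup.closure {g | ∃ W ∈ X, wordVal v W = g}

theorem wordVal_nil : wordVal v [] = 1 := map_one (FreeGroup.lift v)

theorem wordVal_append (W W' : List (L × Bool)) :
    wordVal v (W ++ W') = wordVal v W * wordVal v W' := by
  simp only [wordVal, ← FreeGroup.mul_mk, map_mul]

theorem wordVal_cons (l : L × Bool) (W : List (L × Bool)) :
    wordVal v (l :: W) = wordVal v [l] * wordVal v W :=
  wordVal_append v [l] W

theorem wordVal_letter (l : L) : wordVal v [(l, true)] = v l := FreeGroup.lift_apply_of

theorem wordVal_invRev (W : List (L × Bool)) :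
    wordVal v (FreeGroup.invRev W) = (wordVal v W)⁻¹ := by
  simp only [wordVal, ← FreeGroup.inv_mk, map_inv]

theorem wordVal_inv_letter (l : L) : wordVal v [(l, false)] = (v l)⁻¹ := by
  rw [← wordVal_letter v l, ← wordVal_invRev]
  rfl

theorem wordVal_wordSubst {v : L' → G} (s : L → List (L' × Bool)) (W : List (L × Bool)) :
    wordVal v (wordSubst s W) = wordVal (fun l => wordVal v (s l)) W := by
  induction W with
  | nil => simp only [wordSubst, List.flatMap_nil, wordVal_nil]
  | cons l W ih =>
    rw [wordVal_cons, ← ih]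
    simp only [wordSubst, List.flatMap_cons, wordVal_append]
    rcases l with ⟨l, _ | _⟩ <;> simp [wordVal_invRev, wordVal_letter, wordVal_inv_letter]

theorem map_wordVal {H : Type*} [Group H] (f : G →* H) (W : List (L × Bool)) :
    f (wordVal v W) = wordVal (fun l => f (v l)) W := by
  refine DFunLike.congr_fun (f := f.comp (FreeGroup.lift v)) (FreeGroup.ext_hom _ _ fun l => ?_)
    (FreeGroup.mk W)
  simp only [MonoidHom.comp_apply, FreeGroup.lift_apply_of]

theorem wordVal_map {v : L' → G} (s : L → L') (W : List (L × Bool)) :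
    wordVal v (W.map fun l => (s l.1, l.2)) = wordVal (fun l => v (s l)) W := by
  simp only [wordVal, FreeGroup.lift_mk, List.map_map, Function.comp_def]

theorem mem_closure_range_iff_exists_wordVal {g : G} :
    g ∈ Subgroup.closure (Set.range v) ↔ ∃ W, wordVal v W = g := by
  rw [← FreeGroup.range_lift_eq_closure, MonoidHom.mem_range]
  exact (Quot.mk_surjective (r := FreeGroup.Red.Step)).exists

theorem wordVal_mem_wordSpan {X : List (List (L × Bool))} {W : List (L × Bool)} (h : W ∈ X) :
    wordVal v W ∈ wordSpan v X :=
  Subgroup.subset_closure ⟨W, h, rfl⟩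

theorem wordSpan_le {X : List (List (L × Bool))} {K : Subgroup G} :
    wordSpan v X ≤ K ↔ ∀ W ∈ X, wordVal v W ∈ K := by
  rw [wordSpan, Subgroup.closure_le]
  exact ⟨fun h W hW => h ⟨W, hW, rfl⟩, fun h g ⟨W, hW, hg⟩ => hg ▸ h W hW⟩

theorem mem_closure_iff_exists_wordVal_getD {gens : List G} {g : G} :
    g ∈ Subgroup.closure {g | g ∈ gens} ↔ ∃ W, wordVal (fun i => gens.getD i 1) W = g := by
  rw [← mem_closure_range_iff_exists_wordVal]
  suffices Subgroup.closure {g | g ∈ gens} =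
      Subgroup.closure (Set.range fun i => gens.getD i 1) by rw [this]
  refine le_antisymm (Subgroup.closure_mono fun g hg => ?_) ((Subgroup.closure_le _).2 ?_)
  · obtain ⟨i, hi, rfl⟩ := List.mem_iff_getElem.1 hg
    exact ⟨i, by simp [hi]⟩
  · rintro _ ⟨i, rfl⟩
    by_cases hi : i < gens.length
    · simpa [hi] using Subgroup.subset_closure (k := {g | g ∈ gens}) (List.getElem_mem hi)
    · simp [hi]

theorem mem_wordSpan_iff {X : List (List (L × Bool))} {g : G} :
    g ∈ wordSpan v X ↔ ∃ V, wordVal v (wordSubst (fun i => X.getD i []) V) = g := by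
  have hspan : wordSpan v X = Subgroup.closure {g | g ∈ X.map (wordVal v)} := by
    simp [wordSpan]
  have hval : ∀ i, wordVal v (X.getD i []) = (X.map (wordVal v)).getD i 1 := fun i => by
    rw [← wordVal_nil v, List.getD_map]
  simp only [hspan, mem_closure_iff_exists_wordVal_getD, wordVal_wordSubst, hval]

theorem GWord.eval_eq_wordVal (gens : List G) (W : GWord) :
    GWord.eval gens W = wordVal (fun i => gens.getD i 1) W := by
  simp only [GWord.eval, wordVal, FreeGroup.lift_mk, Bool.cond_eq_ite]

theorem GWord.span_eq_wordSpan (gens : List G) (X : List GWord) :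
    GWord.span gens X = wordSpan (fun i => gens.getD i 1) X := by
  simp only [GWord.span, wordSpan, GWord.eval_eq_wordVal]

theorem GWord.exists_eval_eq {gens : List G} (h : Subgroup.closure {g | g ∈ gens} = ⊤) (g : G) :
    ∃ W : GWord, GWord.eval gens W = g := by
  simp only [GWord.eval_eq_wordVal, ← mem_closure_iff_exists_wordVal_getD, h, Subgroup.mem_top]

end Words

section WordAlgorithms

variable {α L : Type*} [Primcodable α] [Primcodable L]

theorem primrec_invRev : Primrec (FreeGroup.invRev : List (L × Bool) → List (L × Bool)) :=
  Primrec.list_reverse.comp (Primrec.list_map Primrec.id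
    ((Primrec.fst.comp Primrec.snd).pair (Primrec.not.comp (Primrec.snd.comp Primrec.snd))).to₂)

@[fun_prop]
theorem computable_invRev {f : α → List (L × Bool)} (hf : Computable f) :
    Computable fun a => FreeGroup.invRev (f a) :=
  primrec_invRev.to_comp.comp hf

theorem primrec_wordSubst_getD :
    Primrec₂ fun (X : List (List (L × Bool))) (V : List (ℕ × Bool)) =>
      wordSubst (fun i => X.getD i []) V := by
  have hletter : Primrec fun y : (List (List (L × Bool)) × List (ℕ × Bool)) × ℕ × Bool =>
      y.1.1.getD y.2.1 [] :=
    (Primrec.list_getD []).comp (Primrec.fst.comp Primrec.fst) (Primrec.fst.comp Primrec.snd)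
  exact Primrec.list_flatMap Primrec.snd (Primrec.cond (Primrec.snd.comp Primrec.snd) hletter
    (primrec_invRev.comp hletter)).to₂

@[fun_prop]
theorem computable_wordSubst_getD {X : α → List (List (L × Bool))} {V : α → List (ℕ × Bool)}
    (hX : Computable X) (hV : Computable V) :
    Computable fun a => wordSubst (fun i => (X a).getD i []) (V a) :=
  primrec_wordSubst_getD.to_comp.comp hX hV

variable {G : Type*} [Group G] {v : L → G} (hv : REPred fun W : List (L × Bool) => wordVal v W = 1)
include hv

theorem rePred_wordVal_eq {f g : α → List (L × Bool)} (hf : Computable f) (hg : Computable g) :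
    REPred fun a => wordVal v (f a) = wordVal v (g a) := by
  have hdiff : REPred fun a => wordVal v (FreeGroup.invRev (f a) ++ g a) = 1 :=
    rePred_comp hv (by fun_prop)
  refine hdiff.of_eq fun a => ?_
  rw [wordVal_append, wordVal_invRev, inv_mul_eq_one]

theorem rePred_mem_wordSpan {f : α → List (L × Bool)} {X : α → List (List (L × Bool))}
    (hf : Computable f) (hX : Computable X) :
    REPred fun a => wordVal v (f a) ∈ wordSpan v (X a) :=
  (rePred_exists (p := fun a V => wordVal v (wordSubst (fun i => (X a).getD i []) V) =
    wordVal v (f a)) (rePred_wordVal_eq hv (by fun_prop) (by fun_prop))).of_eq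
      fun _ => (mem_wordSpan_iff v).symm

theorem rePred_wordSpan_le {X Y : α → List (List (L × Bool))} (hX : Computable X)
    (hY : Computable Y) : REPred fun a => wordSpan v (X a) ≤ wordSpan v (Y a) :=
  (rePred_forall_mem_list (p := fun a W => wordVal v W ∈ wordSpan v (Y a)) hX
    (rePred_mem_wordSpan hv (by fun_prop) (by fun_prop))).of_eq fun _ => (wordSpan_le v).symm

theorem rePred_wordSpan_eq {X Y : α → List (List (L × Bool))} (hX : Computable X)
    (hY : Computable Y) : REPred fun a => wordSpan v (X a) = wordSpan v (Y a) :=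
  (rePred_and (rePred_wordSpan_le hv hX hY) (rePred_wordSpan_le hv hY hX)).of_eq
    fun _ => le_antisymm_iff.symm

end WordAlgorithms

section NormalClosure

variable {L : Type*} {R : Set (List (L × Bool))}

/-- The product of the conjugates `u r u⁻¹`, for the pairs `(u, r)` in a list. -/
def conjugatesWord (l : List (List (L × Bool) × List (L × Bool))) : List (L × Bool) :=
  l.flatMap fun p => p.1 ++ p.2 ++ FreeGroup.invRev p.1

theorem mk_conjugatesWord_cons (p : List (L × Bool) × List (L × Bool))
    (l : List (List (L × Bool) × List (L × Bool))) :
    FreeGroup.mk (conjugatesWord (p :: l)) =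
      FreeGroup.mk p.1 * FreeGroup.mk p.2 * (FreeGroup.mk p.1)⁻¹ *
        FreeGroup.mk (conjugatesWord l) := by
  simp only [conjugatesWord, List.flatMap_cons, FreeGroup.mul_mk, FreeGroup.inv_mk]

theorem mk_conjugatesWord_mem {l : List (List (L × Bool) × List (L × Bool))}
    (hl : ∀ p ∈ l, p.2 ∈ R ∨ FreeGroup.invRev p.2 ∈ R) :
    FreeGroup.mk (conjugatesWord l) ∈ Subgroup.normalClosure (FreeGroup.mk '' R) := by
  induction l with
  | nil => exact one_mem _
  | cons p l ih =>
    rw [mk_conjugatesWord_cons]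
    refine mul_mem (Subgroup.normalClosure_normal.conj_mem _ ?_ _)
      (ih fun q hq => hl q (List.mem_cons_of_mem p hq))
    rcases hl p List.mem_cons_self with hp | hp
    · exact Subgroup.subset_normalClosure ⟨_, hp, rfl⟩
    · rw [← inv_mem_iff, FreeGroup.inv_mk]
      exact Subgroup.subset_normalClosure ⟨_, hp, rfl⟩

theorem exists_mk_conjugatesWord_eq {g : FreeGroup L}
    (hg : g ∈ Subgroup.normalClosure (FreeGroup.mk '' R)) :
    ∃ l, (∀ p ∈ l, p.2 ∈ R ∨ FreeGroup.invRev p.2 ∈ R) ∧ FreeGroup.mk (conjugatesWord l) = g := by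
  rw [Subgroup.normalClosure] at hg
  induction hg using Subgroup.closure_induction_left with
  | one => exact ⟨[], by simp, rfl⟩
  | mul_left c hc h _ ih =>
    obtain ⟨_, ⟨r, hr, rfl⟩, hc⟩ := Group.mem_conjugatesOfSet_iff.1 hc
    obtain ⟨⟨u⟩, rfl⟩ := isConj_iff.1 hc
    obtain ⟨l, hl, rfl⟩ := ih
    exact ⟨(u, r) :: l, List.forall_mem_cons.2 ⟨.inl hr, hl⟩, mk_conjugatesWord_cons _ _⟩
  | inv_mul_cancel c hc h _ ih =>
    obtain ⟨_, ⟨r, hr, rfl⟩, hc⟩ := Group.mem_conjugatesOfSet_iff.1 hc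
    obtain ⟨⟨u⟩, rfl⟩ := isConj_iff.1 hc
    obtain ⟨l, hl, rfl⟩ := ih
    refine ⟨(u, FreeGroup.invRev r) :: l, List.forall_mem_cons.2
      ⟨.inr (by rwa [FreeGroup.invRev_invRev]), hl⟩, ?_⟩
    rw [mk_conjugatesWord_cons, ← FreeGroup.inv_mk]
    simp only [FreeGroup.quot_mk_eq_mk]
    group

variable [Primcodable L]

theorem rePred_mk_eq_one : REPred fun W : List (L × Bool) => FreeGroup.mk W = 1 := by
  have hstep : REPred fun x : Unit × List (L × Bool) × List (L × Bool) =>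
      ∃ y : List (L × Bool) × List (L × Bool) × L × Bool,
        x.2.1 = y.1 ++ (y.2.2.1, y.2.2.2) :: (y.2.2.1, !y.2.2.2) :: y.2.1 ∧
          x.2.2 = y.1 ++ y.2.1 := by
    have hnot : Computable not := Primrec.not.to_comp
    exact rePred_exists (rePred_and (rePred_eq (by fun_prop) (by fun_prop))
      (rePred_eq (by fun_prop) (by fun_prop)))
  have hred := rePred_reflTransGen (r := fun _ : Unit => FreeGroup.Red.Step)
    (hstep.of_eq fun x => ⟨fun ⟨_, h, h'⟩ => h ▸ h' ▸ .not, ?_⟩)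
  · refine (rePred_comp hred (f := fun W => ((), W, [])) (by fun_prop)).of_eq fun W => ?_
    rw [FreeGroup.one_eq_mk, FreeGroup.Red.exact]
    exact ⟨fun h => ⟨[], h, .refl⟩, fun ⟨_, h, h'⟩ => FreeGroup.Red.nil_iff.1 h' ▸ h⟩
  · obtain ⟨-, W, W'⟩ := x
    rintro ⟨⟩
    exact ⟨(_, _, _, _), rfl, rfl⟩

theorem rePred_mem_normalClosure (hR : REPred (· ∈ R)) :
    REPred fun W => FreeGroup.mk W ∈ Subgroup.normalClosure (FreeGroup.mk '' R) := by
  have hval : ∀ W : List (L × Bool), wordVal FreeGroup.of W = FreeGroup.mk W := fun W => by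
    simp only [wordVal, FreeGroup.lift_of_eq_id, MonoidHom.id_apply]
  have hconj : Computable (conjugatesWord (L := L)) :=
    (Primrec.list_flatMap Primrec.id (Primrec.list_append.comp (Primrec.list_append.comp
      (Primrec.fst.comp Primrec.snd) (Primrec.snd.comp Primrec.snd))
        (primrec_invRev.comp (Primrec.fst.comp Primrec.snd))).to₂).to_comp
  have hrel : REPred fun l : List (List (L × Bool) × List (L × Bool)) =>
      ∀ p ∈ l, p.2 ∈ R ∨ FreeGroup.invRev p.2 ∈ R :=
    rePred_forall_mem_list
      (p := fun _ (p : List (L × Bool) × List (L × Bool)) => p.2 ∈ R ∨ FreeGroup.invRev p.2 ∈ R)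
      (by fun_prop) (rePred_or (rePred_comp hR (by fun_prop)) (rePred_comp hR (by fun_prop)))
  have hfree : REPred fun W : List (L × Bool) => wordVal FreeGroup.of W = 1 :=
    rePred_mk_eq_one.of_eq fun W => by rw [hval]
  refine (rePred_exists (p := fun W l => (∀ p ∈ l, p.2 ∈ R ∨ FreeGroup.invRev p.2 ∈ R) ∧
    wordVal FreeGroup.of (conjugatesWord l) = wordVal FreeGroup.of W)
      (rePred_and (rePred_comp hrel Computable.snd)
        (rePred_wordVal_eq hfree (hconj.comp Computable.snd) Computable.fst))).of_eq fun W => ?_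
  simp only [hval]
  exact ⟨fun ⟨l, hl, hW⟩ => hW ▸ mk_conjugatesWord_mem hl, exists_mk_conjugatesWord_eq⟩

end NormalClosure

/-! ## Reduced paths -/

namespace GraphOfGroups.Path

variable {Γ : SerreGraph.{u}} {A : GraphOfGroups.{u, v, w} Γ}

/-- The number of edges of a path. -/
def length : ∀ {a b : Γ.V}, A.Path a b → ℕ
  | _, _, single _ => 0
  | _, _, cons _ _ p => p.length + 1

theorem length_single_comp {a b : Γ.V} (g : A.GV a) (p : A.Path a b) :
    ((single g).comp p).length = p.length := by
  cases p <;> rfl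

theorem eq_of_length_eq_zero {a b : Γ.V} (p : A.Path a b) (h : p.length = 0) : a = b := by
  cases p with
  | single => rfl
  | cons => simp [length] at h

theorem single_comp_single_comp {a b : Γ.V} (g h : A.GV a) (p : A.Path a b) :
    (single g).comp ((single h).comp p) = (single (g * h)).comp p :=
  (comp_assoc (single g) (single h) p).symm

theorem Red.cons_cases {a b d : Γ.V} {g : A.GV a} {e : Γ.E a b} {p : A.Path b d}
    {q : A.Path a d} (h : Red (cons g e p) q) :
    (∃ c r, p = cons (A.ω e c) (Γ.inv e) r ∧ q = (single (g * A.α e c)).comp r) ∨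
      ∃ q', Red p q' ∧ q = cons g e q' := by
  cases h with
  | head g e c p => exact .inl ⟨c, p, rfl, rfl⟩
  | tail g e h => exact .inr ⟨_, h, rfl⟩

theorem Red.length_lt {a b : Γ.V} {p q : A.Path a b} (h : Red p q) : q.length < p.length := by
  induction h with
  | head g e c p => simp only [length, length_single_comp]; omega
  | tail g e _ ih => simp only [length]; omega

theorem isReduced_of_length_eq_zero {a b : Γ.V} {p : A.Path a b} (h : p.length = 0) :
    p.IsReduced := fun _ hq => by
  have := hq.length_lt
  omega

theorem exists_isReduced {a b : Γ.V} (p : A.Path a b) : ∃ q, q.IsReduced ∧ p.Equiv q := by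
  induction hn : p.length using Nat.strong_induction_on generalizing p with
  | _ n ih =>
    by_cases h : p.IsReduced
    · exact ⟨p, h, .refl _⟩
    · simp only [IsReduced, not_forall, not_not] at h
      obtain ⟨r, hr⟩ := h
      obtain ⟨q, hq, hrq⟩ := ih _ (hn ▸ hr.length_lt) r rfl
      exact ⟨q, hq, .trans _ _ _ (.rel _ _ hr) hrq⟩

/-- `Slide p q`: the path `q` is obtained from `p` by moving an element of an edge group from
one side of the edge to the other side. Elementary reduction is confluent only up to slides. -/
inductive Slide : ∀ {a b : Γ.V}, A.Path a b → A.Path a b → Prop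
  | head {a b d : Γ.V} (g : A.GV a) (e : Γ.E a b) (c : A.GE e) (p : A.Path b d) :
      Slide (cons (g * A.α e c) e p) (cons g e ((single (A.ω e c)).comp p))
  | tail {a b d : Γ.V} (g : A.GV a) (e : Γ.E a b) {p q : A.Path b d} :
      Slide p q → Slide (cons g e p) (cons g e q)

theorem Slide.cons_cases {a b d : Γ.V} {g : A.GV a} {e : Γ.E a b} {p : A.Path b d}
    {q : A.Path a d} (h : Slide (cons g e p) q) :
    (∃ g' c, g = g' * A.α e c ∧ q = cons g' e ((single (A.ω e c)).comp p)) ∨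
      ∃ q', Slide p q' ∧ q = cons g e q' := by
  cases h with
  | head g e c p => exact .inl ⟨g, c, rfl, rfl⟩
  | tail g e h => exact .inr ⟨_, h, rfl⟩

theorem Slide.symm {a b : Γ.V} {p q : A.Path a b} (h : Slide p q) : Slide q p := by
  induction h with
  | head g e c p =>
    simpa only [map_inv, mul_inv_cancel_right, single_comp_single_comp, inv_mul_cancel,
      one_comp] using Slide.head (g * A.α e c) e c⁻¹ ((single (A.ω e c)).comp p)
  | tail g e _ ih => exact .tail g e ih

theorem Slide.length_eq {a b : Γ.V} {p q : A.Path a b} (h : Slide p q) :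
    p.length = q.length := by
  induction h with
  | head g e c p => simp only [length, length_single_comp]
  | tail g e _ ih => simp only [length, ih]

theorem Slide.single_comp {a b : Γ.V} (g : A.GV a) {p q : A.Path a b} (h : Slide p q) :
    Slide ((single g).comp p) ((single g).comp q) := by
  cases h with
  | head k e c p => simpa only [comp, mul_assoc] using Slide.head (g * k) e c p
  | tail k e h => exact .tail (g * k) e h

/-- The class of a path under the equivalence relation generated by slides. -/
def slideClass {a b : Γ.V} (p : A.Path a b) : Quot (Slide (A := A) (a := a) (b := b)) :=
  Quot.mk Slide p

theorem Slide.slideClass_eq {a b : Γ.V} {p q : A.Path a b} (h : Slide p q) :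
    p.slideClass = q.slideClass :=
  Quot.sound h

theorem slideClass_cons_congr {a b d : Γ.V} (g : A.GV a) (e : Γ.E a b) {p q : A.Path b d}
    (h : p.slideClass = q.slideClass) : (cons g e p).slideClass = (cons g e q).slideClass :=
  congrArg (Quot.map (cons g e) fun _ _ => Slide.tail g e) h

theorem length_eq_of_slideClass_eq {a b : Γ.V} {p q : A.Path a b}
    (h : p.slideClass = q.slideClass) : p.length = q.length :=
  congrArg (Quot.lift length fun _ _ => Slide.length_eq) h

theorem Slide.exists_red_of_head_red {a b d : Γ.V} {g : A.GV a} {e : Γ.E a b} {c : A.GE e}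
    {r : A.Path a d} {p : A.Path b d} (h : Slide (cons (A.ω e c) (Γ.inv e) r) p) :
    ∃ q, Red (cons g e p) q ∧ ((single (g * A.α e c)).comp r).slideClass = q.slideClass := by
  obtain ⟨k, d, hk, rfl⟩ | ⟨r', hr, rfl⟩ := h.cons_cases
  · obtain ⟨φ, hφ⟩ := A.inv_edge e
    obtain ⟨d, rfl⟩ := φ.surjective d
    obtain rfl : k = A.ω e (c * d⁻¹) := by
      rw [map_mul, hk, (hφ d).1, map_inv, mul_inv_cancel_right]
    refine ⟨_, .head g e (c * d⁻¹) _, ?_⟩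
    rw [single_comp_single_comp, (hφ d).2, mul_assoc, ← map_mul, inv_mul_cancel_right]
  · exact ⟨_, .head g e c r', (hr.single_comp _).slideClass_eq⟩

theorem Slide.exists_red {a b : Γ.V} {p p' q : A.Path a b} (h : Slide p p') (k : Red p q) :
    ∃ q', Red p' q' ∧ q.slideClass = q'.slideClass := by
  induction p with
  | single g => cases k
  | @cons a b d g e p ih =>
    obtain ⟨g', c, rfl, rfl⟩ | ⟨p', hp, rfl⟩ := h.cons_cases
    · obtain ⟨d, r, rfl, rfl⟩ | ⟨p₂, hp₂, rfl⟩ := k.cons_cases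
      · refine ⟨_, ?_, rfl⟩
        simpa only [comp, map_mul, mul_assoc] using Red.head g' e (c * d) r
      · exact ⟨_, .tail g' e (hp₂.comp_left _), (Slide.head g' e c p₂).slideClass_eq⟩
    · obtain ⟨d, r, rfl, rfl⟩ | ⟨p₂, hp₂, rfl⟩ := k.cons_cases
      · exact hp.exists_red_of_head_red
      · obtain ⟨q', hq, hs⟩ := ih hp hp₂
        exact ⟨_, .tail g e hq, slideClass_cons_congr g e hs⟩

theorem Red.confluent_head_tail {a b d : Γ.V} (g : A.GV a) (e : Γ.E a b) (c : A.GE e)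
    (r : A.Path a d) {q : A.Path b d} (k : Red (Path.cons (A.ω e c) (Γ.inv e) r) q) :
    ((single (g * A.α e c)).comp r).slideClass = (Path.cons g e q).slideClass ∨
      ∃ s, Red ((single (g * A.α e c)).comp r) s ∧ Red (Path.cons g e q) s := by
  obtain ⟨c', s, rfl, rfl⟩ | ⟨r', hr, rfl⟩ := k.cons_cases
  · left
    obtain ⟨φ, hφ⟩ := A.inv_edge e
    obtain ⟨c', rfl⟩ := φ.surjective c'
    have hslide := (Slide.head g e (c * c') s).slideClass_eq
    rw [map_mul, map_mul, ← mul_assoc] at hslide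
    rwa [(hφ c').1, (hφ c').2, Γ.inv_inv]
  · exact .inr ⟨_, hr.comp_left _, .head g e c r'⟩

theorem Red.locally_confluent {a b : Γ.V} {p q₁ q₂ : A.Path a b} (h₁ : Red p q₁)
    (h₂ : Red p q₂) :
    q₁.slideClass = q₂.slideClass ∨
      ∃ r₁ r₂, Red q₁ r₁ ∧ Red q₂ r₂ ∧ r₁.slideClass = r₂.slideClass := by
  induction p with
  | single g => cases h₁
  | @cons a b d g e p ih =>
    obtain ⟨c, r, rfl, rfl⟩ | ⟨p₁, hp₁, rfl⟩ := h₁.cons_cases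
    · obtain ⟨c', r', h, rfl⟩ | ⟨p₂, hp₂, rfl⟩ := h₂.cons_cases
      · simp only [Path.cons.injEq, heq_eq_eq, true_and] at h
        obtain ⟨h, rfl⟩ := h
        obtain rfl := A.ω_injective e h
        exact .inl rfl
      · exact (Red.confluent_head_tail g e c r hp₂).imp_right
          fun ⟨s, hs, hs'⟩ => ⟨s, s, hs, hs', rfl⟩
    · obtain ⟨c, r, rfl, rfl⟩ | ⟨p₂, hp₂, rfl⟩ := h₂.cons_cases
      · exact (Red.confluent_head_tail g e c r hp₁).imp Eq.symm
          fun ⟨s, hs, hs'⟩ => ⟨s, s, hs', hs, rfl⟩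
      · obtain h | ⟨r₁, r₂, k₁, k₂, h⟩ := ih hp₁ hp₂
        · exact .inl (slideClass_cons_congr g e h)
        · exact .inr ⟨_, _, .tail g e k₁, .tail g e k₂, slideClass_cons_congr g e h⟩

/-- Elementary reduction of classes of paths up to slides. -/
def SlideRed {a b : Γ.V} (x y : Quot (Slide (A := A) (a := a) (b := b))) : Prop :=
  Quot.liftOn x (fun p => ∃ q, Red p q ∧ q.slideClass = y) fun _ _ h => propext
    ⟨fun ⟨_, hq, hy⟩ => (h.exists_red hq).imp fun _ hr => ⟨hr.1, hr.2.symm.trans hy⟩,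
      fun ⟨_, hq, hy⟩ => (h.symm.exists_red hq).imp fun _ hr => ⟨hr.1, hr.2.symm.trans hy⟩⟩

theorem slideRed_slideClass_iff {a b : Γ.V} {p : A.Path a b} {y} :
    SlideRed p.slideClass y ↔ ∃ q, Red p q ∧ q.slideClass = y :=
  Iff.rfl

theorem Red.slideRed {a b : Γ.V} {p q : A.Path a b} (h : Red p q) :
    SlideRed p.slideClass q.slideClass :=
  ⟨q, h, rfl⟩

theorem SlideRed.diamond {a b : Γ.V} (x y z : Quot (Slide (A := A) (a := a) (b := b)))
    (hy : SlideRed x y) (hz : SlideRed x z) :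
    ∃ d, Relation.ReflGen SlideRed y d ∧ Relation.ReflTransGen SlideRed z d := by
  obtain ⟨p, rfl⟩ := Quot.exists_rep x
  obtain ⟨q₁, h₁, rfl⟩ := slideRed_slideClass_iff.1 hy
  obtain ⟨q₂, h₂, rfl⟩ := slideRed_slideClass_iff.1 hz
  obtain h | ⟨r₁, r₂, k₁, k₂, h⟩ := h₁.locally_confluent h₂
  · exact ⟨q₂.slideClass, h ▸ .refl, .refl⟩
  · exact ⟨r₁.slideClass, .single k₁.slideRed, .single (h ▸ k₂.slideRed)⟩

theorem Equiv.join_slideRed {a b : Γ.V} {p q : A.Path a b} (h : p.Equiv q) :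
    Relation.Join (Relation.ReflTransGen SlideRed) p.slideClass q.slideClass := by
  have hequiv := Relation.equivalence_join_reflTransGen
    (SlideRed.diamond (A := A) (a := a) (b := b))
  induction h with
  | rel p q h => exact ⟨_, .single h.slideRed, .refl⟩
  | refl => exact hequiv.refl _
  | symm _ _ _ ih => exact hequiv.symm ih
  | trans _ _ _ _ _ ih ih' => exact hequiv.trans ih ih'

theorem IsReduced.slideClass_eq_of_reflTransGen {a b : Γ.V} {p : A.Path a b} (hp : p.IsReduced)
    {y} (h : Relation.ReflTransGen SlideRed p.slideClass y) : p.slideClass = y := by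
  obtain h | ⟨_, hz, -⟩ := Relation.ReflTransGen.cases_head h
  · exact h
  · obtain ⟨q, hq, -⟩ := slideRed_slideClass_iff.1 hz
    exact absurd hq (hp q)

theorem IsReduced.slideClass_eq {a b : Γ.V} {p q : A.Path a b} (hp : p.IsReduced)
    (hq : q.IsReduced) (h : p.Equiv q) : p.slideClass = q.slideClass := by
  obtain ⟨y, hpy, hqy⟩ := h.join_slideRed
  rw [hp.slideClass_eq_of_reflTransGen hpy, hq.slideClass_eq_of_reflTransGen hqy]

theorem IsReduced.length_eq {a b : Γ.V} {p q : A.Path a b} (hp : p.IsReduced)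
    (hq : q.IsReduced) (h : p.Equiv q) : p.length = q.length :=
  length_eq_of_slideClass_eq (hp.slideClass_eq hq h)

end GraphOfGroups.Path

/-! ## Paths in `A`-graphs -/

theorem SerreGraph.edge_eq_inv_iff {Γ : SerreGraph.{u}} {a b d : Γ.V} (e : Γ.E a b)
    (e' : Γ.E b d) :
    (⟨a, b, e⟩ : Γ.Edge) = ⟨d, b, Γ.inv e'⟩ ↔ d = a ∧ e' ≍ Γ.inv e := by
  constructor
  · intro h
    obtain rfl : a = d := congrArg Sigma.fst h
    simp only [Sigma.mk.injEq, heq_eq_eq, true_and] at h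
    rw [h, Γ.inv_inv]
    exact ⟨rfl, HEq.rfl⟩
  · rintro ⟨rfl, h⟩
    rw [eq_of_heq h, Γ.inv_inv]

namespace AGraph

open GraphOfGroups

variable {Γ : SerreGraph.{u}} {A : GraphOfGroups.{u, v, w} Γ} (𝔹 : AGraph A)

theorem μ_comp {a b c : 𝔹.B.V} (p : 𝔹.toGraphOfGroups.Path a b)
    (q : 𝔹.toGraphOfGroups.Path b c) : 𝔹.μ (p.comp q) = (𝔹.μ p).comp (𝔹.μ q) := by
  induction p with
  | single g =>
    cases q with
    | single h => rfl
    | cons h f q => exact congrArg (Path.cons · _ _) (mul_assoc g.1 h.1 (𝔹.lα f))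
  | cons g f p ih => simp only [Path.comp, μ, ih, Path.comp_assoc]

theorem length_μ {a b : 𝔹.B.V} (p : 𝔹.toGraphOfGroups.Path a b) :
    (𝔹.μ p).length = p.length := by
  induction p with
  | single g => rfl
  | cons g f p ih => simp only [μ, Path.length, Path.length_single_comp, ih]

theorem μ_cons_cons_inv {a b d : 𝔹.B.V} (g : 𝔹.grp a) (f : 𝔹.B.E a b) (c : 𝔹.edgeGrp f)
    (p : 𝔹.toGraphOfGroups.Path a d) :
    𝔹.μ (.cons g f (.cons (𝔹.toGraphOfGroups.ω f c) (𝔹.B.inv f) p)) =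
      .cons (g.1 * 𝔹.lα f) (𝔹.etyp f) (.cons (A.ω (𝔹.etyp f) c) (Γ.inv (𝔹.etyp f))
        ((Path.single (𝔹.lα f)⁻¹).comp (𝔹.μ p))) := by
  have hω : ((show 𝔹.grp b from 𝔹.toGraphOfGroups.ω f c) : A.GV (𝔹.typ b)) =
    (𝔹.lω f)⁻¹ * A.ω (𝔹.etyp f) c * 𝔹.lω f := 𝔹.edgeω_coe f c
  simp only [μ]
  rw [hω, 𝔹.etyp_inv, 𝔹.lα_inv, 𝔹.lω_inv]
  simp [Path.comp, mul_assoc]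

theorem μ_single_mul_edgeα_comp {a b d : 𝔹.B.V} (g : 𝔹.grp a) (f : 𝔹.B.E a b)
    (c : 𝔹.edgeGrp f) (p : 𝔹.toGraphOfGroups.Path a d) :
    𝔹.μ ((Path.single (A := 𝔹.toGraphOfGroups) (g * 𝔹.edgeα f c)).comp p) =
      (Path.single (g.1 * 𝔹.lα f * A.α (𝔹.etyp f) c)).comp
        ((Path.single (𝔹.lα f)⁻¹).comp (𝔹.μ p)) := by
  rw [μ_comp, Path.single_comp_single_comp]
  have hα : ((g * 𝔹.edgeα f c : 𝔹.grp a) : A.GV (𝔹.typ a)) =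
      g.1 * 𝔹.lα f * A.α (𝔹.etyp f) c * (𝔹.lα f)⁻¹ := by
    rw [Subgroup.coe_mul, edgeα_coe]
    group
  exact congrArg (fun x => (Path.single x).comp (𝔹.μ p)) hα

theorem μ_red {a b : 𝔹.B.V} {p q : 𝔹.toGraphOfGroups.Path a b} (h : Path.Red p q) :
    Path.Red (𝔹.μ p) (𝔹.μ q) := by
  induction h with
  | head g f c p =>
    have hhead := Path.Red.head ((show 𝔹.grp _ from g).1 * 𝔹.lα f) (𝔹.etyp f)
      (show 𝔹.edgeGrp f from c).1 ((Path.single (𝔹.lα f)⁻¹).comp (𝔹.μ p))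
    rw [← μ_single_mul_edgeα_comp 𝔹 g f c, ← μ_cons_cons_inv 𝔹 g f c] at hhead
    exact hhead
  | tail g f _ ih => exact .tail _ _ (ih.comp_left _)

theorem μ_equiv {a b : 𝔹.B.V} {p q : 𝔹.toGraphOfGroups.Path a b} (h : p.Equiv q) :
    (𝔹.μ p).Equiv (𝔹.μ q) := by
  induction h with
  | rel _ _ h => exact .rel _ _ (𝔹.μ_red h)
  | refl => exact .refl _
  | symm _ _ _ ih => exact .symm _ _ ih
  | trans _ _ _ _ _ ih ih' => exact .trans _ _ _ ih ih'

theorem mem_L_iff {a b : 𝔹.B.V} (g : A.PathClass (𝔹.typ a) (𝔹.typ b)) :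
    g ∈ 𝔹.L a b ↔ ∃ q : 𝔹.toGraphOfGroups.Path a b, (𝔹.μ q).cls = g := by
  constructor
  · rintro ⟨q, -, h⟩
    exact ⟨q, h⟩
  · rintro ⟨q, rfl⟩
    obtain ⟨r, hr, h⟩ := q.exists_isReduced
    exact ⟨r, hr, (Quotient.sound (s := A.pathSetoid _ _) (𝔹.μ_equiv h)).symm⟩

variable {𝔹}

theorem IsFolded.preα_eq (h𝔹 : 𝔹.IsFolded) {a b : 𝔹.B.V} (f : 𝔹.B.E a b) : 𝔹.preα f = 𝔹.preω f :=
  not_not.1 fun h => h𝔹.2 ⟨a, b, f, h⟩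

theorem IsFolded.exists_ω_eq (h𝔹 : 𝔹.IsFolded) {a b : 𝔹.B.V} {f : 𝔹.B.E a b} {k : 𝔹.grp b}
    {c : A.GE (𝔹.etyp f)} (hc : 𝔹.lω f * k * 𝔹.lα (𝔹.B.inv f) = A.ω (𝔹.etyp f) c) :
    ∃ d : 𝔹.edgeGrp f, 𝔹.toGraphOfGroups.ω f d = k := by
  have hk : (k : A.GV (𝔹.typ b)) = (𝔹.lω f)⁻¹ * A.ω (𝔹.etyp f) c * 𝔹.lω f := by
    rw [← hc, 𝔹.lα_inv]
    group
  have hω : c ∈ 𝔹.preω f := by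
    rw [mem_preω, ← hk]
    exact k.2
  have hα : c ∈ 𝔹.preα f := h𝔹.preα_eq f ▸ hω
  exact ⟨⟨c, hα, hω⟩, Subtype.ext ((𝔹.edgeω_coe f ⟨c, hα, hω⟩).trans hk.symm)⟩

theorem IsFolded.exists_red_cons_cons (h𝔹 : 𝔹.IsFolded) {a b d d' : 𝔹.B.V} {g : 𝔹.grp a}
    {f : 𝔹.B.E a b} {k : 𝔹.grp b} {f' : 𝔹.B.E b d'} {p : 𝔹.toGraphOfGroups.Path d' d}
    (htyp : 𝔹.typ d' = 𝔹.typ a) (hetyp : 𝔹.etyp f' ≍ Γ.inv (𝔹.etyp f))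
    {c : A.GE (𝔹.etyp f)} (hc : 𝔹.lω f * (k * 𝔹.lα f') = A.ω (𝔹.etyp f) c) :
    ∃ q, Path.Red (A := 𝔹.toGraphOfGroups) (.cons g f (.cons k f' p)) q := by
  rw [← mul_assoc] at hc
  by_cases hne : (⟨a, b, f⟩ : 𝔹.B.Edge) = ⟨d', b, 𝔹.B.inv f'⟩
  · obtain ⟨rfl, hf⟩ := (SerreGraph.edge_eq_inv_iff _ _).1 hne
    obtain rfl := eq_of_heq hf
    obtain ⟨d, rfl⟩ := h𝔹.exists_ω_eq hc
    exact ⟨_, .head g f d p⟩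
  · have hedge : (⟨_, _, 𝔹.etyp f⟩ : Γ.Edge) = ⟨_, _, 𝔹.etyp (𝔹.B.inv f')⟩ := by
      rw [𝔹.etyp_inv]
      exact (SerreGraph.edge_eq_inv_iff _ _).2 ⟨htyp, hetyp⟩
    exact absurd ⟨a, b, d', f, f', hne, hedge, k, k.2, c, hc⟩ h𝔹.1

theorem IsFolded.isReduced_μ (h𝔹 : 𝔹.IsFolded) {a b : 𝔹.B.V}
    {q : 𝔹.toGraphOfGroups.Path a b} (hq : q.IsReduced) : (𝔹.μ q).IsReduced := by
  induction q with
  | single g => exact Path.isReduced_of_length_eq_zero rfl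
  | cons g f q ih =>
    intro r hr
    obtain ⟨c, s, hs, -⟩ | ⟨r', hr', -⟩ := Path.Red.cons_cases hr
    · cases q with
      | single k => simp [μ, Path.comp] at hs
      | cons k f' q =>
        simp only [μ, Path.comp, Path.cons.injEq] at hs
        obtain ⟨htyp, hc, hetyp, -⟩ := hs
        obtain ⟨r, hr⟩ := h𝔹.exists_red_cons_cons htyp hetyp hc
        exact hq r hr
    · have hred := hr'.comp_left (Path.single (𝔹.lω f)⁻¹)
      rw [Path.single_comp_single_comp, inv_mul_cancel, Path.one_comp] at hred
      exact ih (fun r hr => hq _ (.tail g f hr)) _ hred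

theorem IsFolded.eq_of_length_eq_zero (h𝔹 : 𝔹.IsFolded) {a b : 𝔹.B.V}
    (q : 𝔹.toGraphOfGroups.Path a b) (r : A.Path (𝔹.typ a) (𝔹.typ b)) (hr : r.length = 0)
    (h : (𝔹.μ q).Equiv r) : a = b := by
  obtain ⟨q', hq', hqq'⟩ := q.exists_isReduced
  refine q'.eq_of_length_eq_zero ?_
  rw [← length_μ, ← hr]
  exact (h𝔹.isReduced_μ hq').length_eq (Path.isReduced_of_length_eq_zero hr)
    (.trans _ _ _ (.symm _ _ (𝔹.μ_equiv hqq')) h)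

end AGraph

/-! ## The fundamental group -/

namespace GraphOfGroups

variable {Γ : SerreGraph.{u}} {A : GraphOfGroups.{u, v, w} Γ}

theorem Path.cls_eq_iff {a b : Γ.V} {p q : A.Path a b} : p.cls = q.cls ↔ p.Equiv q :=
  ⟨Quotient.exact (s := A.pathSetoid a b), Quotient.sound (s := A.pathSetoid a b)⟩

theorem Path.cls_mul {a : Γ.V} (p q : A.Path a a) : p.cls * q.cls = ((p.comp q).cls : A.π₁ a) :=
  rfl

theorem Path.cls_one {a : Γ.V} : (1 : A.π₁ a) = (Path.single 1 : A.Path a a).cls := rfl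

section PathVal

variable {Q : Type*} [Group Q] (φ : ∀ a, A.GV a →* Q) (t : ∀ {a b : Γ.V}, Γ.E a b → Q)

/-- The product of the elements and edges of a path, for given homomorphisms `φ` from the vertex
groups and values `t` of the edges. -/
def pathVal : ∀ {a b : Γ.V}, A.Path a b → Q
  | a, _, .single g => φ a g
  | a, _, .cons g e p => φ a g * t e * pathVal p

theorem pathVal_comp {a b c : Γ.V} (p : A.Path a b) (q : A.Path b c) :
    pathVal φ t (p.comp q) = pathVal φ t p * pathVal φ t q := by
  induction p with
  | single g => cases q <;> simp only [Path.comp, pathVal, map_mul, mul_assoc]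
  | cons g e p ih => simp only [Path.comp, pathVal, ih, mul_assoc]

variable {φ t} (ht : ∀ {a b : Γ.V} (e : Γ.E a b) (c : A.GE e),
  t e * φ b (A.ω e c) * t (Γ.inv e) = φ a (A.α e c))
include ht

theorem pathVal_eq_of_red {a b : Γ.V} {p q : A.Path a b} (h : Path.Red p q) :
    pathVal φ t p = pathVal φ t q := by
  induction h with
  | head g e c p =>
    rw [pathVal_comp]
    simp only [pathVal, map_mul, ← ht e c, mul_assoc]
  | tail g e _ ih => simp only [pathVal, ih]

theorem pathVal_eq_of_equiv {a b : Γ.V} {p q : A.Path a b} (h : p.Equiv q) :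
    pathVal φ t p = pathVal φ t q := by
  induction h with
  | rel _ _ h => exact pathVal_eq_of_red ht h
  | refl => rfl
  | symm _ _ _ ih => exact ih.symm
  | trans _ _ _ _ _ ih ih' => exact ih.trans ih'

theorem pathVal_symm {a b : Γ.V} (p : A.Path a b) :
    pathVal φ t p.symm = (pathVal φ t p)⁻¹ := by
  rw [eq_inv_iff_mul_eq_one, ← pathVal_comp, pathVal_eq_of_equiv ht p.symm_comp]
  exact map_one (φ b)

/-- The universal property of the fundamental group. -/
def π₁Lift (v₀ : Γ.V) : A.π₁ v₀ →* Q where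
  toFun := Quotient.lift (pathVal φ t) fun _ _ => pathVal_eq_of_equiv ht
  map_one' := map_one (φ v₀)
  map_mul' x y := by
    induction x using Quotient.inductionOn
    induction y using Quotient.inductionOn
    exact pathVal_comp φ t _ _

theorem π₁Lift_cls {v₀ : Γ.V} (p : A.Path v₀ v₀) : π₁Lift ht v₀ p.cls = pathVal φ t p := rfl

end PathVal

section Loop

variable {v₀ : Γ.V} (τ : ∀ a, A.Path v₀ a)

/-- The element of the fundamental group given by a path, after its endpoints have been joined to
the base point by the paths `τ`. -/
def toLoop {a b : Γ.V} (p : A.Path a b) : A.π₁ v₀ := ((τ a).comp (p.comp (τ b).symm)).cls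

variable {τ} in
theorem toLoop_congr {a b : Γ.V} {p q : A.Path a b} (h : p.Equiv q) : toLoop τ p = toLoop τ q :=
  Path.cls_eq_iff.2 (Path.Equiv.comp (.refl _) (Path.Equiv.comp h (.refl _)))

variable {τ} in
theorem equiv_of_toLoop_eq {a b : Γ.V} {p q : A.Path a b} (h : toLoop τ p = toLoop τ q) :
    p.Equiv q := by
  have hunjoin : ∀ p : A.Path a b,
      ((τ a).symm.comp (((τ a).comp (p.comp (τ b).symm)).comp (τ b))).Equiv p := fun p => by
    rw [Path.comp_assoc, Path.comp_assoc, ← Path.comp_assoc]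
    have hcancel := Path.Equiv.comp (τ a).symm_comp (Path.Equiv.comp (.refl p) (τ b).symm_comp)
    rwa [Path.one_comp, Path.comp_one] at hcancel
  exact .trans _ _ _ (.symm _ _ (hunjoin p)) (.trans _ _ _ (Path.Equiv.comp (.refl _)
    (Path.Equiv.comp (Path.cls_eq_iff.1 h) (.refl _))) (hunjoin q))

theorem toLoop_comp {a b c : Γ.V} (p : A.Path a b) (q : A.Path b c) :
    toLoop τ (p.comp q) = toLoop τ p * toLoop τ q := by
  rw [toLoop, toLoop, toLoop, Path.cls_mul, Path.cls_eq_iff]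
  simp only [Path.comp_assoc]
  refine Path.Equiv.comp (.refl _) (Path.Equiv.comp (.refl _) ?_)
  have hcancel := Path.Equiv.comp (τ b).symm_comp (.refl (q.comp (τ c).symm))
  rw [Path.one_comp, Path.comp_assoc] at hcancel
  exact .symm _ _ hcancel

theorem toLoop_one {a : Γ.V} : toLoop τ (Path.single (1 : A.GV a)) = 1 := by
  rw [toLoop, Path.one_comp, Path.cls_one, Path.cls_eq_iff]
  exact Path.comp_symm _

/-- The image of a vertex group in the fundamental group. -/
def vertexHom (a : Γ.V) : A.GV a →* A.π₁ v₀ where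
  toFun g := toLoop τ (Path.single g)
  map_one' := toLoop_one τ
  map_mul' g h := toLoop_comp τ (Path.single g) (Path.single h)

/-- The element of the fundamental group given by an edge. -/
def edgeElt {a b : Γ.V} (e : Γ.E a b) : A.π₁ v₀ :=
  toLoop τ (Path.cons 1 e (Path.single 1))

theorem toLoop_single {a : Γ.V} (g : A.GV a) : toLoop τ (Path.single g) = vertexHom τ a g := rfl

theorem toLoop_cons {a b c : Γ.V} (g : A.GV a) (e : Γ.E a b) (p : A.Path b c) :
    toLoop τ (Path.cons g e p) = vertexHom τ a g * edgeElt τ e * toLoop τ p := by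
  rw [← toLoop_single, edgeElt, ← toLoop_comp, ← toLoop_comp]
  simp only [Path.comp, Path.one_comp, mul_one]

theorem pathVal_vertexHom_edgeElt {a b : Γ.V} (p : A.Path a b) :
    pathVal (vertexHom τ) (edgeElt τ) p = toLoop τ p := by
  induction p with
  | single g => rfl
  | cons g e p ih => rw [toLoop_cons, pathVal, ih]

theorem edgeElt_mul_mul_edgeElt_inv {a b : Γ.V} (e : Γ.E a b) (c : A.GE e) :
    edgeElt τ e * vertexHom τ b (A.ω e c) * edgeElt τ (Γ.inv e) = vertexHom τ a (A.α e c) := by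
  rw [edgeElt, edgeElt, ← toLoop_single, ← toLoop_comp, ← toLoop_comp, ← toLoop_single]
  have hred := Path.Red.head (1 : A.GV a) e c (Path.single 1)
  simp only [Path.comp, one_mul, mul_one] at hred ⊢
  exact toLoop_congr (.rel _ _ hred)

theorem edgeElt_inv {a b : Γ.V} (e : Γ.E a b) : edgeElt τ (Γ.inv e) = (edgeElt τ e)⁻¹ := by
  have h := edgeElt_mul_mul_edgeElt_inv τ e 1
  simp only [map_one, mul_one] at h
  exact eq_inv_of_mul_eq_one_right h

theorem edgeElt_mul_vertexHom {a b : Γ.V} (e : Γ.E a b) (c : A.GE e) :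
    edgeElt τ e * vertexHom τ b (A.ω e c) = vertexHom τ a (A.α e c) * edgeElt τ e := by
  rw [← mul_inv_eq_iff_eq_mul, ← edgeElt_inv, edgeElt_mul_mul_edgeElt_inv]

variable (hτ : τ v₀ = Path.single 1)
include hτ

theorem toLoop_tree (a : Γ.V) : toLoop τ (τ a) = 1 := by
  rw [toLoop, hτ, Path.one_comp, Path.cls_one, Path.cls_eq_iff]
  exact Path.comp_symm _

theorem cast_cls {a b : Γ.V} (ha : a = v₀) (hb : b = v₀) (p : A.Path a b) :
    PathClass.cast ha hb p.cls = toLoop τ p := by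
  subst ha hb
  rw [toLoop, hτ, Path.one_comp]
  simp only [Path.symm, inv_one, Path.comp_one]
  rfl

theorem cls_eq_toLoop (p : A.Path v₀ v₀) : (p.cls : A.π₁ v₀) = toLoop τ p :=
  cast_cls τ hτ rfl rfl p

end Loop

theorem π₁Lift_toLoop {v₀ : Γ.V} {τ : ∀ a, A.Path v₀ a} {Q : Type*} [Group Q]
    {φ : ∀ a, A.GV a →* Q} {t : ∀ {a b : Γ.V}, Γ.E a b → Q}
    (ht : ∀ {a b : Γ.V} (e : Γ.E a b) (c : A.GE e),
      t e * φ b (A.ω e c) * t (Γ.inv e) = φ a (A.α e c))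
    (htree : ∀ a, pathVal φ t (τ a) = 1) {a b : Γ.V} (p : A.Path a b) :
    π₁Lift ht v₀ (toLoop τ p) = pathVal φ t p := by
  rw [toLoop, π₁Lift_cls, pathVal_comp, pathVal_comp, pathVal_symm ht, htree, htree, one_mul,
    inv_one, mul_one]

end GraphOfGroups

/-! ## A recursive presentation of the fundamental group -/

theorem exists_eval_wordSubst_eq {G H : Type*} [Group G] [Group H] {gens : List G}
    (hgens : Subgroup.closure {g | g ∈ gens} = ⊤) (f : H →* G) (gens' : List H) :
    ∃ T : List GWord, ∀ W,
      GWord.eval gens (wordSubst (fun i => T.getD i []) W) = f (GWord.eval gens' W) := by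
  choose word hword using GWord.exists_eval_eq hgens
  refine ⟨gens'.map fun h => word (f h), fun W => ?_⟩
  have hletter : ∀ i, wordVal (fun j => gens.getD j 1)
      ((gens'.map fun h => word (f h)).getD i []) = f (gens'.getD i 1) := fun i => by
    simp only [List.getD_eq_getElem?_getD, List.getElem?_map]
    cases gens'[i]? with
    | none => exact (wordVal_nil _).trans (map_one f).symm
    | some h => exact (GWord.eval_eq_wordVal gens _).symm.trans (hword (f h))
  simp only [GWord.eval_eq_wordVal, wordVal_wordSubst, hletter, map_wordVal]

namespace GraphOfGroups

variable {Γ : SerreGraph.{u}} {A : GraphOfGroups.{u, v, w} Γ}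

noncomputable section

namespace Marking

variable (M : A.Marking)

/-- Letters for the generators of the fundamental group: the edges, and the generators of the
vertex groups. The generators of the vertex with number `n` have the letters `(n, i)`; as in a
`GWord`, indices `i` beyond their list stand for `1`. -/
abbrev Letter : Type := Fin M.nE ⊕ Fin M.nV × ℕ

/-- Words in the generators of the fundamental group. -/
abbrev Word : Type := List (M.Letter × Bool)

/-- The word in the generators of the fundamental group for a word in the generators of the vertex
group with number `n`. -/
def vertexWord (n : Fin M.nV) (W : GWord) : M.Word := W.map fun l => (Sum.inr (n, l.1), l.2)

/-- The word for the edge with number `k`, followed by a word for an element of the vertex group at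
its terminus. -/
def edgeWord (k : Fin M.nE) (W : GWord) : M.Word :=
  (Sum.inl k, true) :: M.vertexWord (M.vNum (M.eNum.symm k).2.1) W

/-- The word for a path with origin `a`. Pairs of the code that do not begin with the number of an
edge are left out. -/
def pathWord (a : Γ.V) (P : PathCode) : M.Word :=
  M.vertexWord (M.vNum a) P.1 ++
    P.2.flatMap fun q => ((List.finRange M.nE)[q.1]?).elim [] fun k => M.edgeWord k q.2

theorem primrec_edgeWord : Primrec₂ M.edgeWord := by
  have hvertex : Primrec₂ M.vertexWord :=
    Primrec.list_map Primrec.snd ((Primrec.sumInr.comp ((Primrec.fst.comp Primrec.fst).pair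
      (Primrec.fst.comp Primrec.snd))).pair (Primrec.snd.comp Primrec.snd)).to₂
  exact Primrec.list_cons.comp ((Primrec.sumInl.comp Primrec.fst).pair (Primrec.const true))
    (hvertex.comp ((Primrec.dom_finite fun k => M.vNum (M.eNum.symm k).2.1).comp Primrec.fst)
      Primrec.snd)

theorem primrec_pathWord (a : Γ.V) : Primrec (M.pathWord a) := by
  have hvertex : Primrec (M.vertexWord (M.vNum a)) :=
    Primrec.list_map Primrec.id (((Primrec.sumInr.comp ((Primrec.const _).pair
      (Primrec.fst.comp Primrec.snd)))).pair (Primrec.snd.comp Primrec.snd)).to₂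
  have hedge : Primrec₂ fun (_ : PathCode) (q : ℕ × GWord) =>
      ((List.finRange M.nE)[q.1]?).elim [] fun k => M.edgeWord k q.2 :=
    (Primrec.option_casesOn (Primrec.list_getElem?.comp (Primrec.const (List.finRange M.nE))
      (Primrec.fst.comp Primrec.snd)) (Primrec.const []) (M.primrec_edgeWord.comp Primrec.snd
        (Primrec.snd.comp (Primrec.snd.comp Primrec.fst))).to₂).of_eq fun q => by
      dsimp only
      cases (List.finRange M.nE)[q.2.1]? <;> rfl
  exact Primrec.list_append.comp (hvertex.comp Primrec.fst)
    (Primrec.list_flatMap Primrec.snd hedge)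

@[fun_prop]
theorem computable_pathWord {α : Type*} [Primcodable α] (a : Γ.V) {f : α → PathCode}
    (hf : Computable f) : Computable fun x => M.pathWord a (f x) :=
  (M.primrec_pathWord a).to_comp.comp hf

theorem exists_describes {a b : Γ.V} (p : A.Path a b) : ∃ P, M.Describes P p := by
  induction p with
  | single g =>
    obtain ⟨W, rfl⟩ := GWord.exists_eval_eq (M.vGens_closure _) g
    exact ⟨_, .single W⟩
  | cons g e p ih =>
    obtain ⟨W, rfl⟩ := GWord.exists_eval_eq (M.vGens_closure _) g
    obtain ⟨⟨W', l⟩, hp⟩ := ih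
    exact ⟨_, .cons W W' e l p hp⟩

theorem pathWord_cons {a b : Γ.V} (e : Γ.E a b) (W W' : GWord) (l : List (ℕ × GWord)) :
    M.pathWord a (W, ((M.eNum ⟨a, b, e⟩ : ℕ), W') :: l) =
      M.vertexWord (M.vNum a) W ++ (Sum.inl (M.eNum ⟨a, b, e⟩), true) ::
        M.pathWord b (W', l) := by
  have hterminus : M.vNum (M.eNum.symm (M.eNum ⟨a, b, e⟩)).2.1 = M.vNum b :=
    congrArg (fun x : Γ.Edge => M.vNum x.2.1) (M.eNum.symm_apply_apply ⟨a, b, e⟩)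
  simp [pathWord, edgeWord, hterminus]

section LetterVal

variable {Q : Type*} [Group Q] (φ : ∀ a, A.GV a →* Q) (t : ∀ {a b : Γ.V}, Γ.E a b → Q)

/-- The values of the letters, for given homomorphisms `φ` from the vertex groups and values `t`
of the edges. -/
def letterVal : M.Letter → Q :=
  Sum.elim (fun k => t (M.eNum.symm k).2.2) fun x =>
    φ (M.vNum.symm x.1) ((M.vGens (M.vNum.symm x.1)).getD x.2 1)

variable {M}

theorem letterVal_edge {a b : Γ.V} (e : Γ.E a b) :
    M.letterVal φ t (Sum.inl (M.eNum ⟨a, b, e⟩)) = t e :=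
  congrArg (fun x : Γ.Edge => t x.2.2) (M.eNum.symm_apply_apply ⟨a, b, e⟩)

theorem wordVal_vertexWord (a : Γ.V) (W : GWord) :
    wordVal (M.letterVal φ t) (M.vertexWord (M.vNum a) W) = φ a (GWord.eval (M.vGens a) W) := by
  have hletter : ∀ i, M.letterVal φ t (Sum.inr (M.vNum a, i)) = φ a ((M.vGens a).getD i 1) :=
    fun i => congrArg (fun b => φ b ((M.vGens b).getD i 1)) (M.vNum.symm_apply_apply a)
  rw [GWord.eval_eq_wordVal, map_wordVal, vertexWord, wordVal_map fun i => Sum.inr (M.vNum a, i)]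
  simp only [hletter]

theorem Describes.wordVal_pathWord {a b : Γ.V} {P : PathCode} {p : A.Path a b}
    (h : M.Describes P p) : wordVal (M.letterVal φ t) (M.pathWord a P) = pathVal φ t p := by
  induction h with
  | single W =>
    simp only [pathWord, List.flatMap_nil, List.append_nil, wordVal_vertexWord, pathVal]
  | cons W W' e l p _ ih =>
    rw [pathWord_cons, wordVal_append, wordVal_cons, wordVal_vertexWord, ih, pathVal, mul_assoc,
      wordVal_letter, letterVal_edge]

theorem wordVal_pathWord_vertex (a : Γ.V) (W : GWord) :
    wordVal (M.letterVal φ t) (M.pathWord a (W, [])) = φ a (GWord.eval (M.vGens a) W) :=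
  (Describes.single W).wordVal_pathWord φ t

theorem wordVal_pathWord_edge {a b : Γ.V} (e : Γ.E a b) (W W' : GWord) :
    wordVal (M.letterVal φ t) (M.pathWord a (W, [((M.eNum ⟨a, b, e⟩ : ℕ), W')])) =
      φ a (GWord.eval (M.vGens a) W) * t e * φ b (GWord.eval (M.vGens b) W') :=
  (Describes.cons W W' e [] _ (.single W')).wordVal_pathWord φ t

end LetterVal

/-- The generators of the fundamental group that come from the paths `τ`. -/
def gen {v₀ : Γ.V} (τ : ∀ a, A.Path v₀ a) : M.Letter → A.π₁ v₀ :=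
  M.letterVal (vertexHom τ) (edgeElt τ)

section Presentation

variable {v₀ : Γ.V} (τ : ∀ a, A.Path v₀ a)

variable {M} in
theorem Describes.wordVal_gen {a b : Γ.V} {P : PathCode} {p : A.Path a b}
    (h : M.Describes P p) : wordVal (M.gen τ) (M.pathWord a P) = toLoop τ p := by
  rw [gen, h.wordVal_pathWord, pathVal_vertexHom_edgeElt]

/-- Words for the images under `α_e` of the generators of the edge group. -/
def αWords {a b : Γ.V} (e : Γ.E a b) : List GWord :=
  (exists_eval_wordSubst_eq (M.vGens_closure a) (A.α e) (M.eGens e)).choose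

/-- Words for the images under `ω_e` of the generators of the edge group. -/
def ωWords {a b : Γ.V} (e : Γ.E a b) : List GWord :=
  (exists_eval_wordSubst_eq (M.vGens_closure b) (A.ω e) (M.eGens e)).choose

theorem eval_αWords {a b : Γ.V} (e : Γ.E a b) (W : GWord) :
    GWord.eval (M.vGens a) (wordSubst (fun i => (M.αWords e).getD i []) W) =
      A.α e (GWord.eval (M.eGens e) W) :=
  (exists_eval_wordSubst_eq (M.vGens_closure a) (A.α e) (M.eGens e)).choose_spec W

theorem eval_ωWords {a b : Γ.V} (e : Γ.E a b) (W : GWord) :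
    GWord.eval (M.vGens b) (wordSubst (fun i => (M.ωWords e).getD i []) W) =
      A.ω e (GWord.eval (M.eGens e) W) :=
  (exists_eval_wordSubst_eq (M.vGens_closure b) (A.ω e) (M.eGens e)).choose_spec W

/-- The word `e ω_e(c) e⁻¹ α_e(c)⁻¹`, for a word `W` with value `c`. -/
def edgeRelator (e : Γ.Edge) (W : GWord) : M.Word :=
  M.pathWord e.1 ([], [((M.eNum e : ℕ), wordSubst (fun i => (M.ωWords e.2.2).getD i []) W),
    ((M.eNum ⟨_, _, Γ.inv e.2.2⟩ : ℕ),
      FreeGroup.invRev (wordSubst (fun i => (M.αWords e.2.2).getD i []) W))])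

/-- Defining relators of the fundamental group: the relations of the vertex groups, the relations
`e ω_e(c) e⁻¹ = α_e(c)`, and the triviality of the paths `τ`. -/
def relators : Set M.Word :=
  {R | (∃ (a : Γ.V) (W : GWord), GWord.eval (M.vGens a) W = 1 ∧ R = M.pathWord a (W, [])) ∨
    (∃ (e : Γ.Edge) (W : GWord), R = M.edgeRelator e W) ∨
    ∃ a, R = M.pathWord v₀ (M.exists_describes (τ a)).choose}

theorem wordVal_edgeRelator {Q : Type*} [Group Q] (φ : ∀ a, A.GV a →* Q)
    (t : ∀ {a b : Γ.V}, Γ.E a b → Q) (e : Γ.Edge) (W : GWord) :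
    wordVal (M.letterVal φ t) (M.edgeRelator e W) =
      t e.2.2 * φ _ (A.ω e.2.2 (GWord.eval (M.eGens e.2.2) W)) * t (Γ.inv e.2.2) *
        (φ _ (A.α e.2.2 (GWord.eval (M.eGens e.2.2) W)))⁻¹ := by
  obtain ⟨a, b, e⟩ := e
  rw [edgeRelator, (Describes.cons [] _ e _ _
    (.cons _ _ (Γ.inv e) _ _ (.single _))).wordVal_pathWord]
  simp only [pathVal, eval_ωWords]
  rw [GWord.eval_eq_wordVal (M.vGens a) (FreeGroup.invRev _), wordVal_invRev,
    ← GWord.eval_eq_wordVal, eval_αWords, map_inv]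
  simp only [GWord.eval, List.map_nil, List.prod_nil, map_one, one_mul, mul_assoc]

theorem exists_letterVal_eq {Q : Type*} [Group Q] {val : M.Letter → Q}
    (hval : ∀ (a : Γ.V) (W : GWord), GWord.eval (M.vGens a) W = 1 →
      wordVal val (M.pathWord a (W, [])) = 1) :
    ∃ (φ : ∀ a, A.GV a →* Q) (t : ∀ {a b : Γ.V}, Γ.E a b → Q), M.letterVal φ t = val := by
  have hlift : ∀ a, ∃ φ : A.GV a →* Q,
      ∀ i, φ ((M.vGens a).getD i 1) = val (Sum.inr (M.vNum a, i)) := fun a => by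
    have hsurj : Function.Surjective (FreeGroup.lift fun i => (M.vGens a).getD i 1) := fun g => by
      obtain ⟨W, rfl⟩ := GWord.exists_eval_eq (M.vGens_closure a) g
      exact ⟨FreeGroup.mk W, (GWord.eval_eq_wordVal _ W).symm⟩
    have hker : (FreeGroup.lift fun i => (M.vGens a).getD i 1).ker ≤
        (FreeGroup.lift fun i => val (Sum.inr (M.vNum a, i))).ker := fun x hx => by
      obtain ⟨W, rfl⟩ := Quot.mk_surjective x
      have hrel := hval a W ((GWord.eval_eq_wordVal _ W).trans hx)
      rwa [pathWord, List.flatMap_nil, List.append_nil, vertexWord,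
        wordVal_map fun i => Sum.inr (M.vNum a, i)] at hrel
    refine ⟨MonoidHom.liftOfSurjective _ hsurj ⟨_, hker⟩, fun i => ?_⟩
    have hof := MonoidHom.liftOfRightInverse_comp_apply _ _
      (Function.rightInverse_surjInv hsurj) ⟨_, hker⟩ (FreeGroup.of i)
    rwa [FreeGroup.lift_apply_of, FreeGroup.lift_apply_of] at hof
  choose φ hφ using hlift
  refine ⟨φ, fun {a b} e => val (Sum.inl (M.eNum ⟨a, b, e⟩)), funext fun l => ?_⟩
  rcases l with k | ⟨n, i⟩
  · exact congrArg (fun k => val (Sum.inl k)) (M.eNum.apply_symm_apply k)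
  · exact (hφ _ i).trans (congrArg (fun n => val (Sum.inr (n, i))) (M.vNum.apply_symm_apply n))

theorem exists_hom_wordVal_gen {Q : Type*} [Group Q] {val : M.Letter → Q}
    (hval : ∀ R ∈ M.relators τ, wordVal val R = 1) :
    ∃ Ψ : A.π₁ v₀ →* Q, ∀ W, Ψ (wordVal (M.gen τ) W) = wordVal val W := by
  obtain ⟨φ, t, rfl⟩ := M.exists_letterVal_eq fun a W hW => hval _ (.inl ⟨a, W, hW, rfl⟩)
  have ht : ∀ {a b : Γ.V} (e : Γ.E a b) (c : A.GE e),
      t e * φ b (A.ω e c) * t (Γ.inv e) = φ a (A.α e c) := fun {a b} e c => by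
    obtain ⟨W, rfl⟩ := GWord.exists_eval_eq (M.eGens_closure e) c
    have hrel := hval _ (.inr (.inl ⟨⟨a, b, e⟩, W, rfl⟩))
    rwa [wordVal_edgeRelator, mul_inv_eq_one] at hrel
  have htree : ∀ a, pathVal φ t (τ a) = 1 := fun a => by
    rw [← (M.exists_describes (τ a)).choose_spec.wordVal_pathWord]
    exact hval _ (.inr (.inr ⟨a, rfl⟩))
  refine ⟨π₁Lift ht v₀, fun W => ?_⟩
  rw [map_wordVal]
  refine congrArg (wordVal · W) (funext fun l => ?_)
  rcases l with k | ⟨n, i⟩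
  · refine (π₁Lift_toLoop ht htree _).trans ?_
    simp only [pathVal, map_one, one_mul, mul_one]
    rfl
  · exact π₁Lift_toLoop ht htree (Path.single _)

variable {τ}

theorem wordVal_gen_eq_one_of_mem_relators (hτ : τ v₀ = Path.single 1) {R : M.Word}
    (hR : R ∈ M.relators τ) : wordVal (M.gen τ) R = 1 := by
  rcases hR with ⟨a, W, hW, rfl⟩ | ⟨e, W, rfl⟩ | ⟨a, rfl⟩
  · rw [(Describes.single W).wordVal_gen, hW, toLoop_one]
  · rw [gen, wordVal_edgeRelator, edgeElt_mul_mul_edgeElt_inv, mul_inv_cancel]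
  · rw [(M.exists_describes (τ a)).choose_spec.wordVal_gen, toLoop_tree τ hτ]

theorem mk_mem_normalClosure_relators_iff (hτ : τ v₀ = Path.single 1) (W : M.Word) :
    FreeGroup.mk W ∈ Subgroup.normalClosure (FreeGroup.mk '' M.relators τ) ↔
      wordVal (M.gen τ) W = 1 := by
  constructor
  · suffices Subgroup.normalClosure (FreeGroup.mk '' M.relators τ) ≤
        (FreeGroup.lift (M.gen τ)).ker from fun hW => this hW
    refine Subgroup.normalClosure_le_normal ?_
    rintro _ ⟨R, hR, rfl⟩
    exact M.wordVal_gen_eq_one_of_mem_relators hτ hR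
  · intro hW
    set N := Subgroup.normalClosure (FreeGroup.mk '' M.relators τ)
    have hquot : ∀ V : M.Word,
        wordVal (fun l => QuotientGroup.mk' N (FreeGroup.of l)) V =
          QuotientGroup.mk' N (FreeGroup.mk V) := fun V => by
      rw [← map_wordVal, wordVal, FreeGroup.lift_of_eq_id, MonoidHom.id_apply]
    obtain ⟨Ψ, hΨ⟩ := M.exists_hom_wordVal_gen τ
      (val := fun l => QuotientGroup.mk' N (FreeGroup.of l)) fun R hR => by
        rw [hquot]
        exact (QuotientGroup.eq_one_iff _).2 (Subgroup.subset_normalClosure ⟨R, hR, rfl⟩)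
    have h := hΨ W
    rw [hW, map_one, hquot] at h
    exact (QuotientGroup.eq_one_iff _).1 h.symm

end Presentation

end Marking

end

end GraphOfGroups

/-! ## The consequences of benignness for recursive enumerability -/

theorem GWord.span_nil {G : Type*} [Group G] (gens : List G) : GWord.span gens [] = ⊥ := by
  simp [GWord.span]

theorem GWord.exists_span_eq {G : Type*} [Group G] {gens : List G}
    (hgens : Subgroup.closure {g | g ∈ gens} = ⊤) {K : Subgroup G} (hK : K.FG) :
    ∃ X : List GWord, GWord.span gens X = K := by
  obtain ⟨S, rfl⟩ := hK
  choose word hword using GWord.exists_eval_eq hgens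
  refine ⟨S.toList.map word, ?_⟩
  simp [GWord.span, hword]

theorem GWord.span_map_wordSubst {G H : Type*} [Group G] [Group H] {f : H →* G} {gens : List G}
    {gens' : List H} {T : List GWord}
    (hT : ∀ W, GWord.eval gens (wordSubst (fun i => T.getD i []) W) = f (GWord.eval gens' W))
    (X : List GWord) : GWord.span gens (X.map (wordSubst fun i => T.getD i [])) =
      (GWord.span gens' X).map f := by
  rw [GWord.span, GWord.span, MonoidHom.map_closure]
  congr 1
  ext g
  simp only [List.mem_map, Set.mem_ofPred_eq, Set.mem_image, exists_exists_and_eq_and, hT]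

/-- Words for the elements `u⁻¹ x u`, where `u` is the value of `U` and `x` runs through the values
of the words in `X`. -/
def conjWords (U : GWord) (X : List GWord) : List GWord :=
  X.map fun W => FreeGroup.invRev U ++ W ++ U

@[fun_prop]
theorem computable_conjWords {α : Type*} [Primcodable α] {f : α → GWord} {g : α → List GWord}
    (hf : Computable f) (hg : Computable g) : Computable fun a => conjWords (f a) (g a) := by
  have hconj : Primrec₂ fun (x : GWord × List GWord) (W : GWord) =>
      FreeGroup.invRev x.1 ++ W ++ x.1 :=
    Primrec.list_append.comp (Primrec.list_append.comp
      (primrec_invRev.comp (Primrec.fst.comp Primrec.fst)) Primrec.snd)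
        (Primrec.fst.comp Primrec.fst)
  exact (Primrec.list_map Primrec.snd hconj).to_comp.comp (hf.pair hg)

section Conjugation

variable {G H : Type*} [Group G] [Group H] (gens : List G)

theorem mem_span_conjWords (U : GWord) (X : List GWord) (g : G) :
    g ∈ GWord.span gens (conjWords U X) ↔
      GWord.eval gens U * g * (GWord.eval gens U)⁻¹ ∈ GWord.span gens X := by
  have hmap : GWord.span gens (conjWords U X) =
      (GWord.span gens X).map (MulAut.conj (GWord.eval gens U)⁻¹).toMonoidHom := by
    rw [GWord.span, GWord.span, MonoidHom.map_closure]
    congr 1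
    ext g
    simp [conjWords, GWord.eval_eq_wordVal, wordVal_append, wordVal_invRev, mul_assoc]
  rw [hmap, Subgroup.mem_map]
  constructor
  · rintro ⟨k, hk, rfl⟩
    simpa [mul_assoc] using hk
  · exact fun hg => ⟨_, hg, by simp [mul_assoc]⟩

theorem comap_conj_span (f : H →* G) (U : GWord) (X : List GWord) :
    (GWord.span gens X).comap ((MulAut.conj (GWord.eval gens U)).toMonoidHom.comp f) =
      (GWord.span gens (conjWords U X)).comap f := by
  ext c
  rw [Subgroup.mem_comap, Subgroup.mem_comap, mem_span_conjWords]
  rfl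

theorem GWord.eval_invRev (U : GWord) :
    GWord.eval gens (FreeGroup.invRev U) = (GWord.eval gens U)⁻¹ := by
  rw [GWord.eval_eq_wordVal, GWord.eval_eq_wordVal, wordVal_invRev]

theorem GWord.eval_append (U V : GWord) :
    GWord.eval gens (U ++ V) = GWord.eval gens U * GWord.eval gens V := by
  simp only [GWord.eval_eq_wordVal, wordVal_append]

variable {gens}

theorem rePred_comap_conj_span_eq {α : Type*} [Primcodable α]
    (hgens : Subgroup.closure {g | g ∈ gens} = ⊤)
    (hword : REPred fun W : GWord => wordVal (fun i => gens.getD i 1) W = 1)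
    {f : H →* G} (hf : Function.Injective f)
    (hinter : ∃ F : List GWord → List GWord, Computable F ∧
      ∀ X, GWord.span gens (F X) = GWord.span gens X ⊓ f.range)
    (gens' : List H) {X Z : α → List GWord} {U : α → GWord}
    (hX : Computable X) (hU : Computable U) (hZ : Computable Z) :
    REPred fun a => (GWord.span gens (X a)).comap
      ((MulAut.conj (GWord.eval gens (U a))).toMonoidHom.comp f) = GWord.span gens' (Z a) := by
  obtain ⟨F, hF, hspan⟩ := hinter
  obtain ⟨T, hT⟩ := exists_eval_wordSubst_eq hgens f gens'
  have hsubst : Computable fun a => (Z a).map (wordSubst (L' := ℕ) fun i => T.getD i []) :=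
    Computable.comp (f := fun K : List GWord => K.map (wordSubst fun i => T.getD i []))
      (Primrec.list_map Primrec.id ((primrec_wordSubst_getD.comp
        (Primrec.const T) Primrec.snd).to₂)).to_comp hZ
  refine (rePred_wordSpan_eq hword (X := fun a => F (conjWords (U a) (X a)))
    (by fun_prop) hsubst).of_eq fun a => ?_
  rw [← GWord.span_eq_wordSpan, ← GWord.span_eq_wordSpan, GWord.span_map_wordSubst hT, hspan,
    inf_comm, ← Subgroup.map_comap_eq, comap_conj_span, (Subgroup.map_injective hf).eq_iff]

end Conjugation

namespace GraphOfGroups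

variable {Γ : SerreGraph.{u}} {A : GraphOfGroups.{u, v, w} Γ} {M : A.Marking}

theorem α_inv_range {a b : Γ.V} (e : Γ.E a b) : (A.α (Γ.inv e)).range = (A.ω e).range := by
  obtain ⟨φ, hφ⟩ := A.inv_edge e
  ext g
  rw [MonoidHom.mem_range, MonoidHom.mem_range, φ.surjective.exists]
  simp only [(hφ _).1]

theorem Marking.finite_vertex (M : A.Marking) : Finite Γ.V := Finite.of_equiv _ M.vNum.symm

theorem Marking.finite_edge (M : A.Marking) : Finite Γ.Edge := Finite.of_equiv _ M.eNum.symm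

theorem Marking.computable_edgeRelator (M : A.Marking) (e : Γ.Edge) :
    Computable (M.edgeRelator e) :=
  M.computable_pathWord e.1 (by fun_prop)

namespace Benign

variable (hA : Benign M)

include hA

theorem exists_computable_coset_iff {a b : Γ.V} (e : Γ.E a b) :
    ∃ F : List GWord × GWord → Option GWord, Computable F ∧ ∀ X g,
      (F (X, g) = none ↔ ∀ c, GWord.eval (M.vGens a) g * A.α e c ∉ GWord.span (M.vGens a) X) ∧
      ∀ c, F (X, g) = some c →
        GWord.eval (M.vGens a) g * A.α e (GWord.eval (M.eGens e) c) ∈ GWord.span (M.vGens a) X := by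
  obtain ⟨F, hF, hcoset⟩ := hA.coset e
  refine ⟨F, hF, fun X g => ⟨⟨fun hnone c hc => ?_, fun hempty => ?_⟩, (hcoset X g).2⟩⟩
  · exact Set.eq_empty_iff_forall_notMem.1 ((hcoset X g).1 hnone) _ ⟨hc, _, ⟨c, rfl⟩, rfl⟩
  · exact Option.eq_none_iff_forall_ne_some.2 fun c hc => hempty _ ((hcoset X g).2 c hc)

theorem rePred_wordVal_eq_one {a b : Γ.V} (e : Γ.E a b) :
    REPred fun W : GWord => wordVal (fun i => (M.vGens a).getD i 1) W = 1 := by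
  obtain ⟨F, hF, hcoset⟩ := hA.exists_computable_coset_iff e
  obtain ⟨K, hK, hmem⟩ := hA.edge_membership e
  have hsearch : REPred fun W : GWord => ∃ c : GWord, F ([], W) = some c ∧ K ([], c) = true :=
    rePred_exists (p := fun (W : GWord) (c : GWord) => F ([], W) = some c ∧ K ([], c) = true)
      (rePred_and (rePred_eq (by fun_prop) (by fun_prop)) (rePred_of_computable (by fun_prop)))
  refine hsearch.of_eq fun W => ?_
  rw [← GWord.eval_eq_wordVal]
  have hiff : ∀ c, F ([], W) = some c → (K ([], c) = true ↔ GWord.eval (M.vGens a) W = 1) :=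
    fun c hc => by
      have hone := (hcoset [] W).2 c hc
      rw [GWord.span_nil, Subgroup.mem_bot, mul_eq_one_iff_eq_inv] at hone
      rw [hmem, GWord.span_nil, Subgroup.mem_bot, hone, inv_eq_one, ← map_one (A.α e),
        (A.α_injective e).eq_iff]
  refine ⟨fun ⟨c, hc, hKc⟩ => (hiff c hc).1 hKc, fun hW => ?_⟩
  rcases hc : F ([], W) with _ | c
  · refine absurd ?_ ((hcoset [] W).1.1 hc 1)
    rw [hW, map_one, mul_one]
    exact one_mem _
  · exact ⟨c, rfl, (hiff c hc).2 hW⟩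

theorem rePred_mem_relators (hedge : ∀ a : Γ.V, ∃ b, Nonempty (Γ.E a b)) {v₀ : Γ.V}
    (τ : ∀ a, A.Path v₀ a) : REPred (· ∈ M.relators τ) := by
  have := M.finite_vertex
  have := M.finite_edge
  have := M.computable_edgeRelator
  refine rePred_or (rePred_exists_fintype fun a => ?_) (rePred_or
    (rePred_exists_fintype fun e => rePred_exists (rePred_eq (by fun_prop) (by fun_prop)))
    (rePred_exists_fintype fun a => rePred_eq Computable.id (Computable.const _)))
  obtain ⟨b, ⟨e⟩⟩ := hedge a
  simp only [GWord.eval_eq_wordVal]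
  exact rePred_exists (p := fun (R : M.Word) (W : GWord) =>
    wordVal (fun i => (M.vGens a).getD i 1) W = 1 ∧ R = M.pathWord a (W, []))
    (rePred_and (rePred_comp (hA.rePred_wordVal_eq_one e) (by fun_prop))
      (rePred_eq (by fun_prop) (by fun_prop)))

theorem rePred_wordVal_gen_eq_one (hedge : ∀ a : Γ.V, ∃ b, Nonempty (Γ.E a b)) {v₀ : Γ.V}
    {τ : ∀ a, A.Path v₀ a} (hτ : τ v₀ = Path.single 1) :
    REPred fun W : M.Word => wordVal (M.gen τ) W = 1 :=
  (rePred_mem_normalClosure (hA.rePred_mem_relators hedge τ)).of_eq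
    (M.mk_mem_normalClosure_relators_iff hτ)

variable {α : Type*} [Primcodable α] {a b : Γ.V} (e : Γ.E a b)

theorem rePred_coset {X : α → List GWord} {U V : α → GWord} (hX : Computable X)
    (hU : Computable U) (hV : Computable V) :
    REPred fun x => ∀ k ∈ GWord.span (M.vGens a) (X x), ∀ c, GWord.eval (M.vGens a) (V x) ≠
      k * GWord.eval (M.vGens a) (U x) * A.α e c := by
  obtain ⟨F, hF, hcoset⟩ := hA.exists_computable_coset_iff e
  have hnone : REPred fun x =>
      F (conjWords (U x) (X x), FreeGroup.invRev (U x) ++ V x) = none :=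
    rePred_eq (by fun_prop) (by fun_prop)
  refine hnone.of_eq fun x => ?_
  rw [(hcoset _ _).1]
  simp only [mem_span_conjWords, GWord.eval_append, GWord.eval_invRev]
  constructor
  · intro hempty k hk c hV
    refine hempty c⁻¹ ?_
    rw [hV, map_inv]
    simpa [mul_assoc] using hk
  · intro hne c hc
    refine hne _ hc c⁻¹ ?_
    rw [map_inv]
    group

theorem rePred_comap_conj_eq {X Y : α → List GWord} {U V : α → GWord} (hX : Computable X)
    (hY : Computable Y) (hU : Computable U) (hV : Computable V) :
    REPred fun x => (GWord.span (M.vGens a) (X x)).comap ((MulAut.conj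
        (GWord.eval (M.vGens a) (U x))).toMonoidHom.comp (A.α e)) =
      (GWord.span (M.vGens b) (Y x)).comap ((MulAut.conj
        (GWord.eval (M.vGens b) (V x))⁻¹).toMonoidHom.comp (A.ω e)) := by
  have hinter := hA.intersection (Γ.inv e)
  rw [α_inv_range] at hinter
  simp only [← GWord.eval_invRev]
  have hα := rePred_comap_conj_span_eq (M.vGens_closure a) (hA.rePred_wordVal_eq_one e)
    (A.α_injective e) (hA.intersection e) (M.eGens e) (X := fun x : α × List GWord => X x.1)
    (U := fun x => U x.1) (Z := Prod.snd) (by fun_prop) (by fun_prop) (by fun_prop)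
  have hω := rePred_comap_conj_span_eq (M.vGens_closure b) (hA.rePred_wordVal_eq_one (Γ.inv e))
    (A.ω_injective e) hinter (M.eGens e) (X := fun x : α × List GWord => Y x.1)
    (U := fun x => FreeGroup.invRev (V x.1)) (Z := Prod.snd) (by fun_prop) (by fun_prop)
    (by fun_prop)
  -- The edge group is Noetherian, so the common value is generated by finitely many words.
  have hsearch : REPred fun x => ∃ Z,
      (GWord.span (M.vGens a) (X x)).comap ((MulAut.conj
        (GWord.eval (M.vGens a) (U x))).toMonoidHom.comp (A.α e)) = GWord.span (M.eGens e) Z ∧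
      (GWord.span (M.vGens b) (Y x)).comap ((MulAut.conj
        (GWord.eval (M.vGens b) (FreeGroup.invRev (V x)))).toMonoidHom.comp (A.ω e)) =
          GWord.span (M.eGens e) Z :=
    rePred_exists (p := fun x Z => _ = GWord.span _ Z ∧ _ = GWord.span _ Z) (rePred_and hα hω)
  refine hsearch.of_eq fun x => ?_
  constructor
  · rintro ⟨Z, hα, hω⟩
    exact hα.trans hω.symm
  · intro heq
    obtain ⟨Z, hZ⟩ := GWord.exists_span_eq (M.eGens_closure e) (hA.noetherian e _)
    exact ⟨Z, hZ.symm, heq.symm.trans hZ.symm⟩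

end Benign

end GraphOfGroups

/-! ## Loops represented by an `A`-graph -/

namespace AGraph

open GraphOfGroups

variable {Γ : SerreGraph.{u}} {A : GraphOfGroups.{u, v, w} Γ} {v₀ : Γ.V}

/-- The elements of the fundamental group represented by the paths from `a` to `b`. The paths need
not be reduced and `a`, `b` need not have type `v₀`. -/
def loops (τ : ∀ a, A.Path v₀ a) (𝔹 : AGraph A) (a b : 𝔹.B.V) : Set (A.π₁ v₀) :=
  {g | ∃ q : 𝔹.toGraphOfGroups.Path a b, toLoop τ (𝔹.μ q) = g}

/-- The element of the fundamental group represented by an edge. -/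
def edgeLoop (τ : ∀ a, A.Path v₀ a) (𝔹 : AGraph A) {a b : 𝔹.B.V} (f : 𝔹.B.E a b) : A.π₁ v₀ :=
  vertexHom τ _ (𝔹.lα f) * edgeElt τ (𝔹.etyp f) * vertexHom τ _ (𝔹.lω f)

/-- Labels of the vertices such that every path from `a` to `b` represents an element of
`(γ a)⁻¹ H γ b`, expressed for the paths of length 0 and the single edges. Such labels describe a
morphism from `𝔹` to the quotient of the Bass–Serre tree by `H`. -/
structure IsLabelling (τ : ∀ a, A.Path v₀ a) (𝔹 : AGraph A) (H : Subgroup (A.π₁ v₀))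
    (γ : 𝔹.B.V → A.π₁ v₀) : Prop where
  vertex : ∀ a, ∀ g ∈ 𝔹.grp a, γ a * vertexHom τ _ g * (γ a)⁻¹ ∈ H
  edge : ∀ {a b} (f : 𝔹.B.E a b), γ a * 𝔹.edgeLoop τ f * (γ b)⁻¹ ∈ H

variable {τ : ∀ a, A.Path v₀ a} {𝔹 : AGraph A}

theorem LAt_eq_loops (hτ : τ v₀ = Path.single 1) {a b : 𝔹.B.V} (ha : 𝔹.typ a = v₀)
    (hb : 𝔹.typ b = v₀) : 𝔹.LAt v₀ a b ha hb = 𝔹.loops τ a b := by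
  ext g
  constructor
  · rintro ⟨x, hx, rfl⟩
    obtain ⟨q, rfl⟩ := (𝔹.mem_L_iff x).1 hx
    exact ⟨q, (cast_cls τ hτ ha hb _).symm⟩
  · rintro ⟨q, rfl⟩
    exact ⟨_, (𝔹.mem_L_iff _).2 ⟨q, rfl⟩, cast_cls τ hτ ha hb _⟩

theorem one_mem_loops (a : 𝔹.B.V) : (1 : A.π₁ v₀) ∈ 𝔹.loops τ a a :=
  ⟨Path.single 1, toLoop_one τ⟩

theorem mul_mem_loops {a b c : 𝔹.B.V} {g h : A.π₁ v₀} (hg : g ∈ 𝔹.loops τ a b)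
    (hh : h ∈ 𝔹.loops τ b c) : g * h ∈ 𝔹.loops τ a c := by
  obtain ⟨q, rfl⟩ := hg
  obtain ⟨r, rfl⟩ := hh
  exact ⟨q.comp r, by rw [μ_comp, toLoop_comp]⟩

theorem inv_mem_loops {a b : 𝔹.B.V} {g : A.π₁ v₀} (hg : g ∈ 𝔹.loops τ a b) :
    g⁻¹ ∈ 𝔹.loops τ b a := by
  obtain ⟨q, rfl⟩ := hg
  refine ⟨q.symm, ?_⟩
  rw [eq_inv_iff_mul_eq_one, ← toLoop_comp, ← μ_comp,
    toLoop_congr (𝔹.μ_equiv (Path.symm_comp q))]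
  exact toLoop_one τ

theorem loops_swap (a b : 𝔹.B.V) : 𝔹.loops τ b a = (𝔹.loops τ a b)⁻¹ := by
  ext g
  exact ⟨inv_mem_loops, fun hg => inv_inv g ▸ inv_mem_loops hg⟩

theorem vertexHom_mem_loops {a : 𝔹.B.V} {g : A.GV (𝔹.typ a)} (hg : g ∈ 𝔹.grp a) :
    vertexHom τ _ g ∈ 𝔹.loops τ a a :=
  ⟨Path.single (⟨g, hg⟩ : 𝔹.grp a), rfl⟩

theorem edgeLoop_mem_loops {a b : 𝔹.B.V} (f : 𝔹.B.E a b) : 𝔹.edgeLoop τ f ∈ 𝔹.loops τ a b := by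
  refine ⟨Path.cons (1 : 𝔹.grp a) f (Path.single (1 : 𝔹.grp b)), ?_⟩
  simp only [μ, toLoop_cons, toLoop_comp, toLoop_single, edgeLoop]
  simp

theorem closure_subset_loops {a : 𝔹.B.V} {S : Set (A.π₁ v₀)} (hS : S ⊆ 𝔹.loops τ a a) :
    (Subgroup.closure S : Set (A.π₁ v₀)) ⊆ 𝔹.loops τ a a := fun g hg => by
  induction hg using Subgroup.closure_induction with
  | mem g hg => exact hS hg
  | one => exact one_mem_loops a
  | mul g h _ _ ihg ihh => exact mul_mem_loops ihg ihh
  | inv g _ ih => exact inv_mem_loops ih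

theorem IsFolded.eq_of_vertexHom_mem_loops (h𝔹 : 𝔹.IsFolded) {a b : 𝔹.B.V} (ha : 𝔹.typ a = v₀)
    (hb : 𝔹.typ b = v₀) {y : A.GV v₀} (hy : vertexHom τ v₀ y ∈ 𝔹.loops τ a b) : a = b := by
  obtain ⟨q, hq⟩ := hy
  have hlength : ∀ {a b : Γ.V}, a = v₀ → b = v₀ →
      ∃ r : A.Path a b, r.length = 0 ∧ toLoop τ r = vertexHom τ v₀ y := by
    rintro _ _ rfl rfl
    exact ⟨Path.single y, rfl, rfl⟩
  obtain ⟨r, hr, hry⟩ := hlength ha hb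
  exact h𝔹.eq_of_length_eq_zero q r hr (equiv_of_toLoop_eq (hq.trans hry.symm))

namespace IsLabelling

variable {H : Subgroup (A.π₁ v₀)} {γ : 𝔹.B.V → A.π₁ v₀}

theorem mem_of_mem_loops (hγ : 𝔹.IsLabelling τ H γ) {a b : 𝔹.B.V} {g : A.π₁ v₀}
    (hg : g ∈ 𝔹.loops τ a b) : γ a * g * (γ b)⁻¹ ∈ H := by
  obtain ⟨q, rfl⟩ := hg
  induction q with
  | single g => exact hγ.vertex _ _ g.2
  | @cons a b c g f q ih =>
    have hprod := H.mul_mem (H.mul_mem (hγ.vertex a g.1 g.2) (hγ.edge f)) ih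
    simp only [μ, toLoop_cons, toLoop_comp, toLoop_single, map_mul, edgeLoop] at hprod ⊢
    convert hprod using 1
    group

theorem loops_eq_smul (hγ : 𝔹.IsLabelling τ H γ) {a b : 𝔹.B.V} {x : A.π₁ v₀}
    (ha : γ a * x ∈ H) (hb : γ b ∈ H) (hx : x ∈ 𝔹.loops τ a b)
    (hH : (H : Set (A.π₁ v₀)) ⊆ 𝔹.loops τ b b) :
    𝔹.loops τ a b = x • (H : Set (A.π₁ v₀)) := by
  ext g
  rw [Set.mem_smul_set_iff_inv_smul_mem, smul_eq_mul, SetLike.mem_coe]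
  constructor
  · intro hg
    have hprod := H.mul_mem (H.inv_mem ha) (H.mul_mem (hγ.mem_of_mem_loops hg) hb)
    convert hprod using 1
    group
  · intro hg
    exact mul_inv_cancel_left x g ▸ mul_mem_loops hx (hH hg)

end IsLabelling

end AGraph

/-! ## Codes of `A`-graphs -/

namespace AGraphCode

variable (C : AGraphCode)

/-- The number of the type of a vertex. Out-of-range vertices have the junk type `0`. -/
def vTyp (i : ℕ) : ℕ := (C.1.getD i (0, [])).1

/-- The generating words of the group of a vertex. -/
def vGrp (i : ℕ) : List GWord := (C.1.getD i (0, [])).2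

/-- The description of an edge, with a junk value out of range. -/
def edge (k : ℕ) : EdgeCode := C.2.1.getD k ((0, 0, 0), 0, [], [])

/-- The origin of an edge. -/
def org (k : ℕ) : ℕ := (C.edge k).1.1

/-- The terminus of an edge. -/
def ter (k : ℕ) : ℕ := (C.edge k).1.2.1

/-- The inverse of an edge. -/
def inv (k : ℕ) : ℕ := (C.edge k).1.2.2

/-- The number of the type of an edge. -/
def eTyp (k : ℕ) : ℕ := (C.edge k).2.1

/-- The word for the label of an edge at its origin. -/
def wα (k : ℕ) : GWord := (C.edge k).2.2.1

/-- The word for the label of an edge at its terminus. -/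
def wω (k : ℕ) : GWord := (C.edge k).2.2.2

/-- The code of the path in `A` for an edge. -/
def edgePath (k : ℕ) : PathCode := (C.wα k, [(C.eTyp k, C.wω k)])

section Computable

variable {α : Type*} [Primcodable α] {f : α → AGraphCode} {g : α → ℕ}

@[fun_prop]
theorem computable_vTyp (hf : Computable f) (hg : Computable g) :
    Computable fun x => (f x).vTyp (g x) := by unfold vTyp; fun_prop

@[fun_prop]
theorem computable_vGrp (hf : Computable f) (hg : Computable g) :
    Computable fun x => (f x).vGrp (g x) := by unfold vGrp; fun_prop

@[fun_prop]
theorem computable_edge (hf : Computable f) (hg : Computable g) :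
    Computable fun x => (f x).edge (g x) := by unfold edge; fun_prop

@[fun_prop]
theorem computable_org (hf : Computable f) (hg : Computable g) :
    Computable fun x => (f x).org (g x) := by unfold org; fun_prop

@[fun_prop]
theorem computable_ter (hf : Computable f) (hg : Computable g) :
    Computable fun x => (f x).ter (g x) := by unfold ter; fun_prop

@[fun_prop]
theorem computable_inv (hf : Computable f) (hg : Computable g) :
    Computable fun x => (f x).inv (g x) := by unfold inv; fun_prop

@[fun_prop]
theorem computable_eTyp (hf : Computable f) (hg : Computable g) :
    Computable fun x => (f x).eTyp (g x) := by unfold eTyp; fun_prop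

@[fun_prop]
theorem computable_wα (hf : Computable f) (hg : Computable g) :
    Computable fun x => (f x).wα (g x) := by unfold wα; fun_prop

@[fun_prop]
theorem computable_wω (hf : Computable f) (hg : Computable g) :
    Computable fun x => (f x).wω (g x) := by unfold wω; fun_prop

@[fun_prop]
theorem computable_edgePath (hf : Computable f) (hg : Computable g) :
    Computable fun x => (f x).edgePath (g x) := by unfold edgePath; fun_prop

end Computable

/-- The conditions on edge number `k` for a code to describe a Serre graph with edge labels. The
words of inverse edges are required to be formally inverse, which is decidable. -/
structure EdgeWF (k : ℕ) : Prop where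
  org_lt : C.org k < C.1.length
  ter_lt : C.ter k < C.1.length
  inv_lt : C.inv k < C.2.1.length
  inv_ne : C.inv k ≠ k
  inv_inv : C.inv (C.inv k) = k
  org_inv : C.org (C.inv k) = C.ter k
  wα_inv : C.wα (C.inv k) = FreeGroup.invRev (C.wω k)

theorem rePred_edgeWF : REPred fun x : AGraphCode × ℕ => x.1.EdgeWF x.2 := by
  have hconj : REPred fun x : AGraphCode × ℕ =>
      x.1.org x.2 < x.1.1.length ∧ x.1.ter x.2 < x.1.1.length ∧ x.1.inv x.2 < x.1.2.1.length ∧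
      x.1.inv x.2 ≠ x.2 ∧ x.1.inv (x.1.inv x.2) = x.2 ∧ x.1.org (x.1.inv x.2) = x.1.ter x.2 ∧
      x.1.wα (x.1.inv x.2) = FreeGroup.invRev (x.1.wω x.2) :=
    rePred_and (rePred_lt (by fun_prop) (by fun_prop)) <|
    rePred_and (rePred_lt (by fun_prop) (by fun_prop)) <|
    rePred_and (rePred_lt (by fun_prop) (by fun_prop)) <|
    rePred_and (rePred_ne (by fun_prop) (by fun_prop)) <|
    rePred_and (rePred_eq (by fun_prop) (by fun_prop)) <|
    rePred_and (rePred_eq (by fun_prop) (by fun_prop)) (rePred_eq (by fun_prop) (by fun_prop))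
  exact hconj.of_eq fun _ =>
    ⟨fun ⟨horg, hter, hinv, hne, hinv_inv, horg_inv, hwα_inv⟩ =>
      ⟨horg, hter, hinv, hne, hinv_inv, horg_inv, hwα_inv⟩,
    fun h => ⟨h.org_lt, h.ter_lt, h.inv_lt, h.inv_ne, h.inv_inv, h.org_inv, h.wα_inv⟩⟩

variable {C} (hC : ∀ k < C.2.1.length, C.EdgeWF k)

/-- The Serre graph described by a code. -/
def toGraph : SerreGraph.{0} where
  V := Fin C.1.length
  E i j := {k : Fin C.2.1.length // C.org k = i ∧ C.ter k = j}
  inv {i j} f := ⟨⟨C.inv f.1, (hC _ f.1.2).inv_lt⟩, (hC _ f.1.2).org_inv.trans f.2.2, by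
    have horg := (hC _ (hC _ f.1.2).inv_lt).org_inv
    rw [(hC _ f.1.2).inv_inv] at horg
    exact horg.symm.trans f.2.1⟩
  inv_inv f := Subtype.ext (Fin.ext (hC _ f.1.2).inv_inv)
  inv_ne f hf := (hC _ f.1.2).inv_ne (congrArg (fun f => (f.1 : ℕ)) hf)

/-- The numbering of the edges of the Serre graph described by a code. -/
def toGraphEdgeEquiv : (toGraph hC).Edge ≃ Fin C.2.1.length where
  toFun f := f.2.2.1
  invFun k := ⟨⟨C.org k, (hC k k.2).org_lt⟩, ⟨C.ter k, (hC k k.2).ter_lt⟩, k, rfl, rfl⟩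
  left_inv := by
    rintro ⟨⟨i, hi⟩, ⟨j, hj⟩, k, horg, hter⟩
    dsimp only at horg hter
    subst horg hter
    rfl
  right_inv _ := rfl

end AGraphCode

namespace GraphOfGroups.Marking

open AGraph

variable {Γ : SerreGraph.{u}} {A : GraphOfGroups.{u, v, w} Γ} (M : A.Marking)

/-- Edge number `k` of a code has type `e`, in accordance with the types of its endpoints and of its
inverse. -/
structure HasEdgeType (C : AGraphCode) (k : ℕ) (e : Γ.Edge) : Prop where
  eTyp : C.eTyp k = M.eNum e
  eTyp_inv : C.eTyp (C.inv k) = M.eNum ⟨e.2.1, e.1, Γ.inv e.2.2⟩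
  vTyp_org : C.vTyp (C.org k) = M.vNum e.1
  vTyp_ter : C.vTyp (C.ter k) = M.vNum e.2.1

/-- The code describes an `A`-graph. -/
structure WellFormed (C : AGraphCode) : Prop where
  edgeWF : ∀ k < C.2.1.length, C.EdgeWF k
  vertex : ∀ i < C.1.length, ∃ a, C.vTyp i = M.vNum a
  edge : ∀ k < C.2.1.length, ∃ e, M.HasEdgeType C k e

theorem rePred_wellFormed : REPred fun C : AGraphCode => M.WellFormed C := by
  have := M.finite_vertex
  have := M.finite_edge
  have hvertex : REPred fun x : AGraphCode × ℕ => ∃ a, x.1.vTyp x.2 = M.vNum a :=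
    rePred_exists_fintype fun a => rePred_eq (by fun_prop) (by fun_prop)
  have hedge : REPred fun x : AGraphCode × ℕ => ∃ e, M.HasEdgeType x.1 x.2 e := by
    refine rePred_exists_fintype fun e => ?_
    have hconj : REPred fun x : AGraphCode × ℕ =>
        x.1.eTyp x.2 = M.eNum e ∧ x.1.eTyp (x.1.inv x.2) = M.eNum ⟨e.2.1, e.1, Γ.inv e.2.2⟩ ∧
        x.1.vTyp (x.1.org x.2) = M.vNum e.1 ∧ x.1.vTyp (x.1.ter x.2) = M.vNum e.2.1 :=
      rePred_and (rePred_eq (by fun_prop) (by fun_prop)) <|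
      rePred_and (rePred_eq (by fun_prop) (by fun_prop)) <|
      rePred_and (rePred_eq (by fun_prop) (by fun_prop)) (rePred_eq (by fun_prop) (by fun_prop))
    exact hconj.of_eq fun _ => ⟨fun ⟨htyp, hinv, horg, hter⟩ => ⟨htyp, hinv, horg, hter⟩,
      fun h => ⟨h.eTyp, h.eTyp_inv, h.vTyp_org, h.vTyp_ter⟩⟩
  exact (rePred_and (rePred_forall_lt (by fun_prop) AGraphCode.rePred_edgeWF)
    (rePred_and
      (rePred_forall_lt (p := fun C i => ∃ a, C.vTyp i = (M.vNum a : ℕ)) (by fun_prop) hvertex)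
      (rePred_forall_lt (p := fun C k => ∃ e, M.HasEdgeType C k e) (by fun_prop) hedge))).of_eq
    fun _ => ⟨fun ⟨hwf, hv, he⟩ => ⟨hwf, hv, he⟩, fun h => ⟨h.edgeWF, h.vertex, h.edge⟩⟩

/-- Numberings of the vertices and edges of `𝔹` by which the code describes `𝔹`. -/
structure Numbering (C : AGraphCode) (𝔹 : AGraph A) where
  nv : 𝔹.B.V ≃ Fin C.1.length
  ne : 𝔹.B.Edge ≃ Fin C.2.1.length
  vTyp : ∀ a, C.vTyp (nv a) = M.vNum (𝔹.typ a)
  grp : ∀ a, 𝔹.grp a = GWord.span (M.vGens (𝔹.typ a)) (C.vGrp (nv a))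
  org : ∀ {a b} (f : 𝔹.B.E a b), C.org (ne ⟨a, b, f⟩) = nv a
  ter : ∀ {a b} (f : 𝔹.B.E a b), C.ter (ne ⟨a, b, f⟩) = nv b
  inv : ∀ {a b} (f : 𝔹.B.E a b), C.inv (ne ⟨a, b, f⟩) = ne ⟨b, a, 𝔹.B.inv f⟩
  eTyp : ∀ {a b} (f : 𝔹.B.E a b), C.eTyp (ne ⟨a, b, f⟩) = M.eNum ⟨_, _, 𝔹.etyp f⟩
  eval_wα : ∀ {a b} (f : 𝔹.B.E a b),
    GWord.eval (M.vGens (𝔹.typ a)) (C.wα (ne ⟨a, b, f⟩)) = 𝔹.lα f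
  eval_wω : ∀ {a b} (f : 𝔹.B.E a b),
    GWord.eval (M.vGens (𝔹.typ b)) (C.wω (ne ⟨a, b, f⟩)) = 𝔹.lω f

variable {M} {C : AGraphCode}

theorem Numbering.describesAGraph {𝔹 : AGraph A} (N : M.Numbering C 𝔹) {ux u0 : 𝔹.B.V}
    (hux : C.2.2.1 = N.nv ux) (hu0 : C.2.2.2 = N.nv u0) : M.DescribesAGraph C 𝔹 ux u0 := by
  have hvertex : ∀ i : Fin C.1.length, C.1.get i = (C.vTyp i, C.vGrp i) := fun i => by
    simp [AGraphCode.vTyp, AGraphCode.vGrp]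
  have hedge : ∀ k : Fin C.2.1.length, C.2.1.get k = C.edge k := fun k => by
    simp [AGraphCode.edge]
  refine ⟨N.nv, N.ne, fun a => ?_, fun a b f => ?_, Prod.ext hux hu0⟩
  · rw [hvertex]
    exact ⟨N.vTyp a, N.grp a⟩
  · rw [hedge]
    exact ⟨_, _, Prod.ext (Prod.ext (N.org f) (Prod.ext (N.ter f) (N.inv f)))
      (Prod.ext (N.eTyp f) rfl), N.eval_wα f, N.eval_wω f⟩

theorem WellFormed.exists_numbering (h : M.WellFormed C) :
    ∃ 𝔹 : AGraph A, Nonempty (M.Numbering C 𝔹) := by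
  choose typ htyp using fun i : Fin C.1.length => h.vertex i i.2
  have hedge : ∀ {i j} (f : (AGraphCode.toGraph h.edgeWF).E i j), ∃ e : Γ.E (typ i) (typ j),
      M.HasEdgeType C f.1 ⟨_, _, e⟩ := by
    rintro i j ⟨k, horg, hter⟩
    obtain ⟨⟨a, b, e⟩, he⟩ := h.edge k k.2
    obtain rfl : a = typ i :=
      M.vNum.injective (Fin.ext (he.vTyp_org.symm.trans (horg ▸ htyp i)))
    obtain rfl : b = typ j :=
      M.vNum.injective (Fin.ext (he.vTyp_ter.symm.trans (hter ▸ htyp j)))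
    exact ⟨e, he⟩
  choose etyp hetyp using @hedge
  refine ⟨{
    B := AGraphCode.toGraph h.edgeWF
    typ := typ
    etyp := etyp
    etyp_inv := fun f => ?_
    grp := fun i : Fin C.1.length => GWord.span (M.vGens (typ i)) (C.vGrp i)
    lα := fun {i _} f => GWord.eval (M.vGens (typ i)) (C.wα f.1)
    lω := fun {_ j} f => GWord.eval (M.vGens (typ j)) (C.wω f.1)
    lα_inv := fun {_ j} f => ?_ }, ⟨{
    nv := Equiv.refl _
    ne := AGraphCode.toGraphEdgeEquiv h.edgeWF
    vTyp := htyp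
    grp := fun _ => rfl
    org := fun f => f.2.1
    ter := fun f => f.2.2
    inv := fun _ => rfl
    eTyp := fun f => (hetyp f).eTyp
    eval_wα := fun _ => rfl
    eval_wω := fun _ => rfl }⟩⟩
  · have hnum := M.eNum.injective (Fin.ext
      ((hetyp ((AGraphCode.toGraph h.edgeWF).inv f)).eTyp.symm.trans (hetyp f).eTyp_inv))
    simpa using hnum
  · change GWord.eval (M.vGens (typ j)) (C.wα (C.inv f.1)) = _
    rw [(h.edgeWF _ f.1.2).wα_inv, GWord.eval_invRev]

end GraphOfGroups.Marking

/-! ## Certificates -/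

namespace AGraph

open GraphOfGroups

variable {Γ : SerreGraph.{u}} {A : GraphOfGroups.{u, v, w} Γ}

theorem isFolded_of_lα_ne {𝔹 : AGraph A} (hpre : ∀ {a b} (f : 𝔹.B.E a b), 𝔹.preα f = 𝔹.preω f)
    (hlα : ∀ {a b b' : 𝔹.B.V} (f : 𝔹.B.E a b) (f' : 𝔹.B.E a b'),
      (⟨a, b', f'⟩ : 𝔹.B.Edge) ≠ ⟨a, b, f⟩ →
      (⟨_, _, 𝔹.etyp f'⟩ : Γ.Edge) = ⟨_, _, 𝔹.etyp f⟩ →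
      ∀ k ∈ 𝔹.grp a, ∀ c, 𝔹.lα f' ≠ k * 𝔹.lα f * A.α (𝔹.etyp f) c) : 𝔹.IsFolded := by
  refine ⟨?_, fun ⟨a, b, f, hf⟩ => hf (hpre f)⟩
  rintro ⟨a, b, d, f, f', hne, htyp, k, hk, c, hc⟩
  have hne_inv : (⟨b, d, f'⟩ : 𝔹.B.Edge) ≠ ⟨b, a, 𝔹.B.inv f⟩ := fun h => by
    obtain ⟨-, h⟩ := Sigma.mk.inj h
    obtain ⟨hd, hf'⟩ := Sigma.mk.inj (eq_of_heq h)
    exact hne ((SerreGraph.edge_eq_inv_iff f f').2 ⟨hd, hf'⟩)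
  have htyp_inv : (⟨_, _, 𝔹.etyp f'⟩ : Γ.Edge) = ⟨_, _, 𝔹.etyp (𝔹.B.inv f)⟩ := by
    have hinv := congrArg (fun e : Γ.Edge => (⟨e.2.1, e.1, Γ.inv e.2.2⟩ : Γ.Edge)) htyp
    dsimp only at hinv
    rw [← 𝔹.etyp_inv, ← 𝔹.etyp_inv, 𝔹.B.inv_inv] at hinv
    exact hinv.symm
  obtain ⟨φ, hφ⟩ := A.inv_edge (𝔹.etyp f)
  have hα : ∃ c', A.α (𝔹.etyp (𝔹.B.inv f)) c' = A.ω (𝔹.etyp f) c := by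
    rw [𝔹.etyp_inv]
    exact ⟨φ c, (hφ c).1⟩
  obtain ⟨c', hc'⟩ := hα
  refine hlα (𝔹.B.inv f) f' hne_inv htyp_inv k⁻¹ (inv_mem hk) c' ?_
  rw [hc', ← hc, 𝔹.lα_inv]
  group

end AGraph

namespace GraphOfGroups

open AGraph

variable {Γ : SerreGraph.{u}} {A : GraphOfGroups.{u, v, w} Γ}

namespace Marking

variable (M : A.Marking)

/-- The conditions on edge number `k` of type `e` for a code to describe a folded `A`-graph: equal
preimages of the vertex groups at its endpoints, and distinct cosets for distinct edges of the same
type with the same origin. -/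
structure FoldedAt (C : AGraphCode) (k : ℕ) (e : Γ.Edge) : Prop where
  comap_eq : (GWord.span (M.vGens e.1) (C.vGrp (C.org k))).comap ((MulAut.conj
      (GWord.eval (M.vGens e.1) (C.wα k))).toMonoidHom.comp (A.α e.2.2)) =
    (GWord.span (M.vGens e.2.1) (C.vGrp (C.ter k))).comap ((MulAut.conj
      (GWord.eval (M.vGens e.2.1) (C.wω k))⁻¹).toMonoidHom.comp (A.ω e.2.2))
  coset_ne : ∀ l < C.2.1.length, l = k ∨ C.org l ≠ C.org k ∨ C.eTyp l ≠ C.eTyp k ∨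
    ∀ b ∈ GWord.span (M.vGens e.1) (C.vGrp (C.org k)), ∀ c,
      GWord.eval (M.vGens e.1) (C.wα l) ≠ b * GWord.eval (M.vGens e.1) (C.wα k) * A.α e.2.2 c

/-- The `A`-graph described by the code is folded. -/
def FoldedCode (C : AGraphCode) : Prop :=
  ∀ k < C.2.1.length, ∃ e, C.eTyp k = M.eNum e ∧ M.FoldedAt C k e

end Marking

open Marking

theorem Benign.rePred_foldedCode {M : A.Marking} (hA : Benign M) :
    REPred fun C : AGraphCode => M.FoldedCode C := by
  have := M.finite_edge
  refine rePred_forall_lt (p := fun C k => ∃ e : Γ.Edge, C.eTyp k = (M.eNum e : ℕ) ∧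
    M.FoldedAt C k e) (by fun_prop) (rePred_exists_fintype fun e => rePred_and
      (rePred_eq (f := fun x : AGraphCode × ℕ => x.1.eTyp x.2) (g := fun _ => (M.eNum e : ℕ))
        (by fun_prop) (by fun_prop)) ?_)
  have hcomap := hA.rePred_comap_conj_eq e.2.2
    (X := fun x : AGraphCode × ℕ => x.1.vGrp (x.1.org x.2))
    (Y := fun x : AGraphCode × ℕ => x.1.vGrp (x.1.ter x.2))
    (U := fun x : AGraphCode × ℕ => x.1.wα x.2) (V := fun x : AGraphCode × ℕ => x.1.wω x.2)
    (by fun_prop) (by fun_prop) (by fun_prop) (by fun_prop)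
  have hcoset := rePred_or
    (rePred_eq (f := fun y : (AGraphCode × ℕ) × ℕ => y.2) (g := fun y => y.1.2)
      (by fun_prop) (by fun_prop)) <| rePred_or
    (rePred_ne (f := fun y : (AGraphCode × ℕ) × ℕ => y.1.1.org y.2)
      (g := fun y => y.1.1.org y.1.2) (by fun_prop) (by fun_prop)) <| rePred_or
    (rePred_ne (f := fun y : (AGraphCode × ℕ) × ℕ => y.1.1.eTyp y.2)
      (g := fun y => y.1.1.eTyp y.1.2) (by fun_prop) (by fun_prop))
    (hA.rePred_coset e.2.2 (X := fun y : (AGraphCode × ℕ) × ℕ => y.1.1.vGrp (y.1.1.org y.1.2))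
      (U := fun y => y.1.1.wα y.1.2) (V := fun y => y.1.1.wα y.2)
      (by fun_prop) (by fun_prop) (by fun_prop))
  exact (rePred_and hcomap (rePred_forall_lt (p := fun (x : AGraphCode × ℕ) l =>
    l = x.2 ∨ x.1.org l ≠ x.1.org x.2 ∨ x.1.eTyp l ≠ x.1.eTyp x.2 ∨
    ∀ b ∈ GWord.span (M.vGens e.1) (x.1.vGrp (x.1.org x.2)), ∀ c,
      GWord.eval (M.vGens e.1) (x.1.wα l) ≠
        b * GWord.eval (M.vGens e.1) (x.1.wα x.2) * A.α e.2.2 c) (by fun_prop) hcoset)).of_eq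
    fun _ => ⟨fun ⟨hcomap, hcoset⟩ => ⟨hcomap, hcoset⟩, fun h => ⟨h.comap_eq, h.coset_ne⟩⟩

namespace Marking

variable {M : A.Marking} {C : AGraphCode} {𝔹 : AGraph A}

theorem Numbering.of_exists_edge (N : M.Numbering C 𝔹) {P : ℕ → Γ.Edge → Prop}
    (h : ∀ k < C.2.1.length, ∃ e, C.eTyp k = M.eNum e ∧ P k e) {a b : 𝔹.B.V} (f : 𝔹.B.E a b) :
    P (N.ne ⟨a, b, f⟩) ⟨_, _, 𝔹.etyp f⟩ := by
  obtain ⟨e, he, hP⟩ := h _ (N.ne ⟨a, b, f⟩).2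
  rwa [← M.eNum.injective (Fin.ext (he.symm.trans (N.eTyp f)))]

theorem Numbering.isFolded (N : M.Numbering C 𝔹) (h : M.FoldedCode C) : 𝔹.IsFolded := by
  refine isFolded_of_lα_ne (fun f => ?_) fun f f' hne htyp k hk c hc => ?_
  · have hcomap := (N.of_exists_edge h f).comap_eq
    dsimp only at hcomap
    rwa [N.org, N.ter, N.eval_wα, N.eval_wω, ← N.grp, ← N.grp] at hcomap
  · obtain heq | horg | htyp_ne | hcoset :=
      (N.of_exists_edge h f).coset_ne _ (N.ne ⟨_, _, f'⟩).2
    · exact hne (N.ne.injective (Fin.ext heq))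
    · exact horg ((N.org f').trans (N.org f).symm)
    · exact htyp_ne (by rw [N.eTyp, N.eTyp, htyp])
    · dsimp only at hcoset
      rw [N.org, N.eval_wα, N.eval_wα, ← N.grp] at hcoset
      exact hcoset k hk c hc

variable (M) {v₀ : Γ.V} (τ : ∀ a, A.Path v₀ a)

/-- The analogue for codes of `AGraph.IsLabelling`. -/
structure IsCodeLabelling (C : AGraphCode) (H : Subgroup (A.π₁ v₀)) (γ : ℕ → A.π₁ v₀) : Prop where
  vertex : ∀ i < C.1.length, ∃ a, C.vTyp i = M.vNum a ∧ ∀ U ∈ C.vGrp i,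
    γ i * wordVal (M.gen τ) (M.pathWord a (U, [])) * (γ i)⁻¹ ∈ H
  edge : ∀ k < C.2.1.length, ∃ a, C.vTyp (C.org k) = M.vNum a ∧
    γ (C.org k) * wordVal (M.gen τ) (M.pathWord a (C.edgePath k)) * (γ (C.ter k))⁻¹ ∈ H

variable {M τ}

theorem rePred_isCodeLabelling (hword : REPred fun W : M.Word => wordVal (M.gen τ) W = 1) :
    REPred fun x : List M.Word × AGraphCode × List M.Word => M.IsCodeLabelling τ x.2.1
      (wordSpan (M.gen τ) x.1) fun i => wordVal (M.gen τ) (x.2.2.getD i []) := by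
  have := M.finite_vertex
  have hvertex : REPred fun x : List M.Word × AGraphCode × List M.Word =>
      ∀ i < x.2.1.1.length, ∃ a, x.2.1.vTyp i = (M.vNum a : ℕ) ∧ ∀ U ∈ x.2.1.vGrp i,
        wordVal (M.gen τ) (x.2.2.getD i [] ++ M.pathWord a (U, []) ++
          FreeGroup.invRev (x.2.2.getD i [])) ∈ wordSpan (M.gen τ) x.1 :=
    rePred_forall_lt (by fun_prop) <| rePred_exists_fintype fun a =>
      rePred_and (rePred_eq (by fun_prop) (by fun_prop)) <|
      rePred_forall_mem_list (by fun_prop) <|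
      rePred_mem_wordSpan hword (by fun_prop) (by fun_prop)
  have hedge : REPred fun x : List M.Word × AGraphCode × List M.Word =>
      ∀ k < x.2.1.2.1.length, ∃ a, x.2.1.vTyp (x.2.1.org k) = (M.vNum a : ℕ) ∧
        wordVal (M.gen τ) (x.2.2.getD (x.2.1.org k) [] ++ M.pathWord a (x.2.1.edgePath k) ++
          FreeGroup.invRev (x.2.2.getD (x.2.1.ter k) [])) ∈ wordSpan (M.gen τ) x.1 :=
    rePred_forall_lt (by fun_prop) <| rePred_exists_fintype fun a =>
      rePred_and (rePred_eq (by fun_prop) (by fun_prop)) <|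
      rePred_mem_wordSpan hword (by fun_prop) (by fun_prop)
  simp only [wordVal_append, wordVal_invRev] at hvertex hedge
  exact (rePred_and hvertex hedge).of_eq
    fun _ => ⟨fun ⟨hvertex, hedge⟩ => ⟨hvertex, hedge⟩, fun h => ⟨h.vertex, h.edge⟩⟩

theorem Numbering.of_exists_vertex (N : M.Numbering C 𝔹) {a : 𝔹.B.V} {P : Γ.V → Prop}
    (h : ∃ a', C.vTyp (N.nv a) = M.vNum a' ∧ P a') : P (𝔹.typ a) := by
  obtain ⟨a', ha', hP⟩ := h
  rwa [← M.vNum.injective (Fin.ext (ha'.symm.trans (N.vTyp a)))]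

theorem Numbering.wordVal_edgePath (N : M.Numbering C 𝔹) {a b : 𝔹.B.V} (f : 𝔹.B.E a b) :
    wordVal (M.gen τ) (M.pathWord (𝔹.typ a) (C.edgePath (N.ne ⟨a, b, f⟩))) = 𝔹.edgeLoop τ f := by
  rw [AGraphCode.edgePath, N.eTyp, gen, wordVal_pathWord_edge, N.eval_wα, N.eval_wω, edgeLoop]

theorem Numbering.isLabelling (N : M.Numbering C 𝔹) {H : Subgroup (A.π₁ v₀)} {γ : ℕ → A.π₁ v₀}
    (h : M.IsCodeLabelling τ C H γ) : 𝔹.IsLabelling τ H fun a => γ (N.nv a) where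
  vertex a g hg := by
    have hle : 𝔹.grp a ≤
        H.comap ((MulAut.conj (γ (N.nv a))).toMonoidHom.comp (vertexHom τ (𝔹.typ a))) := by
      rw [N.grp, GWord.span_eq_wordSpan, wordSpan_le]
      intro U hU
      have hmem := N.of_exists_vertex (h.vertex _ (N.nv a).2) U hU
      rwa [gen, wordVal_pathWord_vertex, GWord.eval_eq_wordVal] at hmem
    exact hle hg
  edge {a b} f := by
    have hmem := h.edge _ (N.ne ⟨a, b, f⟩).2
    rw [N.org, N.ter] at hmem
    exact N.wordVal_edgePath (τ := τ) f ▸ N.of_exists_vertex hmem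

variable (M τ)

/-- A step in the `A`-graph described by a code, extending by one generator of a vertex group or one
edge a word for an element of the fundamental group. -/
def PathStep (C : AGraphCode) (s t : ℕ × M.Word) : Prop :=
  ∃ a, C.vTyp s.1 = M.vNum a ∧
    ((t.1 = s.1 ∧ ∃ U ∈ C.vGrp s.1,
        t.2 = s.2 ++ M.pathWord a (U, []) ∨ t.2 = s.2 ++ M.pathWord a (FreeGroup.invRev U, [])) ∨
      ∃ k < C.2.1.length, C.org k = s.1 ∧ C.ter k = t.1 ∧
        t.2 = s.2 ++ M.pathWord a (C.edgePath k))

/-- The code describes a path from `i` to `j` that represents `g`. -/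
def Reaches (C : AGraphCode) (i j : ℕ) (g : A.π₁ v₀) : Prop :=
  ∃ W : M.Word, wordVal (M.gen τ) W = g ∧ Relation.ReflTransGen (M.PathStep C) (i, []) (j, W)

theorem rePred_pathStep : REPred fun x : AGraphCode × (ℕ × M.Word) × (ℕ × M.Word) =>
    M.PathStep x.1 x.2.1 x.2.2 := by
  have := M.finite_vertex
  refine rePred_exists_fintype fun a => rePred_and (rePred_eq (by fun_prop) (by fun_prop)) <|
    rePred_or (rePred_and (rePred_eq (by fun_prop) (by fun_prop)) <|
      rePred_exists_mem_list (by fun_prop) <|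
      rePred_or (rePred_eq (by fun_prop) (by fun_prop)) (rePred_eq (by fun_prop) (by fun_prop)))
    (rePred_exists <| rePred_and (rePred_lt (by fun_prop) (by fun_prop)) <|
      rePred_and (rePred_eq (by fun_prop) (by fun_prop)) <|
      rePred_and (rePred_eq (by fun_prop) (by fun_prop)) <|
      rePred_eq (by fun_prop) (by fun_prop))

variable {M τ}

theorem rePred_reaches (hword : REPred fun W : M.Word => wordVal (M.gen τ) W = 1) {α : Type*}
    [Primcodable α] {C : α → AGraphCode} {i j : α → ℕ} {W : α → M.Word} (hC : Computable C)
    (hi : Computable i) (hj : Computable j) (hW : Computable W) :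
    REPred fun x => M.Reaches τ (C x) (i x) (j x) (wordVal (M.gen τ) (W x)) :=
  rePred_exists (rePred_and (rePred_wordVal_eq hword (by fun_prop) (by fun_prop))
    (rePred_comp (rePred_reflTransGen M.rePred_pathStep)
      (f := fun x : α × M.Word => (C x.1, (i x.1, ([] : M.Word)), (j x.1, x.2))) (by fun_prop)))

theorem Numbering.exists_of_pathStep (N : M.Numbering C 𝔹) {a : 𝔹.B.V} {V : M.Word}
    {t : ℕ × M.Word} (h : M.PathStep C (N.nv a, V) t) : ∃ b, t.1 = N.nv b ∧
      ∃ g ∈ 𝔹.loops τ a b, wordVal (M.gen τ) t.2 = wordVal (M.gen τ) V * g := by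
  obtain ⟨j, V'⟩ := t
  obtain ⟨hj, U, hU, hV'⟩ | ⟨k, hk, horg, hter, hV'⟩ := N.of_exists_vertex h
  · have heval : GWord.eval (M.vGens (𝔹.typ a)) U ∈ 𝔹.grp a := by
      rw [N.grp, GWord.eval_eq_wordVal, GWord.span_eq_wordSpan]
      exact wordVal_mem_wordSpan _ hU
    refine ⟨a, hj, ?_⟩
    obtain hV' | hV' := hV' <;> dsimp only at hV' ⊢ <;>
      rw [hV', wordVal_append, gen, wordVal_pathWord_vertex]
    · exact ⟨_, vertexHom_mem_loops heval, rfl⟩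
    · exact ⟨_, vertexHom_mem_loops (GWord.eval_invRev (M.vGens _) U ▸ inv_mem heval), rfl⟩
  · obtain ⟨⟨a', b, f⟩, hf⟩ := N.ne.surjective ⟨k, hk⟩
    obtain rfl : k = N.ne ⟨a', b, f⟩ := congrArg Fin.val hf.symm
    obtain rfl : a' = a := N.nv.injective (Fin.ext ((N.org f).symm.trans horg))
    refine ⟨b, hter.symm.trans (N.ter f), _, edgeLoop_mem_loops f, ?_⟩
    rw [hV', wordVal_append, N.wordVal_edgePath]

theorem Numbering.mem_loops_of_reaches (N : M.Numbering C 𝔹) {a b : 𝔹.B.V} {g : A.π₁ v₀}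
    (h : M.Reaches τ C (N.nv a) (N.nv b) g) : g ∈ 𝔹.loops τ a b := by
  obtain ⟨W, rfl, hW⟩ := h
  suffices ∀ s, Relation.ReflTransGen (M.PathStep C) (N.nv a, []) s →
      ∃ b, s.1 = N.nv b ∧ wordVal (M.gen τ) s.2 ∈ 𝔹.loops τ a b by
    obtain ⟨b', hb', hmem⟩ := this _ hW
    rwa [N.nv.injective (Fin.ext hb')]
  intro s hs
  induction hs with
  | refl => exact ⟨a, rfl, by rw [wordVal_nil]; exact one_mem_loops a⟩
  | @tail s t _ hst ih =>
    obtain ⟨i, V⟩ := s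
    obtain ⟨c, rfl, hmem⟩ := ih
    obtain ⟨d, hd, g, hg, hval⟩ := N.exists_of_pathStep (τ := τ) hst
    exact ⟨d, hd, hval ▸ mul_mem_loops hmem hg⟩

variable (M τ)

/-- The code, together with words `γ` for labels of its vertices, certifies that it describes a
folded `A`-graph for the left coset of `x` modulo the subgroup generated by `X`. -/
structure IsCert (X : List M.Word) (x : M.Word) (C : AGraphCode) (γ : List M.Word) : Prop where
  wellFormed : M.WellFormed C
  folded : M.FoldedCode C
  labelled : M.IsCodeLabelling τ C (wordSpan (M.gen τ) X) fun i => wordVal (M.gen τ) (γ.getD i [])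
  ux_lt : C.2.2.1 < C.1.length
  u0_lt : C.2.2.2 < C.1.length
  ux_ne_u0 : C.2.2.1 ≠ C.2.2.2
  vTyp_ux : C.vTyp C.2.2.1 = M.vNum v₀
  vTyp_u0 : C.vTyp C.2.2.2 = M.vNum v₀
  label_ux : wordVal (M.gen τ) (γ.getD C.2.2.1 [] ++ x) ∈ wordSpan (M.gen τ) X
  label_u0 : wordVal (M.gen τ) (γ.getD C.2.2.2 []) ∈ wordSpan (M.gen τ) X
  reaches_coset : M.Reaches τ C C.2.2.1 C.2.2.2 (wordVal (M.gen τ) x)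
  reaches_subgroup : ∀ W ∈ X, M.Reaches τ C C.2.2.2 C.2.2.2 (wordVal (M.gen τ) W)

end Marking

theorem Benign.rePred_isCert {M : A.Marking} (hA : Benign M) {v₀ : Γ.V}
    {τ : ∀ a, A.Path v₀ a} (hword : REPred fun W : M.Word => wordVal (M.gen τ) W = 1) :
    REPred fun x : (List M.Word × M.Word) × AGraphCode × List M.Word =>
      M.IsCert τ x.1.1 x.1.2 x.2.1 x.2.2 := by
  have hlabelled := rePred_comp (rePred_isCodeLabelling hword)
    (f := fun x : (List M.Word × M.Word) × AGraphCode × List M.Word => (x.1.1, x.2.1, x.2.2))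
    (by fun_prop)
  have hends : REPred fun x : (List M.Word × M.Word) × AGraphCode × List M.Word =>
      x.2.1.2.2.1 < x.2.1.1.length ∧ x.2.1.2.2.2 < x.2.1.1.length ∧
      x.2.1.2.2.1 ≠ x.2.1.2.2.2 ∧ x.2.1.vTyp x.2.1.2.2.1 = (M.vNum v₀ : ℕ) ∧
      x.2.1.vTyp x.2.1.2.2.2 = (M.vNum v₀ : ℕ) :=
    rePred_and (rePred_lt (by fun_prop) (by fun_prop)) <|
    rePred_and (rePred_lt (by fun_prop) (by fun_prop)) <|
    rePred_and (rePred_ne (by fun_prop) (by fun_prop)) <|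
    rePred_and (rePred_eq (by fun_prop) (by fun_prop)) (rePred_eq (by fun_prop) (by fun_prop))
  have hcoset : REPred fun x : (List M.Word × M.Word) × AGraphCode × List M.Word =>
      wordVal (M.gen τ) (x.2.2.getD x.2.1.2.2.1 [] ++ x.1.2) ∈ wordSpan (M.gen τ) x.1.1 ∧
      wordVal (M.gen τ) (x.2.2.getD x.2.1.2.2.2 []) ∈ wordSpan (M.gen τ) x.1.1 ∧
      M.Reaches τ x.2.1 x.2.1.2.2.1 x.2.1.2.2.2 (wordVal (M.gen τ) x.1.2) ∧
      ∀ W ∈ x.1.1, M.Reaches τ x.2.1 x.2.1.2.2.2 x.2.1.2.2.2 (wordVal (M.gen τ) W) :=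
    rePred_and (rePred_mem_wordSpan hword (by fun_prop) (by fun_prop)) <|
    rePred_and (rePred_mem_wordSpan hword (by fun_prop) (by fun_prop)) <|
    rePred_and (rePred_reaches hword (by fun_prop) (by fun_prop) (by fun_prop) (by fun_prop)) <|
    rePred_forall_mem_list (by fun_prop)
      (rePred_reaches hword (by fun_prop) (by fun_prop) (by fun_prop) (by fun_prop))
  exact (rePred_and (rePred_comp M.rePred_wellFormed (by fun_prop)) <|
    rePred_and (rePred_comp hA.rePred_foldedCode (by fun_prop)) <|
    rePred_and hlabelled (rePred_and hends hcoset)).of_eq fun _ =>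
      ⟨fun ⟨hwf, hfold, hlab, ⟨hlt_x, hlt_0, hne, htyp_x, htyp_0⟩, hx, h0, hreach, hsub⟩ =>
        ⟨hwf, hfold, hlab, hlt_x, hlt_0, hne, htyp_x, htyp_0, hx, h0, hreach, hsub⟩,
      fun h => ⟨h.wellFormed, h.folded, h.labelled,
        ⟨h.ux_lt, h.u0_lt, h.ux_ne_u0, h.vTyp_ux, h.vTyp_u0⟩,
        h.label_ux, h.label_u0, h.reaches_coset, h.reaches_subgroup⟩⟩

namespace Marking

variable {M : A.Marking} {v₀ : Γ.V} {τ : ∀ a, A.Path v₀ a} {C : AGraphCode}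

theorem IsCert.exists_aGraph {X : List M.Word} {x : M.Word} {γ : List M.Word}
    (h : M.IsCert τ X x C γ) : ∃ (𝔹 : AGraph A) (ux u0 : 𝔹.B.V),
      𝔹.typ ux = v₀ ∧ 𝔹.typ u0 = v₀ ∧ ux ≠ u0 ∧ M.DescribesAGraph C 𝔹 ux u0 ∧ 𝔹.IsFolded ∧
      𝔹.loops τ ux u0 = wordVal (M.gen τ) x • (wordSpan (M.gen τ) X : Set (A.π₁ v₀)) := by
  obtain ⟨𝔹, ⟨N⟩⟩ := h.wellFormed.exists_numbering
  obtain ⟨ux, hux⟩ := N.nv.surjective ⟨_, h.ux_lt⟩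
  obtain ⟨u0, hu0⟩ := N.nv.surjective ⟨_, h.u0_lt⟩
  obtain ⟨hux, hu0⟩ : C.2.2.1 = N.nv ux ∧ C.2.2.2 = N.nv u0 := by rw [hux, hu0]; exact ⟨rfl, rfl⟩
  obtain ⟨htyp_ux, htyp_u0⟩ := And.intro h.vTyp_ux h.vTyp_u0
  have hne := h.ux_ne_u0
  have hlabel_ux := h.label_ux
  have hlabel_u0 := h.label_u0
  have hreaches := h.reaches_coset
  have hreaches_subgroup := h.reaches_subgroup
  rw [hux] at htyp_ux hne hlabel_ux hreaches
  rw [hu0] at htyp_u0 hne hlabel_u0 hreaches hreaches_subgroup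
  rw [wordVal_append] at hlabel_ux
  refine ⟨𝔹, ux, u0, M.vNum.injective (Fin.ext ((N.vTyp ux).symm.trans htyp_ux)),
    M.vNum.injective (Fin.ext ((N.vTyp u0).symm.trans htyp_u0)), fun heq => hne (heq ▸ rfl),
    N.describesAGraph hux hu0, N.isFolded h.folded,
    (N.isLabelling h.labelled).loops_eq_smul hlabel_ux hlabel_u0
      (N.mem_loops_of_reaches hreaches) (closure_subset_loops ?_)⟩
  rintro _ ⟨W, hW, rfl⟩
  exact N.mem_loops_of_reaches (hreaches_subgroup W hW)

end Marking

end GraphOfGroups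

/-! ## Orbits on the Bass–Serre tree -/

namespace GraphOfGroups

theorem exists_equivariant_choice {E D : Type*} {J : E → E} (hJ : Function.Involutive J)
    {flip : D → D} (hflip : Function.Involutive flip) {pos : E → Prop}
    (hpos : ∀ ε, pos (J ε) ↔ ¬ pos ε) {P : E → D → Prop} (hP : ∀ ε, ∃ d, P ε d)
    (hPflip : ∀ ε d, P ε d → P (J ε) (flip d)) :
    ∃ F : E → D, (∀ ε, F (J ε) = flip (F ε)) ∧ ∀ ε, P ε (F ε) := by
  classical
  choose F hF using hP
  refine ⟨fun ε => if pos ε then F ε else flip (F (J ε)), fun ε => ?_, fun ε => ?_⟩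
  · by_cases hε : pos ε <;> simp [hε, hpos, hJ ε, hflip (F _)]
  · by_cases hε : pos ε
    · simpa only [hε, if_true] using hF ε
    · simpa only [hε, if_false, hJ ε] using hPflip _ _ (hF (J ε))

variable {Γ : SerreGraph.{u}} {A : GraphOfGroups.{u, v, w} Γ} {v₀ : Γ.V}

/-- The inverse edge, as an element of the type of all edges. -/
def edgeInv (e : Γ.Edge) : Γ.Edge := ⟨e.2.1, e.1, Γ.inv e.2.2⟩

theorem edgeInv_edgeInv (e : Γ.Edge) : edgeInv (edgeInv e) = e := by
  simp only [edgeInv, Γ.inv_inv]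

theorem edgeInv_ne (e : Γ.Edge) : edgeInv e ≠ e := by
  obtain ⟨a, b, e⟩ := e
  intro heq
  obtain rfl : b = a := congrArg Sigma.fst heq
  simp only [edgeInv, Sigma.mk.injEq, heq_eq_eq, true_and] at heq
  exact Γ.inv_ne e heq

variable (τ : ∀ a, A.Path v₀ a) (H : Subgroup (A.π₁ v₀))

/-- The orbits of `H` on the vertices of the Bass–Serre tree: those of type `a` are the double
cosets of `H` and the image of `A_a`. -/
abbrev VertexClass : Type (max u v) :=
  Σ a : Γ.V, DoubleCoset.Quotient (H : Set (A.π₁ v₀)) ((vertexHom τ a).range : Set (A.π₁ v₀))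

/-- The orbits of `H` on the edges of the Bass–Serre tree: those of type `e` are the double cosets
of `H` and the image of `A_e`. -/
abbrev EdgeClass : Type (max u v) :=
  Σ e : Γ.Edge, DoubleCoset.Quotient (H : Set (A.π₁ v₀))
    (((vertexHom τ e.1).comp (A.α e.2.2)).range : Set (A.π₁ v₀))

/-- The orbit of the vertex `g A_a` of the Bass–Serre tree. -/
def vMk (a : Γ.V) (g : A.π₁ v₀) : VertexClass τ H := ⟨a, DoubleCoset.mk _ _ g⟩

/-- The orbit of the edge `g A_e` of the Bass–Serre tree. -/
def eMk (e : Γ.Edge) (g : A.π₁ v₀) : EdgeClass τ H := ⟨e, DoubleCoset.mk _ _ g⟩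

variable {τ H}

theorem vMk_eq_iff {a : Γ.V} {g g' : A.π₁ v₀} :
    vMk τ H a g = vMk τ H a g' ↔ ∃ h ∈ H, ∃ k, g' = h * g * vertexHom τ a k := by
  rw [vMk, vMk, Sigma.mk.injEq, heq_eq_eq, DoubleCoset.eq]
  simp

theorem eMk_eq_iff {e : Γ.Edge} {g g' : A.π₁ v₀} :
    eMk τ H e g = eMk τ H e g' ↔
      ∃ h ∈ H, ∃ c, g' = h * g * vertexHom τ e.1 (A.α e.2.2 c) := by
  rw [eMk, eMk, Sigma.mk.injEq, heq_eq_eq, DoubleCoset.eq]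
  simp

theorem eMk_mul_left {e : Γ.Edge} {h g : A.π₁ v₀} (hh : h ∈ H) :
    eMk τ H e (h * g) = eMk τ H e g :=
  (eMk_eq_iff.2 ⟨h, hh, 1, by simp⟩).symm

theorem vMk_mul_right {a : Γ.V} {g : A.π₁ v₀} (k : A.GV a) :
    vMk τ H a (g * vertexHom τ a k) = vMk τ H a g :=
  (vMk_eq_iff.2 ⟨1, H.one_mem, k, by simp⟩).symm

theorem VertexClass.exists_rep (c : VertexClass τ H) : ∃ g, vMk τ H c.1 g = c := by
  obtain ⟨a, q⟩ := c
  exact ⟨q.out, congrArg (Sigma.mk a) (DoubleCoset.out_eq' _ _ q)⟩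

theorem EdgeClass.exists_rep (ε : EdgeClass τ H) : ∃ g, eMk τ H ε.1 g = ε := by
  obtain ⟨e, q⟩ := ε
  exact ⟨q.out, congrArg (Sigma.mk e) (DoubleCoset.out_eq' _ _ q)⟩

/-- The origin of an edge orbit. -/
noncomputable def EdgeClass.org (ε : EdgeClass τ H) : VertexClass τ H :=
  vMk τ H ε.1.1 ε.exists_rep.choose

/-- The inverse of an edge orbit. -/
noncomputable def EdgeClass.inv (ε : EdgeClass τ H) : EdgeClass τ H :=
  eMk τ H (edgeInv ε.1) (ε.exists_rep.choose * edgeElt τ ε.1.2.2)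

theorem org_eMk (e : Γ.Edge) (g : A.π₁ v₀) : (eMk τ H e g).org = vMk τ H e.1 g := by
  obtain ⟨h, hh, c, hg⟩ := eMk_eq_iff.1 (eMk τ H e g).exists_rep.choose_spec
  exact vMk_eq_iff.2 ⟨h, hh, _, hg⟩

theorem eMk_edgeInv_congr {e : Γ.Edge} {g g' : A.π₁ v₀} (h : eMk τ H e g = eMk τ H e g') :
    eMk τ H (edgeInv e) (g * edgeElt τ e.2.2) = eMk τ H (edgeInv e) (g' * edgeElt τ e.2.2) := by
  obtain ⟨k, hk, c, rfl⟩ := eMk_eq_iff.1 h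
  obtain ⟨φ, hφ⟩ := A.inv_edge e.2.2
  refine eMk_eq_iff.2 ⟨k, hk, φ c, ?_⟩
  change _ = k * _ * vertexHom τ e.2.1 (A.α (Γ.inv e.2.2) (φ c))
  rw [(hφ c).1]
  simp only [mul_assoc, edgeElt_mul_vertexHom]

theorem inv_eMk (e : Γ.Edge) (g : A.π₁ v₀) :
    (eMk τ H e g).inv = eMk τ H (edgeInv e) (g * edgeElt τ e.2.2) :=
  eMk_edgeInv_congr (eMk τ H e g).exists_rep.choose_spec

theorem org_inv_eMk (e : Γ.Edge) (g : A.π₁ v₀) :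
    (eMk τ H e g).inv.org = vMk τ H e.2.1 (g * edgeElt τ e.2.2) := by
  rw [inv_eMk, org_eMk, edgeInv]

theorem EdgeClass.inv_involutive : Function.Involutive (EdgeClass.inv : EdgeClass τ H → _) := by
  intro ε
  obtain ⟨g, hg⟩ := ε.exists_rep
  rw [← hg, inv_eMk, inv_eMk, edgeInv_edgeInv]
  have hinv : edgeElt τ (edgeInv ε.1).2.2 = (edgeElt τ ε.1.2.2)⁻¹ := edgeElt_inv τ _
  rw [hinv, mul_inv_cancel_right]

theorem EdgeClass.inv_ne (ε : EdgeClass τ H) : ε.inv ≠ ε :=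
  fun heq => edgeInv_ne _ (congrArg Sigma.fst heq)

theorem exists_vertex_reps {a : Γ.V} {g g' : A.π₁ v₀} (hne : vMk τ H a g ≠ vMk τ H a g') :
    ∃ γ : VertexClass τ H → A.π₁ v₀, (∀ c, vMk τ H c.1 (γ c) = c) ∧
      γ (vMk τ H a g) = g ∧ γ (vMk τ H a g') = g' := by
  classical
  choose rep hrep using VertexClass.exists_rep (τ := τ) (H := H)
  refine ⟨Function.update (Function.update rep (vMk τ H a g) g) (vMk τ H a g') g', fun c => ?_,
    by rw [Function.update_of_ne hne, Function.update_self], Function.update_self ..⟩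
  obtain rfl | hc' := eq_or_ne c (vMk τ H a g')
  · rw [Function.update_self]; rfl
  obtain rfl | hc := eq_or_ne c (vMk τ H a g)
  · rw [Function.update_of_ne hc', Function.update_self]; rfl
  · rw [Function.update_of_ne hc', Function.update_of_ne hc, hrep]

/-! ## Labels of edge orbits -/

variable (M : A.Marking)

/-- The words `d` represent elements `x` and `y` that can serve as the labels at the two ends of the
edge `ε` of the quotient of the Bass–Serre tree by `H`. If `γ` chooses representatives of the vertex
orbits, this means that `γ(o(ε)) x` represents `ε` and that `γ(o(ε)) x e y` represents the terminus
of `ε` modulo `H` exactly as `γ(t(ε))` does. -/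
structure IsLabel (γ : VertexClass τ H → A.π₁ v₀) (ε : EdgeClass τ H) (d : GWord × GWord) :
    Prop where
  mk_eq : eMk τ H ε.1 (γ ε.org * vertexHom τ ε.1.1 (GWord.eval (M.vGens ε.1.1) d.1)) = ε
  mem : γ ε.org * (vertexHom τ ε.1.1 (GWord.eval (M.vGens ε.1.1) d.1) * edgeElt τ ε.1.2.2 *
    vertexHom τ ε.1.2.1 (GWord.eval (M.vGens ε.1.2.1) d.2)) * (γ ε.inv.org)⁻¹ ∈ H

variable {M}

theorem exists_isLabel {γ : VertexClass τ H → A.π₁ v₀} (hγ : ∀ c, vMk τ H c.1 (γ c) = c)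
    (ε : EdgeClass τ H) : ∃ d, IsLabel M γ ε d := by
  obtain ⟨g, hg⟩ := ε.exists_rep
  have horg : ε.org = vMk τ H ε.1.1 g := by conv_lhs => rw [← hg, org_eMk]
  obtain ⟨h, hh, x, hx⟩ := vMk_eq_iff.1
    (show vMk τ H ε.1.1 (γ ε.org) = vMk τ H ε.1.1 g from (hγ ε.org).trans horg)
  have hmk : eMk τ H ε.1 (γ ε.org * vertexHom τ ε.1.1 x) = ε := by
    conv_rhs => rw [← hg, hx, mul_assoc, eMk_mul_left hh]
  have hter : ε.inv.org = vMk τ H ε.1.2.1 (γ ε.org * vertexHom τ ε.1.1 x * edgeElt τ ε.1.2.2) := by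
    conv_lhs => rw [← hmk, org_inv_eMk]
  obtain ⟨h', hh', y, hy⟩ := vMk_eq_iff.1 (hter.symm.trans (hγ ε.inv.org).symm)
  obtain ⟨U, rfl⟩ := GWord.exists_eval_eq (M.vGens_closure _) x
  obtain ⟨V, rfl⟩ := GWord.exists_eval_eq (M.vGens_closure _) y
  refine ⟨(U, V), hmk, ?_⟩
  dsimp only
  rw [hy]
  convert H.inv_mem hh' using 1
  group

theorem IsLabel.flip {γ : VertexClass τ H → A.π₁ v₀} {ε : EdgeClass τ H} {d : GWord × GWord}
    (hd : IsLabel M γ ε d) :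
    IsLabel M γ ε.inv (FreeGroup.invRev d.2, FreeGroup.invRev d.1) where
  mk_eq := by
    change eMk τ H (edgeInv ε.1) (γ ε.inv.org * vertexHom τ ε.1.2.1
      (GWord.eval (M.vGens ε.1.2.1) (FreeGroup.invRev d.2))) = ε.inv
    rw [GWord.eval_invRev, map_inv, ← eMk_mul_left hd.mem]
    conv_rhs => rw [← hd.mk_eq, inv_eMk]
    congr 1
    group
  mem := by
    change γ ε.inv.org * (vertexHom τ ε.1.2.1 (GWord.eval (M.vGens ε.1.2.1)
      (FreeGroup.invRev d.2)) * edgeElt τ (Γ.inv ε.1.2.2) * vertexHom τ ε.1.1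
        (GWord.eval (M.vGens ε.1.1) (FreeGroup.invRev d.1))) * (γ ε.inv.inv.org)⁻¹ ∈ H
    rw [GWord.eval_invRev, GWord.eval_invRev, map_inv, map_inv, edgeElt_inv,
      EdgeClass.inv_involutive ε]
    convert H.inv_mem hd.mem using 1
    group

theorem exists_labels {γ : VertexClass τ H → A.π₁ v₀} (hγ : ∀ c, vMk τ H c.1 (γ c) = c) :
    ∃ F : EdgeClass τ H → GWord × GWord,
      (∀ ε, F ε.inv = (FreeGroup.invRev (F ε).2, FreeGroup.invRev (F ε).1)) ∧
      ∀ ε, IsLabel M γ ε (F ε) := by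
  refine exists_equivariant_choice EdgeClass.inv_involutive
    (flip := fun d : GWord × GWord => (FreeGroup.invRev d.2, FreeGroup.invRev d.1))
    (fun d => by simp only [FreeGroup.invRev_invRev])
    (pos := fun ε => M.eNum ε.1 < M.eNum (edgeInv ε.1)) (fun ε => ?_) (exists_isLabel hγ)
    fun ε d hd => hd.flip
  change M.eNum (edgeInv ε.1) < M.eNum (edgeInv (edgeInv ε.1)) ↔ _
  rw [edgeInv_edgeInv, not_lt]
  exact ⟨le_of_lt, fun hle => hle.lt_of_ne fun heq => edgeInv_ne _ (M.eNum.injective heq)⟩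

/-! ## Properties of large families of generators -/

/-- `R` holds for all sufficiently large families, where some admissible family, one that satisfies
`S`, is already large enough. -/
def EventuallyIn {ι : Type*} [LE ι] (S R : ι → Prop) : Prop :=
  ∃ Y₀, S Y₀ ∧ ∀ Y, Y₀ ≤ Y → R Y

namespace EventuallyIn

theorem mono {ι : Type*} [LE ι] {S R R' : ι → Prop} (h : EventuallyIn S R)
    (hR : ∀ Y, R Y → R' Y) : EventuallyIn S R' := by
  obtain ⟨Y, hY, h⟩ := h
  exact ⟨Y, hY, fun Z hZ => hR Z (h Z hZ)⟩

variable {ι : Type*} [SemilatticeSup ι] {S : ι → Prop}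

theorem and (hS : ∀ Y Z, S Y → S Z → S (Y ⊔ Z)) {R R' : ι → Prop}
    (h : EventuallyIn S R) (h' : EventuallyIn S R') : EventuallyIn S fun Y => R Y ∧ R' Y := by
  obtain ⟨Y, hY, h⟩ := h
  obtain ⟨Z, hZ, h'⟩ := h'
  exact ⟨Y ⊔ Z, hS Y Z hY hZ, fun T hT =>
    ⟨h T (le_sup_left.trans hT), h' T (le_sup_right.trans hT)⟩⟩

theorem forall_mem (hS : ∀ Y Z, S Y → S Z → S (Y ⊔ Z)) {Y₀ : ι} (hY₀ : S Y₀)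
    {κ : Type*} {s : Set κ} (hs : s.Finite) {R : κ → ι → Prop}
    (h : ∀ x ∈ s, EventuallyIn S (R x)) : EventuallyIn S fun Y => ∀ x ∈ s, R x Y := by
  induction s, hs using Set.Finite.induction_on with
  | empty => exact ⟨Y₀, hY₀, fun _ _ _ => False.elim⟩
  | @insert x s _ _ ih =>
    simp only [Set.forall_mem_insert] at h ⊢
    exact h.1.and hS (ih h.2)

end EventuallyIn

end GraphOfGroups

/-! ## Finite parts of the quotient of the Bass–Serre tree -/

namespace GraphOfGroups

variable {Γ : SerreGraph.{u}} {A : GraphOfGroups.{u, v, w} Γ} {M : A.Marking} {v₀ : Γ.V}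
  {τ : ∀ a, A.Path v₀ a} {H : Subgroup (A.π₁ v₀)} {C : AGraphCode}

namespace Marking.Reaches

theorem trans {i j k : ℕ} {g g' : A.π₁ v₀} (h : M.Reaches τ C i j g)
    (h' : M.Reaches τ C j k g') : M.Reaches τ C i k (g * g') := by
  obtain ⟨W, rfl, hW⟩ := h
  obtain ⟨W', rfl, hW'⟩ := h'
  refine ⟨W ++ W', wordVal_append .., hW.trans ?_⟩
  have hshift := hW'.lift (fun s => (s.1, W ++ s.2)) (r := M.PathStep C) (p := M.PathStep C) ?_
  · simpa only [Function.onFun, List.append_nil] using hshift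
  rintro s t ⟨a, ha, ⟨ht, U, hU, hW⟩ | ⟨k, hk, horg, hter, hW⟩⟩
  · refine ⟨a, ha, .inl ⟨ht, U, hU, hW.imp ?_ ?_⟩⟩ <;> rintro hW <;>
      simp only [hW, List.append_assoc]
  · exact ⟨a, ha, .inr ⟨k, hk, horg, hter, by simp only [hW, List.append_assoc]⟩⟩

theorem vertex {a : Γ.V} {i : ℕ} {U : GWord} (ha : C.vTyp i = M.vNum a) (hU : U ∈ C.vGrp i) :
    M.Reaches τ C i i (vertexHom τ a (GWord.eval (M.vGens a) U)) :=
  ⟨M.pathWord a (U, []), wordVal_pathWord_vertex ..,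
    .single ⟨a, ha, .inl ⟨rfl, U, hU, .inl rfl⟩⟩⟩

theorem edge {e : Γ.Edge} {k : ℕ} (hk : k < C.2.1.length) (horg : C.vTyp (C.org k) = M.vNum e.1)
    (he : C.eTyp k = M.eNum e) :
    M.Reaches τ C (C.org k) (C.ter k) (vertexHom τ e.1 (GWord.eval (M.vGens e.1) (C.wα k)) *
      edgeElt τ e.2.2 * vertexHom τ e.2.1 (GWord.eval (M.vGens e.2.1) (C.wω k))) :=
  ⟨M.pathWord e.1 (C.edgePath k),
    by rw [AGraphCode.edgePath, he, gen, wordVal_pathWord_edge],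
    .single ⟨e.1, horg, .inr ⟨k, hk, rfl, rfl, rfl⟩⟩⟩

end Marking.Reaches

variable (M τ H) in
/-- A finite subgraph of the quotient of the Bass–Serre tree by `H` that contains the orbits of
`x⁻¹ A_{v₀}` and `A_{v₀}`, together with representatives `γ` of vertex orbits and labels of edge
orbits. -/
structure Skeleton (x : A.π₁ v₀) where
  γ : VertexClass τ H → A.π₁ v₀
  label : EdgeClass τ H → GWord × GWord
  label_inv : ∀ ε, label ε.inv = (FreeGroup.invRev (label ε).2, FreeGroup.invRev (label ε).1)
  isLabel : ∀ ε, IsLabel M γ ε (label ε)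
  verts : List (VertexClass τ H)
  edges : List (EdgeClass τ H)
  verts_nodup : verts.Nodup
  edges_nodup : edges.Nodup
  org_mem : ∀ ε ∈ edges, ε.org ∈ verts
  inv_mem : ∀ ε ∈ edges, ε.inv ∈ edges
  γ_coset : γ (vMk τ H v₀ x⁻¹) = x⁻¹
  γ_one : γ (vMk τ H v₀ 1) = 1
  coset_mem : vMk τ H v₀ x⁻¹ ∈ verts
  one_mem : vMk τ H v₀ 1 ∈ verts

theorem getD_map_idxOf {α β : Type*} [DecidableEq α] {l : List α} {a : α} (ha : a ∈ l)
    (f : α → β) (d : β) : (l.map f).getD (l.idxOf a) d = f a := by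
  rw [List.getD_eq_getElem?_getD, List.getElem?_map,
    List.getElem?_eq_getElem (List.idxOf_lt_length_iff.2 ha), List.getElem_idxOf]
  rfl

namespace Skeleton

variable {x : A.π₁ v₀} (S : Skeleton M τ H x)

open Classical in
/-- The number of a vertex orbit. -/
noncomputable def vIdx (c : VertexClass τ H) : ℕ := S.verts.idxOf c

open Classical in
/-- The number of an edge orbit. -/
noncomputable def eIdx (ε : EdgeClass τ H) : ℕ := S.edges.idxOf ε

/-- The code with vertex groups generated by `Y` and distinguished vertices the orbits of
`x⁻¹ A_{v₀}` and `A_{v₀}`. -/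
noncomputable def code (Y : VertexClass τ H → Finset GWord) : AGraphCode :=
  (S.verts.map fun c => ((M.vNum c.1 : ℕ), (Y c).toList),
    S.edges.map fun ε => ((S.vIdx ε.org, S.vIdx ε.inv.org, S.eIdx ε.inv), (M.eNum ε.1 : ℕ),
      S.label ε), S.vIdx (vMk τ H v₀ x⁻¹), S.vIdx (vMk τ H v₀ 1))

variable {S} {Y : VertexClass τ H → Finset GWord} {c : VertexClass τ H} {ε : EdgeClass τ H}

theorem vIdx_lt (hc : c ∈ S.verts) : S.vIdx c < (S.code Y).1.length := by
  classical
  rw [code, List.length_map]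
  exact List.idxOf_lt_length_iff.2 hc

theorem vTyp_vIdx (hc : c ∈ S.verts) : (S.code Y).vTyp (S.vIdx c) = M.vNum c.1 := by
  classical exact congrArg Prod.fst (getD_map_idxOf hc _ _)

theorem vGrp_vIdx (hc : c ∈ S.verts) : (S.code Y).vGrp (S.vIdx c) = (Y c).toList := by
  classical exact congrArg Prod.snd (getD_map_idxOf hc _ _)

theorem eIdx_lt (hε : ε ∈ S.edges) : S.eIdx ε < (S.code Y).2.1.length := by
  classical
  rw [code, List.length_map]
  exact List.idxOf_lt_length_iff.2 hε

theorem edge_eIdx (hε : ε ∈ S.edges) : (S.code Y).edge (S.eIdx ε) =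
    ((S.vIdx ε.org, S.vIdx ε.inv.org, S.eIdx ε.inv), (M.eNum ε.1 : ℕ), S.label ε) := by
  classical exact getD_map_idxOf hε _ _

theorem org_eIdx (hε : ε ∈ S.edges) : (S.code Y).org (S.eIdx ε) = S.vIdx ε.org := by
  rw [AGraphCode.org, edge_eIdx hε]

theorem ter_eIdx (hε : ε ∈ S.edges) : (S.code Y).ter (S.eIdx ε) = S.vIdx ε.inv.org := by
  rw [AGraphCode.ter, edge_eIdx hε]

theorem inv_eIdx (hε : ε ∈ S.edges) : (S.code Y).inv (S.eIdx ε) = S.eIdx ε.inv := by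
  rw [AGraphCode.inv, edge_eIdx hε]

theorem eTyp_eIdx (hε : ε ∈ S.edges) : (S.code Y).eTyp (S.eIdx ε) = M.eNum ε.1 := by
  rw [AGraphCode.eTyp, edge_eIdx hε]

theorem wα_eIdx (hε : ε ∈ S.edges) : (S.code Y).wα (S.eIdx ε) = (S.label ε).1 := by
  rw [AGraphCode.wα, edge_eIdx hε]

theorem wω_eIdx (hε : ε ∈ S.edges) : (S.code Y).wω (S.eIdx ε) = (S.label ε).2 := by
  rw [AGraphCode.wω, edge_eIdx hε]

theorem exists_vert {i : ℕ} (hi : i < (S.code Y).1.length) : ∃ c ∈ S.verts, S.vIdx c = i := by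
  classical
  rw [code, List.length_map] at hi
  exact ⟨S.verts[i], List.getElem_mem hi, S.verts_nodup.idxOf_getElem i hi⟩

theorem exists_edge {k : ℕ} (hk : k < (S.code Y).2.1.length) : ∃ ε ∈ S.edges, S.eIdx ε = k := by
  classical
  rw [code, List.length_map] at hk
  exact ⟨S.edges[k], List.getElem_mem hk, S.edges_nodup.idxOf_getElem k hk⟩

theorem vIdx_inj {c' : VertexClass τ H} (hc : c ∈ S.verts) : S.vIdx c = S.vIdx c' ↔ c = c' := by
  classical exact List.idxOf_inj hc

theorem eIdx_inj {ε' : EdgeClass τ H} (hε : ε ∈ S.edges) : S.eIdx ε = S.eIdx ε' ↔ ε = ε' := by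
  classical exact List.idxOf_inj hε

theorem inv_org_mem (hε : ε ∈ S.edges) : ε.inv.org ∈ S.verts :=
  S.org_mem _ (S.inv_mem _ hε)

theorem edgeWF_eIdx (hε : ε ∈ S.edges) : (S.code Y).EdgeWF (S.eIdx ε) where
  org_lt := org_eIdx hε ▸ vIdx_lt (S.org_mem _ hε)
  ter_lt := ter_eIdx hε ▸ vIdx_lt (inv_org_mem hε)
  inv_lt := inv_eIdx hε ▸ eIdx_lt (S.inv_mem _ hε)
  inv_ne := by
    rw [inv_eIdx hε, Ne, eIdx_inj (S.inv_mem _ hε)]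
    exact ε.inv_ne
  inv_inv := by rw [inv_eIdx hε, inv_eIdx (S.inv_mem _ hε), EdgeClass.inv_involutive ε]
  org_inv := by rw [inv_eIdx hε, org_eIdx (S.inv_mem _ hε), ter_eIdx hε]
  wα_inv := by rw [inv_eIdx hε, wα_eIdx (S.inv_mem _ hε), wω_eIdx hε, S.label_inv]

theorem hasEdgeType_eIdx (hε : ε ∈ S.edges) : M.HasEdgeType (S.code Y) (S.eIdx ε) ε.1 where
  eTyp := eTyp_eIdx hε
  eTyp_inv := by rw [inv_eIdx hε, eTyp_eIdx (S.inv_mem _ hε)]; rfl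
  vTyp_org := by rw [org_eIdx hε, vTyp_vIdx (S.org_mem _ hε)]; rfl
  vTyp_ter := by rw [ter_eIdx hε, vTyp_vIdx (inv_org_mem hε)]; rfl

theorem wellFormed_code : M.WellFormed (S.code Y) where
  edgeWF k hk := by
    obtain ⟨ε, hε, rfl⟩ := exists_edge hk
    exact edgeWF_eIdx hε
  vertex i hi := by
    obtain ⟨c, hc, rfl⟩ := exists_vert hi
    exact ⟨c.1, vTyp_vIdx hc⟩
  edge k hk := by
    obtain ⟨ε, hε, rfl⟩ := exists_edge hk
    exact ⟨ε.1, hasEdgeType_eIdx hε⟩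

end Skeleton

end GraphOfGroups

/-! ## Existence of certificates -/

namespace GraphOfGroups

variable {Γ : SerreGraph.{u}} {A : GraphOfGroups.{u, v, w} Γ} {M : A.Marking} {v₀ : Γ.V}
  {τ : ∀ a, A.Path v₀ a} {H : Subgroup (A.π₁ v₀)}

variable (τ H) in
/-- The elements of `A_a` whose conjugates by `d` lie in `H`; these conjugates form the stabilizer
in `H` of the vertex `d A_a` of the Bass–Serre tree. -/
def vertexStabilizer (a : Γ.V) (d : A.π₁ v₀) : Subgroup (A.GV a) :=
  H.comap ((MulAut.conj d).toMonoidHom.comp (vertexHom τ a))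

theorem mem_vertexStabilizer {a : Γ.V} {d : A.π₁ v₀} {g : A.GV a} :
    g ∈ vertexStabilizer τ H a d ↔ d * vertexHom τ a g * d⁻¹ ∈ H := Iff.rfl

theorem comap_vertexStabilizer_eq {a b : Γ.V} {e : Γ.E a b} {d d' : A.π₁ v₀} {x : A.GV a}
    {y : A.GV b} (h : d * (vertexHom τ a x * edgeElt τ e * vertexHom τ b y) * d'⁻¹ ∈ H) :
    (vertexStabilizer τ H a d).comap ((MulAut.conj x).toMonoidHom.comp (A.α e)) =
      (vertexStabilizer τ H b d').comap ((MulAut.conj y⁻¹).toMonoidHom.comp (A.ω e)) := by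
  ext s
  change d * vertexHom τ a (x * A.α e s * x⁻¹) * d⁻¹ ∈ H ↔
    d' * vertexHom τ b (y⁻¹ * A.ω e s * y⁻¹⁻¹) * d'⁻¹ ∈ H
  rw [← H.mul_mem_cancel_left (H.inv_mem h), ← H.mul_mem_cancel_right h]
  simp only [map_mul, map_inv, eq_mul_inv_of_mul_eq (edgeElt_mul_vertexHom τ e s).symm]
  group

/-- The edge orbits of the Bass–Serre tree crossed by the lift of `p` that starts at `d`. -/
def tracedEdges (τ : ∀ a, A.Path v₀ a) (H : Subgroup (A.π₁ v₀)) :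
    ∀ {a b : Γ.V}, A.π₁ v₀ → A.Path a b → List (EdgeClass τ H)
  | _, _, _, .single _ => []
  | a, _, d, .cons g e p => eMk τ H ⟨_, _, e⟩ (d * vertexHom τ a g) ::
      tracedEdges τ H (d * vertexHom τ a g * edgeElt τ e) p

namespace Skeleton

variable {x : A.π₁ v₀} (S : Skeleton M τ H x)

/-- The words in `Y` represent elements of the stabilizers of the chosen representatives. -/
def InStabilizers (Y : VertexClass τ H → Finset GWord) : Prop :=
  ∀ c, ∀ W ∈ Y c, GWord.eval (M.vGens c.1) W ∈ vertexStabilizer τ H c.1 (S.γ c)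

/-- The element of `A_{o(ε)}` that labels the origin of `ε`. -/
noncomputable def lα (ε : EdgeClass τ H) : A.GV ε.1.1 :=
  GWord.eval (M.vGens ε.1.1) (S.label ε).1

/-- The element of `A_{t(ε)}` that labels the terminus of `ε`. -/
noncomputable def lω (ε : EdgeClass τ H) : A.GV ε.1.2.1 :=
  GWord.eval (M.vGens ε.1.2.1) (S.label ε).2

/-- The vertex groups generated by `Y` contain the stabilizers of the edges of the skeleton. -/
def Saturated (Y : VertexClass τ H → Finset GWord) : Prop :=
  ∀ ε ∈ S.edges,
    (vertexStabilizer τ H ε.1.1 (S.γ ε.org)).comap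
        ((MulAut.conj (S.lα ε)).toMonoidHom.comp (A.α ε.1.2.2)) ≤
      (GWord.span (M.vGens ε.1.1) (Y ε.org).toList).comap
        ((MulAut.conj (S.lα ε)).toMonoidHom.comp (A.α ε.1.2.2)) ∧
    (vertexStabilizer τ H ε.1.2.1 (S.γ ε.inv.org)).comap
        ((MulAut.conj (S.lω ε)⁻¹).toMonoidHom.comp (A.ω ε.1.2.2)) ≤
      (GWord.span (M.vGens ε.1.2.1) (Y ε.inv.org).toList).comap
        ((MulAut.conj (S.lω ε)⁻¹).toMonoidHom.comp (A.ω ε.1.2.2))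

/-- The element `k` carries the chosen representative of the orbit of `d A_a` to `d`,
modulo `H`. -/
def Fits (a : Γ.V) (d : A.π₁ v₀) (k : A.GV a) : Prop :=
  S.γ (vMk τ H a d) * vertexHom τ a k * d⁻¹ ∈ H

variable {S} {Y : VertexClass τ H → Finset GWord}

theorem InStabilizers.span_le (hY : S.InStabilizers Y) (c : VertexClass τ H) :
    GWord.span (M.vGens c.1) (Y c).toList ≤ vertexStabilizer τ H c.1 (S.γ c) := by
  refine (Subgroup.closure_le _).2 ?_
  rintro _ ⟨W, hW, rfl⟩
  exact hY c W (Finset.mem_toList.1 hW)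

theorem InStabilizers.sup (Y Z : VertexClass τ H → Finset GWord) (hY : S.InStabilizers Y)
    (hZ : S.InStabilizers Z) : S.InStabilizers (Y ⊔ Z) :=
  fun c W hW => (Finset.mem_union.1 hW).elim (hY c W) (hZ c W)

theorem inStabilizers_bot : S.InStabilizers ⊥ := fun _ W hW => absurd hW (Finset.notMem_empty W)

theorem eventually_mem {c : VertexClass τ H} {W : GWord}
    (hW : GWord.eval (M.vGens c.1) W ∈ vertexStabilizer τ H c.1 (S.γ c)) :
    EventuallyIn S.InStabilizers fun Y => W ∈ Y c := by
  classical
  refine ⟨Function.update ⊥ c {W}, fun c' V hV => ?_, fun Y hY => hY c ?_⟩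
  · obtain rfl | hc := eq_or_ne c' c
    · rw [Function.update_self, Finset.mem_singleton] at hV
      exact hV ▸ hW
    · rw [Function.update_of_ne hc] at hV
      exact absurd hV (Finset.notMem_empty V)
  · rw [Function.update_self]
    exact Finset.mem_singleton_self W

theorem eventually_comap_le {E : Type*} [Group E] (hE : ∀ K : Subgroup E, K.FG)
    (c : VertexClass τ H) (f : E →* A.GV c.1) : EventuallyIn S.InStabilizers fun Y =>
      (vertexStabilizer τ H c.1 (S.γ c)).comap f ≤
        (GWord.span (M.vGens c.1) (Y c).toList).comap f := by
  obtain ⟨T, hT⟩ := hE ((vertexStabilizer τ H c.1 (S.γ c)).comap f)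
  choose word hword using GWord.exists_eval_eq (M.vGens_closure c.1)
  have hgens : EventuallyIn S.InStabilizers fun Y => ∀ t ∈ (T : Set E), word (f t) ∈ Y c :=
    .forall_mem InStabilizers.sup inStabilizers_bot T.finite_toSet fun t ht => eventually_mem <| by
      rw [hword]
      exact hT.le (Subgroup.subset_closure ht)
  refine hgens.mono fun Y hY => ?_
  rw [← hT, Subgroup.closure_le]
  exact fun t ht => Subgroup.subset_closure ⟨_, Finset.mem_toList.2 (hY t ht), hword _⟩

theorem eventually_saturated (hnoeth : ∀ {a b} (e : Γ.E a b) (K : Subgroup (A.GE e)), K.FG) :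
    EventuallyIn S.InStabilizers S.Saturated :=
  .forall_mem InStabilizers.sup inStabilizers_bot (List.finite_toSet S.edges) fun ε _ =>
    (eventually_comap_le (hnoeth _) ε.org
      ((MulAut.conj (S.lα ε)).toMonoidHom.comp (A.α ε.1.2.2))).and InStabilizers.sup
    (eventually_comap_le (hnoeth _) ε.inv.org
      ((MulAut.conj (S.lω ε)⁻¹).toMonoidHom.comp (A.ω ε.1.2.2)))

theorem comap_span_eq (hY : S.InStabilizers Y) (hS : S.Saturated Y) {ε : EdgeClass τ H}
    (hε : ε ∈ S.edges) : (GWord.span (M.vGens ε.1.1) (Y ε.org).toList).comap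
      ((MulAut.conj (S.lα ε)).toMonoidHom.comp (A.α ε.1.2.2)) =
    (GWord.span (M.vGens ε.1.2.1) (Y ε.inv.org).toList).comap
      ((MulAut.conj (S.lω ε)⁻¹).toMonoidHom.comp (A.ω ε.1.2.2)) :=
  calc
    _ = (vertexStabilizer τ H ε.1.1 (S.γ ε.org)).comap
          ((MulAut.conj (S.lα ε)).toMonoidHom.comp (A.α ε.1.2.2)) :=
      le_antisymm (Subgroup.comap_mono (hY.span_le ε.org)) (hS ε hε).1
    _ = (vertexStabilizer τ H ε.1.2.1 (S.γ ε.inv.org)).comap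
          ((MulAut.conj (S.lω ε)⁻¹).toMonoidHom.comp (A.ω ε.1.2.2)) :=
      comap_vertexStabilizer_eq (S.isLabel ε).mem
    _ = _ := le_antisymm (hS ε hε).2 (Subgroup.comap_mono (hY.span_le ε.inv.org))

theorem eq_of_eval_label_eq (hY : S.InStabilizers Y) {ε ε' : EdgeClass τ H}
    (horg : ε'.org = ε.org) (htyp : ε'.1 = ε.1) {b : A.GV ε.1.1}
    (hb : b ∈ GWord.span (M.vGens ε.1.1) (Y ε.org).toList) {c : A.GE ε.1.2.2}
    (h : GWord.eval (M.vGens ε.1.1) (S.label ε').1 = b * S.lα ε * A.α ε.1.2.2 c) : ε' = ε := by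
  have hmk : eMk τ H ε.1 (S.γ ε'.org * vertexHom τ ε.1.1
      (GWord.eval (M.vGens ε.1.1) (S.label ε').1)) = ε' := htyp ▸ (S.isLabel ε').mk_eq
  rw [← hmk, horg, h]
  refine (eMk_eq_iff.2 ⟨_, hY.span_le ε.org hb, c, ?_⟩).symm.trans (S.isLabel ε).mk_eq
  change _ = S.γ ε.org * vertexHom τ ε.1.1 b * (S.γ ε.org)⁻¹ *
    (S.γ ε.org * vertexHom τ ε.1.1 (S.lα ε)) * _
  rw [map_mul, map_mul]
  group

theorem foldedCode (hY : S.InStabilizers Y) (hS : S.Saturated Y) : M.FoldedCode (S.code Y) := by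
  intro k hk
  obtain ⟨ε, hε, rfl⟩ := exists_edge hk
  refine ⟨ε.1, eTyp_eIdx hε, ?_, fun l hl => ?_⟩
  · rw [org_eIdx hε, ter_eIdx hε, wα_eIdx hε, wω_eIdx hε, vGrp_vIdx (S.org_mem _ hε),
      vGrp_vIdx (inv_org_mem hε)]
    exact comap_span_eq hY hS hε
  · obtain ⟨ε', hε', rfl⟩ := exists_edge hl
    rw [org_eIdx hε, org_eIdx hε', eTyp_eIdx hε, eTyp_eIdx hε', wα_eIdx hε, wα_eIdx hε',
      vGrp_vIdx (S.org_mem _ hε), or_iff_not_imp_left, or_iff_not_imp_left, or_iff_not_imp_left,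
      not_not, not_not, eIdx_inj hε', vIdx_inj (S.org_mem _ hε')]
    exact fun hne horg htyp b hb c heq =>
      hne (eq_of_eval_label_eq hY horg (M.eNum.injective (Fin.ext htyp)) hb heq)

theorem isCodeLabelling (hY : S.InStabilizers Y) {δ : ℕ → A.π₁ v₀}
    (hδ : ∀ c ∈ S.verts, δ (S.vIdx c) = S.γ c) : M.IsCodeLabelling τ (S.code Y) H δ where
  vertex i hi := by
    obtain ⟨c, hc, rfl⟩ := exists_vert hi
    refine ⟨c.1, vTyp_vIdx hc, fun W hW => ?_⟩
    rw [vGrp_vIdx hc, Finset.mem_toList] at hW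
    rw [hδ c hc, Marking.gen, Marking.wordVal_pathWord_vertex]
    exact hY c W hW
  edge k hk := by
    obtain ⟨ε, hε, rfl⟩ := exists_edge hk
    refine ⟨ε.1.1, (hasEdgeType_eIdx hε).vTyp_org, ?_⟩
    rw [org_eIdx hε, ter_eIdx hε, hδ _ (S.org_mem _ hε), hδ _ (inv_org_mem hε),
      AGraphCode.edgePath, eTyp_eIdx hε, wα_eIdx hε, wω_eIdx hε, Marking.gen,
      Marking.wordVal_pathWord_edge]
    exact (S.isLabel ε).mem

theorem Fits.mem_vertexStabilizer {a : Γ.V} {d : A.π₁ v₀} {k k' g : A.GV a} (h : S.Fits a d k)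
    (h' : S.Fits a (d * vertexHom τ a g) k') :
    k * g * k'⁻¹ ∈ vertexStabilizer τ H a (S.γ (vMk τ H a d)) := by
  rw [Fits, vMk_mul_right] at h'
  rw [GraphOfGroups.mem_vertexStabilizer, map_mul, map_mul, map_inv]
  convert H.mul_mem h (H.inv_mem h') using 1
  group

theorem reaches_edge {ε : EdgeClass τ H} (hε : ε ∈ S.edges) :
    M.Reaches τ (S.code Y) (S.vIdx ε.org) (S.vIdx ε.inv.org)
      (vertexHom τ ε.1.1 (S.lα ε) * edgeElt τ ε.1.2.2 * vertexHom τ ε.1.2.1 (S.lω ε)) := by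
  have hreach := Marking.Reaches.edge (τ := τ) (eIdx_lt (Y := Y) hε)
    (hasEdgeType_eIdx hε).vTyp_org (eTyp_eIdx hε)
  rwa [org_eIdx hε, ter_eIdx hε, wα_eIdx hε, wω_eIdx hε] at hreach

theorem exists_fits_edge {a b : Γ.V} {e : Γ.E a b} {d : A.π₁ v₀}
    (hε : eMk τ H ⟨a, b, e⟩ d ∈ S.edges) : ∃ (k : A.GV a) (k' : A.GV b),
      S.Fits a d k ∧ S.Fits b (d * edgeElt τ e) k' ∧
      ∀ Y, M.Reaches τ (S.code Y) (S.vIdx (vMk τ H a d)) (S.vIdx (vMk τ H b (d * edgeElt τ e)))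
        (vertexHom τ a k * edgeElt τ e * (vertexHom τ b k')⁻¹) := by
  set ε := eMk τ H ⟨a, b, e⟩ d
  let l : A.GV a := S.lα ε
  let l' : A.GV b := S.lω ε
  have horg : vMk τ H a d = ε.org := (org_eMk ⟨a, b, e⟩ d).symm
  have hter : vMk τ H b (d * edgeElt τ e) = ε.inv.org := (org_inv_eMk ⟨a, b, e⟩ d).symm
  obtain ⟨h, hh, z, hz⟩ := eMk_eq_iff.1 (S.isLabel ε).mk_eq
  change d = h * (S.γ ε.org * vertexHom τ a l) * vertexHom τ a (A.α e z) at hz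
  have hmem : S.γ ε.org * (vertexHom τ a l * edgeElt τ e * vertexHom τ b l') *
      (S.γ ε.inv.org)⁻¹ ∈ H := (S.isLabel ε).mem
  have hα : vertexHom τ a (A.α e z) =
      edgeElt τ e * vertexHom τ b (A.ω e z) * (edgeElt τ e)⁻¹ :=
    eq_mul_inv_of_mul_eq (edgeElt_mul_vertexHom τ e z).symm
  refine ⟨l * A.α e z, l'⁻¹ * A.ω e z, ?_, ?_, fun Y => ?_⟩
  · rw [Fits, horg, map_mul]
    convert H.inv_mem hh using 1
    rw [hz]
    group
  · rw [Fits, hter, map_mul, map_inv]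
    convert H.mul_mem (H.inv_mem hmem) (H.inv_mem hh) using 1
    rw [hz, hα]
    group
  · rw [horg, hter]
    convert reaches_edge (Y := Y) hε using 1
    change _ = vertexHom τ a l * edgeElt τ e * vertexHom τ b l'
    rw [map_mul, map_mul, map_inv, hα]
    group

theorem eventually_reaches_vertex {a : Γ.V} {d : A.π₁ v₀} (hv : vMk τ H a d ∈ S.verts) {g : A.GV a}
    (hg : g ∈ vertexStabilizer τ H a (S.γ (vMk τ H a d))) : EventuallyIn S.InStabilizers fun Y =>
      M.Reaches τ (S.code Y) (S.vIdx (vMk τ H a d)) (S.vIdx (vMk τ H a d)) (vertexHom τ a g) := by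
  obtain ⟨W, rfl⟩ := GWord.exists_eval_eq (M.vGens_closure a) g
  exact (eventually_mem hg).mono fun Y hY => .vertex (vTyp_vIdx hv)
    ((vGrp_vIdx hv).symm ▸ Finset.mem_toList.2 hY)

theorem eventually_reaches {a b : Γ.V} (p : A.Path a b) :
    ∀ {d : A.π₁ v₀} {k : A.GV a} {k' : A.GV b}, S.Fits a d k → S.Fits b (d * toLoop τ p) k' →
      vMk τ H a d ∈ S.verts → (∀ ε ∈ tracedEdges τ H d p, ε ∈ S.edges) →
      EventuallyIn S.InStabilizers fun Y => M.Reaches τ (S.code Y) (S.vIdx (vMk τ H a d))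
        (S.vIdx (vMk τ H b (d * toLoop τ p)))
        (vertexHom τ a k * toLoop τ p * (vertexHom τ b k')⁻¹) := by
  induction p with
  | @single a g =>
    intro d k k' hk hk' hv _
    rw [toLoop_single] at hk' ⊢
    have hreach := eventually_reaches_vertex hv (hk.mem_vertexStabilizer hk')
    rw [vMk_mul_right, ← map_inv, ← map_mul, ← map_mul]
    exact hreach
  | @cons a b c g e p ih =>
    intro d k k' hk hk' hv hp
    rw [tracedEdges, List.forall_mem_cons] at hp
    obtain ⟨l, l', hl, hl', hedge⟩ := exists_fits_edge hp.1
    have hassoc : d * toLoop τ (Path.cons g e p) =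
        d * vertexHom τ a g * edgeElt τ e * toLoop τ p := by
      simp only [toLoop_cons, mul_assoc]
    rw [hassoc] at hk' ⊢
    have hv' : vMk τ H b (d * vertexHom τ a g * edgeElt τ e) ∈ S.verts :=
      org_inv_eMk (τ := τ) ⟨a, b, e⟩ (d * vertexHom τ a g) ▸ inv_org_mem hp.1
    refine ((eventually_reaches_vertex hv (hk.mem_vertexStabilizer hl)).and InStabilizers.sup
      (ih hl' hk' hv' hp.2)).mono fun Y ⟨hvertex, htail⟩ => ?_
    have hedge' := hedge Y
    rw [vMk_mul_right] at hedge'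
    convert (hvertex.trans hedge').trans htail using 1
    simp only [toLoop_cons, map_mul, map_inv]
    group

theorem eventually_reaches_coset {p : A.Path v₀ v₀} (hp : toLoop τ p = x)
    (hE : ∀ ε ∈ tracedEdges τ H x⁻¹ p, ε ∈ S.edges) : EventuallyIn S.InStabilizers fun Y =>
      M.Reaches τ (S.code Y) (S.vIdx (vMk τ H v₀ x⁻¹)) (S.vIdx (vMk τ H v₀ 1)) x := by
  have hend : x⁻¹ * toLoop τ p = 1 := by rw [hp, inv_mul_cancel]
  have hfits : S.Fits v₀ x⁻¹ 1 := by
    rw [Fits, S.γ_coset, map_one, mul_one, mul_inv_cancel]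
    exact H.one_mem
  have hfits' : S.Fits v₀ (x⁻¹ * toLoop τ p) 1 := by
    rw [hend, Fits, S.γ_one, map_one, mul_one, inv_one, mul_one]
    exact H.one_mem
  have hreach := eventually_reaches p hfits hfits' S.coset_mem hE
  rw [hend] at hreach
  simpa only [map_one, one_mul, inv_one, mul_one, hp] using hreach

theorem eventually_reaches_subgroup {h : A.π₁ v₀} (hh : h ∈ H) {p : A.Path v₀ v₀}
    (hp : toLoop τ p = h) (hE : ∀ ε ∈ tracedEdges τ H 1 p, ε ∈ S.edges) :
    EventuallyIn S.InStabilizers fun Y =>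
      M.Reaches τ (S.code Y) (S.vIdx (vMk τ H v₀ 1)) (S.vIdx (vMk τ H v₀ 1)) h := by
  have hend : vMk τ H v₀ (1 * toLoop τ p) = vMk τ H v₀ 1 :=
    (vMk_eq_iff.2 ⟨h, hh, 1, by rw [hp, map_one, one_mul, mul_one, mul_one]⟩).symm
  have hfits : S.Fits v₀ 1 1 := by
    rw [Fits, S.γ_one, map_one, mul_one, inv_one, mul_one]
    exact H.one_mem
  have hfits' : S.Fits v₀ (1 * toLoop τ p) 1 := by
    rw [Fits, hend, S.γ_one, map_one, mul_one, one_mul, one_mul, hp]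
    exact H.inv_mem hh
  have hreach := eventually_reaches p hfits hfits' S.one_mem hE
  rw [hend] at hreach
  simpa only [map_one, one_mul, inv_one, mul_one, hp] using hreach

theorem isCert {X : List M.Word} {x : M.Word}
    {S : Skeleton M τ (wordSpan (M.gen τ) X) (wordVal (M.gen τ) x)}
    {Y : VertexClass τ (wordSpan (M.gen τ) X) → Finset GWord} (hY : S.InStabilizers Y)
    (hS : S.Saturated Y) {toWord : A.π₁ v₀ → M.Word}
    (hword : ∀ g, wordVal (M.gen τ) (toWord g) = g)
    (hne : vMk τ (wordSpan (M.gen τ) X) v₀ (wordVal (M.gen τ) x)⁻¹ ≠ vMk τ _ v₀ 1)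
    (hcoset : M.Reaches τ (S.code Y) (S.code Y).2.2.1 (S.code Y).2.2.2 (wordVal (M.gen τ) x))
    (hsubgroup : ∀ W ∈ X, M.Reaches τ (S.code Y) (S.code Y).2.2.2 (S.code Y).2.2.2
      (wordVal (M.gen τ) W)) :
    M.IsCert τ X x (S.code Y) (S.verts.map fun c => toWord (S.γ c)) := by
  have hγ : ∀ c ∈ S.verts, wordVal (M.gen τ)
      ((S.verts.map fun c => toWord (S.γ c)).getD (S.vIdx c) []) = S.γ c := by
    classical
    exact fun c hc => (congrArg _ (getD_map_idxOf hc _ _)).trans (hword _)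
  exact
  { wellFormed := wellFormed_code
    folded := foldedCode hY hS
    labelled := isCodeLabelling hY hγ
    ux_lt := vIdx_lt S.coset_mem
    u0_lt := vIdx_lt S.one_mem
    ux_ne_u0 := fun heq => hne ((vIdx_inj S.coset_mem).1 heq)
    vTyp_ux := vTyp_vIdx S.coset_mem
    vTyp_u0 := vTyp_vIdx S.one_mem
    label_ux := by
      have hux := hγ _ S.coset_mem
      rw [S.γ_coset] at hux
      change wordVal _ (List.getD _ (S.vIdx _) [] ++ x) ∈ _
      rw [wordVal_append, hux, inv_mul_cancel]
      exact Subgroup.one_mem _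
    label_u0 := ((hγ _ S.one_mem).trans S.γ_one) ▸ Subgroup.one_mem _
    reaches_coset := hcoset
    reaches_subgroup := hsubgroup }

end Skeleton

theorem exists_skeleton {x : A.π₁ v₀} (hne : vMk τ H v₀ x⁻¹ ≠ vMk τ H v₀ 1)
    (E : List (EdgeClass τ H)) : ∃ S : Skeleton M τ H x, ∀ ε ∈ E, ε ∈ S.edges := by
  classical
  obtain ⟨γ, hγ, hγ_coset, hγ_one⟩ := exists_vertex_reps hne
  obtain ⟨label, label_inv, isLabel⟩ := exists_labels (M := M) hγ
  let edges := (E ++ E.map EdgeClass.inv).dedup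
  have hedges : ∀ ε, ε ∈ edges ↔ ε ∈ E ∨ ε.inv ∈ E := fun ε => by
    rw [List.mem_dedup, List.mem_append,
      List.mem_map_of_involutive EdgeClass.inv_involutive]
  exact
  ⟨{  γ := γ
      label := label
      label_inv := label_inv
      isLabel := isLabel
      verts := (vMk τ H v₀ x⁻¹ :: vMk τ H v₀ 1 :: edges.map EdgeClass.org).dedup
      edges := edges
      verts_nodup := List.nodup_dedup _
      edges_nodup := List.nodup_dedup _
      org_mem := fun ε hε => List.mem_dedup.2 <| List.mem_cons_of_mem _ <|
        List.mem_cons_of_mem _ <| List.mem_map_of_mem hε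
      inv_mem := fun ε hε => (hedges _).2 <| by
        rw [EdgeClass.inv_involutive ε]
        exact ((hedges _).1 hε).symm
      γ_coset := hγ_coset
      γ_one := hγ_one
      coset_mem := List.mem_dedup.2 List.mem_cons_self
      one_mem := List.mem_dedup.2 (List.mem_cons_of_mem _ List.mem_cons_self) },
    fun ε hε => (hedges ε).2 (.inl hε)⟩

theorem vMk_inv_ne_vMk_one {x : A.π₁ v₀} (hno : ∀ y : A.GV v₀, (vertexHom τ v₀ y)⁻¹ * x ∉ H) :
    vMk τ H v₀ x⁻¹ ≠ vMk τ H v₀ 1 := by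
  intro heq
  obtain ⟨h, hh, y, hy⟩ := vMk_eq_iff.1 heq
  refine hno y ?_
  have hy' : (vertexHom τ v₀ y)⁻¹ = h * x⁻¹ := inv_eq_of_mul_eq_one_left hy.symm
  rwa [hy', inv_mul_cancel_right]

theorem exists_toLoop_eq (hτ : τ v₀ = Path.single 1) (g : A.π₁ v₀) :
    ∃ p : A.Path v₀ v₀, toLoop τ p = g := by
  induction g using Quotient.inductionOn with | _ p
  exact ⟨p, (cls_eq_toLoop τ hτ p).symm⟩

theorem Marking.exists_wordVal_gen_eq (M : A.Marking) (hτ : τ v₀ = Path.single 1) (g : A.π₁ v₀) :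
    ∃ W : M.Word, wordVal (M.gen τ) W = g := by
  obtain ⟨p, rfl⟩ := exists_toLoop_eq hτ g
  obtain ⟨P, hP⟩ := M.exists_describes p
  exact ⟨_, hP.wordVal_gen τ⟩

theorem exists_isCert (hnoeth : ∀ {a b} (e : Γ.E a b) (K : Subgroup (A.GE e)), K.FG)
    (hτ : τ v₀ = Path.single 1) (X : List M.Word) (x : M.Word)
    (hno : ∀ y : A.GV v₀, (vertexHom τ v₀ y)⁻¹ * wordVal (M.gen τ) x ∉ wordSpan (M.gen τ) X) :
    ∃ C γ, M.IsCert τ X x C γ := by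
  choose path hpath using exists_toLoop_eq hτ
  choose toWord htoWord using M.exists_wordVal_gen_eq hτ
  have hne := vMk_inv_ne_vMk_one hno
  obtain ⟨S, hE⟩ := exists_skeleton (M := M) hne
    (tracedEdges τ _ (wordVal (M.gen τ) x)⁻¹ (path (wordVal (M.gen τ) x)) ++
      X.flatMap fun W => tracedEdges τ _ 1 (path (wordVal (M.gen τ) W)))
  have hcoset := Skeleton.eventually_reaches_coset (hpath _) fun ε hε =>
    hE ε (List.mem_append_left _ hε)
  have hsubgroup := EventuallyIn.forall_mem Skeleton.InStabilizers.sup Skeleton.inStabilizers_bot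
    (List.finite_toSet X) fun W hW =>
      Skeleton.eventually_reaches_subgroup (wordVal_mem_wordSpan _ hW) (hpath _) fun ε hε =>
        hE ε (List.mem_append_right _ (List.mem_flatMap.2 ⟨W, hW, hε⟩))
  obtain ⟨Y, hY, hlarge⟩ := (Skeleton.eventually_saturated hnoeth).and Skeleton.InStabilizers.sup
    (hcoset.and Skeleton.InStabilizers.sup hsubgroup)
  obtain ⟨hS, hcoset, hsubgroup⟩ := hlarge Y le_rfl
  exact ⟨_, _, Skeleton.isCert hY hS htoWord hne hcoset hsubgroup⟩

end GraphOfGroups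

/-! ## The algorithms -/

theorem inv_smul_coe {G : Type*} [Group G] (H : Subgroup G) (x : G) :
    (x • (H : Set G))⁻¹ = MulOpposite.op x⁻¹ • (H : Set G) := by
  rw [Set.inv_smul_set_distrib, inv_coe_set]

namespace GraphOfGroups

variable {Γ : SerreGraph.{u}} {A : GraphOfGroups.{u, v, w} Γ} {M : A.Marking} {v₀ : Γ.V}
  {τ : ∀ a, A.Path v₀ a}

theorem exists_tree_paths (hΓ : Γ.Connected) (A : GraphOfGroups.{u, v, w} Γ) (v₀ : Γ.V) :
    ∃ τ : ∀ a, A.Path v₀ a, τ v₀ = Path.single 1 := by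
  classical
  have hpath : ∀ a, Nonempty (A.Path v₀ a) := fun a => by
    induction hΓ.2 v₀ a with
    | refl => exact ⟨Path.single 1⟩
    | tail _ hedge ih =>
      obtain ⟨p⟩ := ih
      obtain ⟨e⟩ := hedge
      exact ⟨p.comp (Path.cons 1 e (Path.single 1))⟩
  exact ⟨Function.update (fun a => (hpath a).some) v₀ (Path.single 1), Function.update_self _ _ _⟩

theorem lengthZero_eq_vertexHom (hτ : τ v₀ = Path.single 1) (y : A.GV v₀) :
    A.lengthZero v₀ y = vertexHom τ v₀ y :=
  cls_eq_toLoop τ hτ _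

theorem lengthZero_inv (y : A.GV v₀) : A.lengthZero v₀ y⁻¹ = (A.lengthZero v₀ y)⁻¹ := rfl

namespace Marking

theorem DescribesElt.wordVal_gen (hτ : τ v₀ = Path.single 1) {P : PathCode} {g : A.π₁ v₀}
    (h : M.DescribesElt P g) : wordVal (M.gen τ) (M.pathWord v₀ P) = g := by
  obtain ⟨p, hp, rfl⟩ := h
  rw [hp.wordVal_gen, cls_eq_toLoop τ hτ]

theorem wordSpan_map_pathWord (hτ : τ v₀ = Path.single 1) {X : List PathCode}
    (hX : ∀ Q ∈ X, ∃ h : A.π₁ v₀, M.DescribesElt Q h) :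
    wordSpan (M.gen τ) (X.map (M.pathWord v₀)) =
      Subgroup.closure {h : A.π₁ v₀ | ∃ Q ∈ X, M.DescribesElt Q h} := by
  refine congrArg Subgroup.closure (Set.ext fun g => ?_)
  simp only [Set.mem_ofPred_eq, List.mem_map]
  constructor
  · rintro ⟨_, ⟨Q, hQ, rfl⟩, rfl⟩
    obtain ⟨h, hh⟩ := hX Q hQ
    obtain rfl := hh.wordVal_gen hτ
    exact ⟨Q, hQ, hh⟩
  · rintro ⟨Q, hQ, h⟩
    exact ⟨_, ⟨Q, hQ, rfl⟩, h.wordVal_gen hτ⟩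

theorem computable_map_pathWord (M : A.Marking) (a : Γ.V) {α : Type*} [Primcodable α]
    {f : α → List PathCode} (hf : Computable f) : Computable fun x => (f x).map (M.pathWord a) :=
  (Primrec.list_map Primrec.id ((M.primrec_pathWord a).comp Primrec.snd).to₂).to_comp.comp hf

variable (M) in
/-- A correct output for the left coset `x H`: a word for an element of `A_{v₀}` in `x H`, or, if
there is no such element, the description of a folded `A`-graph that represents `x H`. -/
def IsLeftCosetAnswer (s : GWord ⊕ AGraphCode) (x : A.π₁ v₀) (H : Subgroup (A.π₁ v₀)) : Prop :=
  (∃ W : GWord, s = Sum.inl W ∧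
    A.lengthZero v₀ (GWord.eval (M.vGens v₀) W) • (H : Set (A.π₁ v₀)) =
      x • (H : Set (A.π₁ v₀))) ∨
  ((¬ ∃ y : A.GV v₀, A.lengthZero v₀ y • (H : Set (A.π₁ v₀)) = x • (H : Set (A.π₁ v₀))) ∧
    ∃ C : AGraphCode, s = Sum.inr C ∧
      ∃ (𝔹 : AGraph A) (ux u0 : 𝔹.B.V) (hx : 𝔹.typ ux = v₀) (h0 : 𝔹.typ u0 = v₀),
        M.DescribesAGraph C 𝔹 ux u0 ∧ 𝔹.IsFolded ∧
        𝔹.LAt v₀ ux u0 hx h0 = x • (H : Set (A.π₁ v₀)))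

variable (M) in
/-- A correct output for the right coset `H x`, analogous to `IsLeftCosetAnswer`. -/
def IsRightCosetAnswer (s : GWord ⊕ AGraphCode) (x : A.π₁ v₀) (H : Subgroup (A.π₁ v₀)) : Prop :=
  (∃ W : GWord, s = Sum.inl W ∧
    MulOpposite.op (A.lengthZero v₀ (GWord.eval (M.vGens v₀) W)) • (H : Set (A.π₁ v₀)) =
      MulOpposite.op x • (H : Set (A.π₁ v₀))) ∨
  ((¬ ∃ y : A.GV v₀, MulOpposite.op (A.lengthZero v₀ y) • (H : Set (A.π₁ v₀)) =
      MulOpposite.op x • (H : Set (A.π₁ v₀))) ∧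
    ∃ C : AGraphCode, s = Sum.inr C ∧
      ∃ (𝔹 : AGraph A) (ux u0 : 𝔹.B.V) (hx : 𝔹.typ ux = v₀) (h0 : 𝔹.typ u0 = v₀),
        M.DescribesAGraph C 𝔹 ux u0 ∧ 𝔹.IsFolded ∧
        𝔹.LAt v₀ u0 ux h0 hx = MulOpposite.op x • (H : Set (A.π₁ v₀)))

theorem IsLeftCosetAnswer.right (hτ : τ v₀ = Path.single 1) {s : GWord ⊕ AGraphCode}
    {x : A.π₁ v₀} {H : Subgroup (A.π₁ v₀)} (h : M.IsLeftCosetAnswer s x⁻¹ H) :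
    M.IsRightCosetAnswer (s.map FreeGroup.invRev id) x H := by
  refine h.imp ?_ (And.imp ?_ ?_)
  · rintro ⟨W, rfl, hW⟩
    refine ⟨FreeGroup.invRev W, rfl, ?_⟩
    rw [GWord.eval_eq_wordVal, wordVal_invRev, ← GWord.eval_eq_wordVal, lengthZero_inv,
      ← inv_smul_coe, hW, inv_smul_coe, inv_inv]
  · rintro hno ⟨y, hy⟩
    refine hno ⟨y⁻¹, inv_injective ?_⟩
    rw [inv_smul_coe, inv_smul_coe, lengthZero_inv, inv_inv, inv_inv, hy]
  · rintro ⟨C, rfl, 𝔹, ux, u0, hx, h0, hC, h𝔹, hL⟩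
    refine ⟨C, rfl, 𝔹, ux, u0, hx, h0, hC, h𝔹, ?_⟩
    rw [𝔹.LAt_eq_loops hτ] at hL ⊢
    rw [AGraph.loops_swap, hL, inv_smul_coe, inv_inv]

theorem isLeftCosetAnswer_inl (hτ : τ v₀ = Path.single 1) {W : GWord} {x : A.π₁ v₀}
    {H : Subgroup (A.π₁ v₀)}
    (hW : (vertexHom τ v₀ (GWord.eval (M.vGens v₀) W))⁻¹ * x ∈ H) :
    M.IsLeftCosetAnswer (Sum.inl W) x H :=
  .inl ⟨W, rfl, by rwa [lengthZero_eq_vertexHom hτ, leftCoset_eq_iff]⟩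

theorem IsCert.isLeftCosetAnswer (hτ : τ v₀ = Path.single 1) {X : List M.Word} {x : M.Word}
    {C : AGraphCode} {γ : List M.Word} (h : M.IsCert τ X x C γ) :
    M.IsLeftCosetAnswer (Sum.inr C) (wordVal (M.gen τ) x) (wordSpan (M.gen τ) X) := by
  obtain ⟨𝔹, ux, u0, hx, h0, hne, hC, h𝔹, hloops⟩ := h.exists_aGraph
  refine .inr ⟨?_, C, rfl, 𝔹, ux, u0, hx, h0, hC, h𝔹, (𝔹.LAt_eq_loops hτ hx h0).trans hloops⟩
  rintro ⟨y, hy⟩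
  refine hne (h𝔹.eq_of_vertexHom_mem_loops (τ := τ) (y := y) hx h0 ?_)
  rw [hloops, ← hy, lengthZero_eq_vertexHom hτ]
  exact mem_own_leftCoset (wordSpan (M.gen τ) X).toSubmonoid _

variable (M) in
/-- The word in the generators of `A_{v₀}` that a word represents if `v₀` is the only vertex and
there are no edges. -/
def vertexPart (W : M.Word) : GWord := W.map fun l => (l.1.elim (fun _ => 0) Prod.snd, l.2)

theorem computable_vertexPart : Computable M.vertexPart := by
  have hindex : Primrec fun l : M.Letter => l.elim (fun _ => 0) Prod.snd :=
    (Primrec.sumCasesOn Primrec.id (Primrec.const 0).to₂ (Primrec.snd.comp Primrec.snd).to₂).of_eq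
      fun l => by cases l <;> rfl
  exact (Primrec.list_map Primrec.id ((hindex.comp (Primrec.fst.comp Primrec.snd)).pair
    (Primrec.snd.comp Primrec.snd)).to₂).to_comp

theorem vertexHom_eval_vertexPart (hV : ∀ a, v₀ = a) (hE : ∀ a b, IsEmpty (Γ.E a b))
    (W : M.Word) : vertexHom τ v₀ (GWord.eval (M.vGens v₀) (M.vertexPart W)) =
      wordVal (M.gen τ) W := by
  have hletter : ∀ l : M.Letter,
      vertexHom τ v₀ ((M.vGens v₀).getD (l.elim (fun _ => 0) Prod.snd) 1) = M.gen τ l := by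
    rintro (k | x)
    · exact ((hE _ _).false (M.eNum.symm k).2.2).elim
    · exact congrArg (fun a => vertexHom τ a ((M.vGens a).getD x.2 1)) (hV (M.vNum.symm x.1))
  rw [GWord.eval_eq_wordVal, map_wordVal, vertexPart,
    wordVal_map fun l : M.Letter => l.elim (fun _ => 0) Prod.snd]
  simp only [hletter]

end Marking

theorem Benign.rePred_coset_search (hA : Benign M) (hedge : ∀ a : Γ.V, ∃ b, Nonempty (Γ.E a b))
    (hτ : τ v₀ = Path.single 1) :
    REPred fun x : (List M.Word × M.Word) × (GWord ⊕ AGraphCode) =>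
      (∃ W : GWord, x.2 = Sum.inl W ∧ (vertexHom τ v₀ (GWord.eval (M.vGens v₀) W))⁻¹ *
        wordVal (M.gen τ) x.1.2 ∈ wordSpan (M.gen τ) x.1.1) ∨
      ∃ y : AGraphCode × List M.Word, x.2 = Sum.inr y.1 ∧ M.IsCert τ x.1.1 x.1.2 y.1 y.2 := by
  have hword := hA.rePred_wordVal_gen_eq_one hedge hτ
  have hmem : REPred fun x : ((List M.Word × M.Word) × (GWord ⊕ AGraphCode)) × GWord =>
      (vertexHom τ v₀ (GWord.eval (M.vGens v₀) x.2))⁻¹ * wordVal (M.gen τ) x.1.1.2 ∈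
        wordSpan (M.gen τ) x.1.1.1 :=
    (rePred_mem_wordSpan hword (f := fun x : ((List M.Word × M.Word) × (GWord ⊕ AGraphCode)) ×
      GWord => FreeGroup.invRev (M.pathWord v₀ (x.2, [])) ++ x.1.1.2) (X := fun x => x.1.1.1)
      (by fun_prop) (by fun_prop)).of_eq fun x => by
        rw [wordVal_append, wordVal_invRev, Marking.gen, Marking.wordVal_pathWord_vertex]
  have hcert := rePred_comp (hA.rePred_isCert hword)
    (f := fun x : ((List M.Word × M.Word) × (GWord ⊕ AGraphCode)) × AGraphCode × List M.Word =>
      (x.1.1, x.2)) (by fun_prop)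
  exact rePred_or
    (rePred_exists <| rePred_and
      (rePred_eq (by fun_prop) (Primrec.sumInl.to_comp.comp Computable.snd)) hmem)
    (rePred_exists <| rePred_and
      (rePred_eq (by fun_prop) (Primrec.sumInr.to_comp.comp (by fun_prop))) hcert)

theorem Benign.exists_left_coset_algorithm_of_edges (hA : Benign M)
    (hedge : ∀ a : Γ.V, ∃ b, Nonempty (Γ.E a b)) (hτ : τ v₀ = Path.single 1) :
    ∃ F : List M.Word × M.Word → GWord ⊕ AGraphCode, Computable F ∧ ∀ X x,
      M.IsLeftCosetAnswer (F (X, x)) (wordVal (M.gen τ) x) (wordSpan (M.gen τ) X) := by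
  obtain ⟨F, hF, hsearch⟩ := exists_computable_of_rePred
    (p := fun (z : List M.Word × M.Word) (s : GWord ⊕ AGraphCode) =>
      (∃ W : GWord, s = Sum.inl W ∧ (vertexHom τ v₀ (GWord.eval (M.vGens v₀) W))⁻¹ *
        wordVal (M.gen τ) z.2 ∈ wordSpan (M.gen τ) z.1) ∨
      ∃ y : AGraphCode × List M.Word, s = Sum.inr y.1 ∧ M.IsCert τ z.1 z.2 y.1 y.2)
    (hA.rePred_coset_search hedge hτ) fun z => by
      by_cases hno : ∃ y : A.GV v₀,
          (vertexHom τ v₀ y)⁻¹ * wordVal (M.gen τ) z.2 ∈ wordSpan (M.gen τ) z.1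
      · obtain ⟨y, hy⟩ := hno
        obtain ⟨W, rfl⟩ := GWord.exists_eval_eq (M.vGens_closure v₀) y
        exact ⟨_, .inl ⟨W, rfl, hy⟩⟩
      · obtain ⟨C, γ, hC⟩ := exists_isCert hA.noetherian hτ z.1 z.2 (not_exists.1 hno)
        exact ⟨_, .inr ⟨(C, γ), rfl, hC⟩⟩
  refine ⟨F, hF, fun X x => ?_⟩
  rcases hsearch (X, x) with ⟨W, hs, hW⟩ | ⟨y, hs, hy⟩
  · exact hs ▸ Marking.isLeftCosetAnswer_inl hτ hW
  · exact hs ▸ hy.isLeftCosetAnswer hτ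

theorem Benign.exists_left_coset_algorithm (hA : Benign M) (hτ : τ v₀ = Path.single 1) :
    ∃ F : List M.Word × M.Word → GWord ⊕ AGraphCode, Computable F ∧ ∀ X x,
      M.IsLeftCosetAnswer (F (X, x)) (wordVal (M.gen τ) x) (wordSpan (M.gen τ) X) := by
  by_cases hedge : ∀ a : Γ.V, ∃ b, Nonempty (Γ.E a b)
  · exact hA.exists_left_coset_algorithm_of_edges hedge hτ
  obtain ⟨a, ha⟩ := not_forall.1 hedge
  have heq : ∀ b, a = b := fun b => (hA.connected.2 a b).cases_head.resolve_right
    fun ⟨c, hc, _⟩ => ha ⟨c, hc⟩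
  obtain rfl := heq v₀
  have hE : ∀ b c, IsEmpty (Γ.E b c) := fun b c => ⟨fun e => by
    obtain rfl := heq b
    exact ha ⟨c, ⟨e⟩⟩⟩
  refine ⟨fun z => Sum.inl (M.vertexPart z.2),
    Primrec.sumInl.to_comp.comp (Marking.computable_vertexPart.comp Computable.snd), fun X x =>
      Marking.isLeftCosetAnswer_inl hτ ?_⟩
  rw [Marking.vertexHom_eval_vertexPart heq hE, inv_mul_cancel]
  exact one_mem _

end GraphOfGroups

theorem mainTheorem11 {Γ : SerreGraph.{u}} (A : GraphOfGroups.{u, v, w} Γ) (M : A.Marking)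
    (hA : GraphOfGroups.Benign M) (v₀ : Γ.V) :
    -- left cosets
    (∃ F : List PathCode × PathCode → GWord ⊕ AGraphCode, Computable F ∧
      ∀ (X : List PathCode) (P : PathCode) (x : A.π₁ v₀) (H : Subgroup (A.π₁ v₀)),
        (∀ Q ∈ X, ∃ h : A.π₁ v₀, M.DescribesElt Q h) →
        H = Subgroup.closure {h | ∃ Q ∈ X, M.DescribesElt Q h} →
        M.DescribesElt P x →
        (∃ W : GWord, F (X, P) = Sum.inl W ∧
          A.lengthZero v₀ (GWord.eval (M.vGens v₀) W) • (H : Set (A.π₁ v₀)) =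
            x • (H : Set (A.π₁ v₀))) ∨
        ((¬ ∃ y : A.GV v₀,
            A.lengthZero v₀ y • (H : Set (A.π₁ v₀)) = x • (H : Set (A.π₁ v₀))) ∧
          ∃ C : AGraphCode, F (X, P) = Sum.inr C ∧
            ∃ (𝔹 : AGraph A) (ux u0 : 𝔹.B.V) (hx : 𝔹.typ ux = v₀) (h0 : 𝔹.typ u0 = v₀),
              M.DescribesAGraph C 𝔹 ux u0 ∧ 𝔹.IsFolded ∧
              𝔹.LAt v₀ ux u0 hx h0 = x • (H : Set (A.π₁ v₀)))) ∧
    -- right cosets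
    (∃ F : List PathCode × PathCode → GWord ⊕ AGraphCode, Computable F ∧
      ∀ (X : List PathCode) (P : PathCode) (x : A.π₁ v₀) (H : Subgroup (A.π₁ v₀)),
        (∀ Q ∈ X, ∃ h : A.π₁ v₀, M.DescribesElt Q h) →
        H = Subgroup.closure {h | ∃ Q ∈ X, M.DescribesElt Q h} →
        M.DescribesElt P x →
        (∃ W : GWord, F (X, P) = Sum.inl W ∧
          MulOpposite.op (A.lengthZero v₀ (GWord.eval (M.vGens v₀) W)) • (H : Set (A.π₁ v₀)) =
            MulOpposite.op x • (H : Set (A.π₁ v₀))) ∨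
        ((¬ ∃ y : A.GV v₀,
            MulOpposite.op (A.lengthZero v₀ y) • (H : Set (A.π₁ v₀)) =
              MulOpposite.op x • (H : Set (A.π₁ v₀))) ∧
          ∃ C : AGraphCode, F (X, P) = Sum.inr C ∧
            ∃ (𝔹 : AGraph A) (ux u0 : 𝔹.B.V) (hx : 𝔹.typ ux = v₀) (h0 : 𝔹.typ u0 = v₀),
              M.DescribesAGraph C 𝔹 ux u0 ∧ 𝔹.IsFolded ∧
              𝔹.LAt v₀ u0 ux h0 hx = MulOpposite.op x • (H : Set (A.π₁ v₀)))) := by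
  obtain ⟨τ, hτ⟩ := GraphOfGroups.exists_tree_paths hA.connected A v₀
  obtain ⟨F, hF, hanswer⟩ := hA.exists_left_coset_algorithm hτ
  have hX := M.computable_map_pathWord v₀ (Computable.fst (α := List PathCode) (β := PathCode))
  refine ⟨⟨fun z => F (z.1.map (M.pathWord v₀), M.pathWord v₀ z.2), hF.comp (hX.pair (by fun_prop)),
      fun X P x H hdescribed hH hP => ?_⟩,
    ⟨fun z => (F (z.1.map (M.pathWord v₀), FreeGroup.invRev (M.pathWord v₀ z.2))).map
        FreeGroup.invRev id,
      (computable_sumMap primrec_invRev.to_comp Computable.id).comp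
        (hF.comp (hX.pair (by fun_prop))),
      fun X P x H hdescribed hH hP => ?_⟩⟩
  · have h := hanswer (X.map (M.pathWord v₀)) (M.pathWord v₀ P)
    rw [hP.wordVal_gen hτ, GraphOfGroups.Marking.wordSpan_map_pathWord hτ hdescribed, ← hH] at h
    exact h
  · have h := hanswer (X.map (M.pathWord v₀)) (FreeGroup.invRev (M.pathWord v₀ P))
    rw [wordVal_invRev, hP.wordVal_gen hτ,
      GraphOfGroups.Marking.wordSpan_map_pathWord hτ hdescribed, ← hH] at h
    exact h.right hτ
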